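/- **Setting.** Fix $B\ge 1$, a discrete prior $P_0=\sum_{k=1}^K p_k\delta_{\mathbf a_k}$ on $\mathbb R^B$ (finitely many atoms, $p_k\ge 0$, $\sum_k p_k=1$), a noise variance $\Delta>0$ and a measurement rate $\alpha>0$. The signal $\mathbf S=(\mathbf S_1,\dots,\mathbf S_L)$ has $L$ i.i.d. sections $\mathbf S_l\sim P_0$, so $N=LB$ components, and one observes $\mathbf Y=\boldsymbol\Phi\mathbf S+\sqrt\Delta\,\mathbf Z\in\mathbb R^M$ with $\mathbf Z\sim\mathcal N(0,I_M)$, where $\boldsymbol\Phi\in\mathbb R^{M\times N}$ is known, has independent centered Gaussian entries, and $\boldsymbol\Phi,\mathbf S,\mathbf Z$ are independent. With $P(\mathbf y|\mathbf x)=(2\pi\Delta)^{-M/2}\exp(-\|\boldsymbol\Phi\mathbf x-\mathbf y\|^2/(2\Delta))$ and $P(\mathbf y)=\int P(\mathbf y|\mathbf x)\prod_l dP_0(\mathbf x_l)$, the mutual information (MI) per section is $\frac1L\mathbb E_{\boldsymbol\Phi,\mathbf S,\mathbf Z}\big[\ln\frac{P(\mathbf Y|\mathbf S)}{P(\mathbf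 Y)}\big]$. The limit $L\to\infty$ means $L,M\to\infty$ with $M/N\to\alpha$ (in particular it covers $M/N=\alpha$ fixed). * *CS model*: all entries of $\boldsymbol\Phi$ have variance $1/L$; its MI per section is $i^{\rm cs}$. * *Spatially coupled models*: for $\Gamma$ odd dividing $L$ and $M$, the matrix is divided into $\Gamma\times\Gamma$ blocks of $M/\Gamma$ rows and $N/\Gamma$ columns ($L/\Gamma$ sections each), and the entries of block $(r,c)$ have variance $J_{r,c}/L$. * *Periodic model* (MI per section $i^{\rm per}_{\Gamma,w}$): $J_{r,c}=\Gamma/(2w+1)$ if $|r-c|\le w$ modulo $\Gamma$, and $J_{r,c}=0$ otherwise. * *Seeded model*: $J_{r,c}=\Gamma/\#\{c'\in\{1,\dots,\Gamma\}:|r-c'|\le w\}$ if $|r-c|\le w$ (no periodicity), and $0$ otherwise; moreover the sections in the boundary blocks $\mathcal B=\{1,\dots,4w\}\cup\{\Gamma-4w+1,\dots,\Gamma\}$ are known. Its MI per section is $i^{\rm seed}_{\Gamma,w}=\frac1L\mathbb E\big[\ln\frac{P(\mathbf Y|\mathbf S)}{P(\mathbf Y|\mathbf S_{\mathcal B})}\big]$,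 where $P(\mathbf y|\mathbf s_{\mathcal B})$ is the average of $P(\mathbf y|\mathbf x)$ over i.i.d. sections $\sim P_0$ outside $\mathcal B$, those in $\mathcal B$ being equal to $\mathbf s_{\mathcal B}$. **Theorem (Invariance of the MI).** The following limits exist and are equal, for every odd $\Gamma$ and every $w\in\{0,\dots,(\Gamma-1)/2\}$: $$\lim_{L\to\infty} i^{\rm per}_{\Gamma,w}=\lim_{L\to\infty} i^{\rm cs}.$$ Moreover, for every fixed $w$, the limit $\lim_{L\to\infty}i^{\rm seed}_{\Gamma,w}$ exists for every odd $\Gamma\ge 2w+1$, and, along odd $\Gamma$, $$\lim_{\Gamma\to\infty}\lim_{L\to\infty} i^{\rm seed}_{\Gamma,w}=\lim_{L\to\infty} i^{\rm cs}.$$ -/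

import Mathlib

open MeasureTheory ProbabilityTheory Filter Topology
open scoped NNReal ENNReal

noncomputable section

namespace LinearEstimation

/-- A discrete prior on `ℝ^B`: the law `∑ k, p k • δ_{a k}` with finitely many atoms `a k`.
(The atoms are automatically bounded since there are finitely many of them.) -/
structure DiscretePrior (B : ℕ) where
  /-- number of atoms -/
  K : ℕ
  /-- weights -/
  p : Fin K → ℝ≥0
  /-- atoms -/
  a : Fin K → Fin B → ℝ
  sum_p : ∑ k, p k = 1

/-- The law of one section. -/
def DiscretePrior.measure {B : ℕ} (P : DiscretePrior B) : Measure (Fin B → ℝ) :=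
  ∑ k, (P.p k : ℝ≥0∞) • Measure.dirac (P.a k)

instance DiscretePrior.isProbabilityMeasure_measure {B : ℕ} (P : DiscretePrior B) :
    IsProbabilityMeasure P.measure := by
  constructor
  have h := P.sum_p
  simp only [DiscretePrior.measure, Measure.coe_finsetSum, Finset.sum_apply, Measure.smul_apply,
    measure_univ, smul_eq_mul, mul_one]
  exact_mod_cast h

section General

/-! A linear Gaussian observation model with measurements indexed by `R`, and a signal made of
`B`-dimensional sections indexed by `C`. -/

variable {R C : Type} [Fintype R] [Fintype C] {B : ℕ}

/-- The law of the signal: i.i.d. sections drawn from the prior. -/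
def signalLaw (C : Type) [Fintype C] {B : ℕ} (P : DiscretePrior B) : Measure (C → Fin B → ℝ) :=
  Measure.pi fun _ => P.measure

/-- The law of the measurement matrix: independent centered Gaussian entries; the entry in
row `μ` and column `(c, j)` has variance `V μ c`. -/
def matrixLaw (B : ℕ) (V : R → C → ℝ≥0) : Measure (R → C → Fin B → ℝ) :=
  Measure.pi fun μ => Measure.pi fun c => Measure.pi fun _ => gaussianReal 0 (V μ c)

/-- The law of the standardized noise. -/
def noiseLaw (R : Type) [Fintype R] : Measure (R → ℝ) :=
  Measure.pi fun _ => gaussianReal 0 1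

/-- The matrix-vector product `φ x`. -/
def proj (φ : R → C → Fin B → ℝ) (x : C → Fin B → ℝ) : R → ℝ :=
  fun μ => ∑ c, ∑ j, φ μ c j * x c j

/-- The measurements `y = φ s + √Δ z`. -/
def measurements (Δ : ℝ) (φ : R → C → Fin B → ℝ) (s : C → Fin B → ℝ) (z : R → ℝ) : R → ℝ :=
  fun μ => proj φ s μ + z μ * √Δ

/-- The transition density `P(y | x)` of the additive white Gaussian noise channel. -/
def channelDensity (Δ : ℝ) (φ : R → C → Fin B → ℝ) (x : C → Fin B → ℝ) (y : R → ℝ) : ℝ :=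
  (2 * Real.pi * Δ) ^ (-(Fintype.card R : ℝ) / 2) *
    Real.exp (-(1 / (2 * Δ)) * ∑ μ, (proj φ x μ - y μ) ^ 2)

/-- The density of the measurements when the sections `c` with `known c` are revealed to be those
of `s`, the others being averaged over the prior. If no section is known, it is the
marginal density `P(y)`. -/
def evidence (P : DiscretePrior B) (Δ : ℝ) (known : C → Prop) [DecidablePred known]
    (φ : R → C → Fin B → ℝ) (s : C → Fin B → ℝ) (y : R → ℝ) : ℝ :=
  ∫ x, channelDensity Δ φ (fun c => if known c then s c else x c) y ∂(signalLaw C P)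

/-- The mutual information per section,
`(1 / L) E[ln (P(Y | S) / P(Y | known sections of S))]`, between the unknown part of the signal
and the measurements, given the known part, averaged over the measurement matrix; `L = |C|`.
If no section is known, it is
`(1 / L) E[ln (P(S, Y) / (P₀(S) P(Y)))] = (1 / L) E_Φ[I(S; Y)]`. -/
def mutualInfo (P : DiscretePrior B) (Δ : ℝ) (V : R → C → ℝ≥0)
    (known : C → Prop) [DecidablePred known] : ℝ :=
  (1 / (Fintype.card C : ℝ)) *
    ∫ φ, ∫ s, ∫ z,
      Real.log (channelDensity Δ φ s (measurements Δ φ s z) /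
        evidence P Δ known φ s (measurements Δ φ s z))
      ∂(noiseLaw R) ∂(signalLaw C P) ∂(matrixLaw B V)

end General

section Models

variable {B : ℕ}

/-- The uncoupled model with `L` sections and `M` measurements: the entries of the measurement
matrix are i.i.d. of variance `1 / L`. -/
def miCS (P : DiscretePrior B) (Δ : ℝ) (L M : ℕ) : ℝ :=
  mutualInfo (R := Fin M) (C := Fin L) P Δ (fun _ _ => 1 / (L : ℝ≥0)) (fun _ => False)

/-- Distance `|r - c|` of two block indices. -/
def blockDist {Γ : ℕ} (r c : Fin Γ) : ℕ := ((r : ℤ) - (c : ℤ)).natAbs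

/-- Periodic variance matrix: `Γ / (2w+1)` if `|r - c| ≤ w` modulo `Γ`, and `0` otherwise. -/
def Jper (Γ w : ℕ) (r c : Fin Γ) : ℝ≥0 :=
  if blockDist r c ≤ w ∨ Γ - blockDist r c ≤ w then (Γ : ℝ≥0) / (2 * w + 1) else 0

/-- Open variance matrix: the window is cut at the boundaries, where the coupling strength is
increased so that every block-row has the same total strength `∑ c, J r c = Γ`. -/
def Jopen (Γ w : ℕ) (r c : Fin Γ) : ℝ≥0 :=
  if blockDist r c ≤ w then
    (Γ : ℝ≥0) / ((Finset.univ.filter fun c' : Fin Γ => blockDist r c' ≤ w).card : ℝ≥0)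
  else 0

/-- Variances of the entries of a spatially coupled matrix made of `Γ × Γ` blocks, with `m` rows
per block-row and `ℓ` sections per block-column, hence `L = Γ ℓ` sections in total: the entries of
block `(r, c)` have variance `J r c / L`. -/
def blockVariance {Γ : ℕ} (J : Fin Γ → Fin Γ → ℝ≥0) (ℓ m : ℕ) :
    Fin Γ × Fin m → Fin Γ × Fin ℓ → ℝ≥0 :=
  fun μ c => J μ.1 c.1 / ((Γ * ℓ : ℕ) : ℝ≥0)

/-- The boundary blocks: the first `4w` and the last `4w` ones (indices start at `0`). -/
def IsBoundary {Γ : ℕ} (w : ℕ) (c : Fin Γ) : Prop := (c : ℕ) < 4 * w ∨ Γ ≤ (c : ℕ) + 4 * w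

instance {Γ : ℕ} (w : ℕ) : DecidablePred (IsBoundary (Γ := Γ) w) := fun c => by
  unfold IsBoundary; infer_instance

/-- Mutual information per section of the periodic spatially coupled model. -/
def miPer (P : DiscretePrior B) (Δ : ℝ) (Γ w ℓ m : ℕ) : ℝ :=
  mutualInfo P Δ (blockVariance (Jper Γ w) ℓ m) (fun _ => False)

/-- Mutual information per section of the seeded spatially coupled model: the measurement matrix
is the open one, and the sections of the boundary blocks are known. -/
def miSeed (P : DiscretePrior B) (Δ : ℝ) (Γ w ℓ m : ℕ) : ℝ :=
  mutualInfo P Δ (blockVariance (Jopen Γ w) ℓ m) (fun c => IsBoundary w c.1)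

/-- The thermodynamic limit for pairs (number of sections, number of measurements): the number of
sections tends to infinity and the ratio `M / N = M / (L B)` tends to the measurement rate `α`.
For block models it is applied to the sizes `(ℓ, m) = (L / Γ, M / Γ)` of a block, for which the
ratio is the same. -/
def thermodynamicLimit (B : ℕ) (α : ℝ) : Filter (ℕ × ℕ) :=
  comap (fun q : ℕ × ℕ => q.1) atTop ⊓
    comap (fun q : ℕ × ℕ => (q.2 : ℝ) / ((q.1 : ℝ) * (B : ℝ))) (𝓝 α)

end Models

end LinearEstimation

end

/-!
The mutual information is written as a loss of entropy. With finitely many atoms, a signal with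
sections indexed by `C` is a configuration `σ : C → A`, and the posterior is a vector of
nonnegative weights on configurations. The entropy `eta` is extended to unnormalized weights by
`1`-homogeneity. Under the reference law where the observations are standard Gaussian, measuring
one row multiplies the weights by a likelihood, so that the measurement of a row becomes a linear
operator `obs` acting on functionals of the weights. These operators commute (`obs_comm`), and the
mutual information is `gain x l w = eta w - obsList x l eta w`, where `l` lists the standard
deviations of the rows (`card_mul_mutualInfo`).

**Comparison of rows.** The information gained from one row is at most that of a Gaussian signal of
the same variance `V`, namely `log (1 + V) / 2` (`eta_sub_obs_le`). If the types of the sections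
are almost pairwise independent under the current weights, the squared deviation of the signal
seen by the row concentrates and the overlap of two replicas is small, and a chi-square estimate
restricted to the typical configurations shows that the Gaussian bound is almost attained
(`le_eta_sub_obs`, `log_le_eta_sub_obs`). Since `log (1 + V)` is concave and `V` is linear in the
variances of the entries, replacing a row by a random row with the same average variances can only
lose information (`obs_le_mix`).

**Removal of correlations.** Pairwise dependence is not small in general, but disclosing a random
section increases the average collision probability of the sections, which is bounded, by at least
the average squared pairwise covariance (`pairDep_le_reveal_collision`). The increments telescope,
hence after the disclosure of a random number of sections less than `T` the dependence is on
average at most `1 / T`. The disclosure costs a bounded amount of entropy and commutes with all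
the operators `obs`, so that the comparison may be applied to the rows one after the other
(`obs_avgReveal_le_mix`). This gives `exists_gain_comparison`: in a large system the rows may be
replaced by independent random rows with the same average variances, at the price of an error
which is small compared to the number of rows.

**Consequences.** The comparison is used for designs made of blocks (`exists_blockGain_le`).
* A large system dominates many decoupled copies of a small one, each row being replaced by a row of
  a random copy; this almost superadditivity yields the existence of all the limits
  (`exists_mul_blockGain_le`, `exists_tendsto_blockGain`).
* The rows of the uncoupled system average the rows of the periodic one, which in turn average the
  rows of `Γ` decoupled uncoupled systems. The periodic system is thus squeezed between uncoupled
  systems of sizes `ℓ` and `Γ * ℓ` (`exists_miPer_le`, `exists_miCS_le`).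
* Away from the boundary the open variance profile coincides with the periodic one
  (`Jopen_eq_Jper`), so the seeded system is the periodic one with the boundary sections known. This
  changes the mutual information by at most twice the entropy of these sections, of order `w / Γ`
  per section (`miPer_le_miSeed`).
-/

set_option linter.unusedSectionVars false

noncomputable section

namespace LinearEstimation

/-! ### Scalar Gaussian integrals -/

/-- The likelihood ratio `N(u, 1) / N(0, 1)` at the observation `y`. -/
def lik (u y : ℝ) : ℝ := Real.exp (y * u - u ^ 2 / 2)

lemma lik_pos (u y : ℝ) : 0 < lik u y := Real.exp_pos _

lemma log_lik (u y : ℝ) : Real.log (lik u y) = y * u - u ^ 2 / 2 := Real.log_exp _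

lemma measurable_lik : Measurable fun p : ℝ × ℝ => lik p.1 p.2 := by
  unfold lik; fun_prop

/-- Integral of the exponential of a quadratic polynomial against the standard Gaussian. -/
lemma integral_exp_quadratic_stdGaussian {b : ℝ} (hb : b < 1 / 2) (c d : ℝ) :
    Integrable (fun y => Real.exp (b * y ^ 2 + c * y + d)) (gaussianReal 0 1) ∧
    ∫ y, Real.exp (b * y ^ 2 + c * y + d) ∂(gaussianReal 0 1) =
      (√(1 - 2 * b))⁻¹ * Real.exp (c ^ 2 / (2 * (1 - 2 * b)) + d) := by
  have hr : 0 < 1 - 2 * b := by linarith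
  set r := 1 - 2 * b with hrdef
  have hbr : b = (1 - r) / 2 := by rw [hrdef]; ring
  let v : ℝ≥0 := ⟨1 / r, by positivity⟩
  have hv : v ≠ 0 := by
    intro h; have : (1 / r) = 0 := congrArg NNReal.toReal h
    have : 0 < 1 / r := by positivity
    linarith
  have key : ∀ y, gaussianPDFReal 0 1 y * Real.exp (b * y ^ 2 + c * y + d) =
      ((√r)⁻¹ * Real.exp (c ^ 2 / (2 * r) + d)) * gaussianPDFReal (c / r) v y := by
    intro y
    have hs : √(2 * Real.pi * (1 / r)) = √(2 * Real.pi) * (√r)⁻¹ := by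
      rw [Real.sqrt_mul (by positivity), one_div, Real.sqrt_inv]
    have hvv : (v : ℝ) = 1 / r := rfl
    have h1 : 0 < √r := Real.sqrt_pos.2 hr
    have h2 : 0 < √(2 * Real.pi) := Real.sqrt_pos.2 (by positivity)
    simp only [gaussianPDFReal, hvv, NNReal.coe_one, mul_one, hs, sub_zero]
    have : (√r)⁻¹ * Real.exp (c ^ 2 / (2 * r) + d) *
        ((√(2 * Real.pi) * (√r)⁻¹)⁻¹ * Real.exp (-(y - c / r) ^ 2 / (2 * (1 / r)))) =
        (√(2 * Real.pi))⁻¹ * (Real.exp (c ^ 2 / (2 * r) + d) *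
          Real.exp (-(y - c / r) ^ 2 / (2 * (1 / r)))) := by
      field_simp
    rw [this, mul_assoc, ← Real.exp_add, ← Real.exp_add]
    congr 2
    rw [hbr]; field_simp; ring
  constructor
  · rw [gaussianReal_of_var_ne_zero _ one_ne_zero]
    rw [integrable_withDensity_iff_integrable_smul' (measurable_gaussianPDF _ _)
      (ae_of_all _ fun _ => gaussianPDF_lt_top)]
    simp only [toReal_gaussianPDF, smul_eq_mul, key]
    exact (integrable_gaussianPDFReal _ _).const_mul _
  · rw [integral_gaussianReal_eq_integral_smul one_ne_zero]
    simp only [smul_eq_mul, key]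
    rw [integral_const_mul, integral_gaussianPDFReal_eq_one _ hv, mul_one]

lemma withDensity_lik (u : ℝ) :
    (gaussianReal 0 1).withDensity (fun y => ENNReal.ofReal (lik u y)) = gaussianReal u 1 := by
  have hm : Measurable fun y => ENNReal.ofReal (lik u y) := by unfold lik; fun_prop
  rw [gaussianReal_of_var_ne_zero _ one_ne_zero, gaussianReal_of_var_ne_zero _ one_ne_zero,
    ← withDensity_mul _ (measurable_gaussianPDF _ _) hm]
  congr 1
  ext y
  simp only [Pi.mul_apply, gaussianPDF]
  rw [← ENNReal.ofReal_mul (gaussianPDFReal_nonneg _ _ _)]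
  congr 1
  simp only [gaussianPDFReal, lik, mul_assoc, ← Real.exp_add]
  congr 2
  simp; ring

lemma integral_mul_lik (F : ℝ → ℝ) (u : ℝ) :
    ∫ y, F y * lik u y ∂(gaussianReal 0 1) = ∫ y, F y ∂(gaussianReal u 1) := by
  have hm : Measurable fun y => ENNReal.ofReal (lik u y) := by unfold lik; fun_prop
  rw [← withDensity_lik u, integral_withDensity_eq_integral_toReal_smul hm (by simp)]
  simp [ENNReal.toReal_ofReal (lik_pos _ _).le, mul_comm]

lemma integrable_mul_lik {F : ℝ → ℝ} {u : ℝ} (h : Integrable F (gaussianReal u 1)) :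
    Integrable (fun y => F y * lik u y) (gaussianReal 0 1) := by
  have hm : Measurable fun y => ENNReal.ofReal (lik u y) := by unfold lik; fun_prop
  rw [← withDensity_lik u, integrable_withDensity_iff_integrable_smul' hm (by simp)] at h
  simpa [ENNReal.toReal_ofReal (lik_pos _ _).le, mul_comm] using h

lemma integrable_quadratic_gaussianReal (a b c u : ℝ) :
    Integrable (fun y => a * y ^ 2 + b * y + c) (gaussianReal u 1) := by
  have h2 : Integrable (fun y : ℝ => y ^ 2) (gaussianReal u 1) :=
    (memLp_id_gaussianReal (μ := u) (v := 1) 2).integrable_sq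
  have h1 : Integrable (fun y : ℝ => y) (gaussianReal u 1) :=
    (memLp_id_gaussianReal (μ := u) (v := 1) 1).integrable (by simp)
  exact ((h2.const_mul a).add (h1.const_mul b)).add (integrable_const c)

lemma integral_quadratic_gaussianReal (a b c u : ℝ) :
    ∫ y, (a * y ^ 2 + b * y + c) ∂(gaussianReal u 1) = a * (1 + u ^ 2) + b * u + c := by
  have h2 : Integrable (fun y : ℝ => y ^ 2) (gaussianReal u 1) :=
    (memLp_id_gaussianReal (μ := u) (v := 1) 2).integrable_sq
  have h1 : Integrable (fun y : ℝ => y) (gaussianReal u 1) :=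
    (memLp_id_gaussianReal (μ := u) (v := 1) 1).integrable (by simp)
  have h21 : Integrable (fun y : ℝ => a * y ^ 2 + b * y) (gaussianReal u 1) :=
    (h2.const_mul a).add (h1.const_mul b)
  rw [integral_add h21 (integrable_const c),
    integral_add (h2.const_mul a) (h1.const_mul b), integral_const_mul, integral_const_mul]
  have hv := variance_eq_sub (memLp_id_gaussianReal (μ := u) (v := 1) 2)
  rw [variance_id_gaussianReal] at hv
  simp only [Pi.pow_apply, id, integral_id_gaussianReal, NNReal.coe_one] at hv
  rw [integral_id_gaussianReal]
  have : ∫ y : ℝ, y ^ 2 ∂(gaussianReal u 1) = 1 + u ^ 2 := by linarith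
  rw [this]; simp

lemma integrable_quadratic_mul_lik (a b c u : ℝ) :
    Integrable (fun y => (a * y ^ 2 + b * y + c) * lik u y) (gaussianReal 0 1) :=
  integrable_mul_lik (integrable_quadratic_gaussianReal a b c u)

lemma integral_quadratic_mul_lik (a b c u : ℝ) :
    ∫ y, (a * y ^ 2 + b * y + c) * lik u y ∂(gaussianReal 0 1) = a * (1 + u ^ 2) + b * u + c := by
  rw [integral_mul_lik, integral_quadratic_gaussianReal]

lemma integrable_lik (u : ℝ) : Integrable (lik u) (gaussianReal 0 1) := by
  simpa using integrable_quadratic_mul_lik 0 0 1 u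

lemma integral_lik (u : ℝ) : ∫ y, lik u y ∂(gaussianReal 0 1) = 1 := by
  simpa using integral_quadratic_mul_lik 0 0 1 u

/-! ### Entropy of finite weights and the scalar Gaussian channel -/

/-- Entropy of a nonnegative weight vector, extended to unnormalized weights by `1`-homogeneity:
`W • H(w / W)` with `W = ∑ w`. -/
def eta {Ω : Type} [Fintype Ω] (w : Ω → ℝ) : ℝ :=
  ∑ σ, Real.negMulLog (w σ) - Real.negMulLog (∑ σ, w σ)

lemma mul_log_ge {a t : ℝ} (ha : 0 ≤ a) (ht : 0 < t) :
    a * Real.log t + a - t ≤ a * Real.log a := by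
  rcases ha.eq_or_lt with rfl | ha
  · simp; exact ht.le
  · have h := Real.log_le_sub_one_of_pos (div_pos ht ha)
    rw [Real.log_div ht.ne' ha.ne'] at h
    have := mul_le_mul_of_nonneg_left h ha.le
    have e : a * (t / a - 1) = t - a := by field_simp
    rw [e] at this
    linarith

/-- Logarithm of the density of `N(m, κ)` relative to `N(0, 1)`. -/
def logRef (κ m y : ℝ) : ℝ := -(1 / 2) * Real.log κ - (y - m) ^ 2 / (2 * κ) + y ^ 2 / 2

/-- Relative entropy of `N(u, 1)` with respect to `N(m, κ)`, as a function of `a = u - m`. -/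
def klRef (κ a : ℝ) : ℝ := 1 / 2 * Real.log κ + (1 + a ^ 2) / (2 * κ) - 1 / 2

/-- The chi-square kernel `∫ N(y; a, 1) N(y; b, 1) / N(y; 0, κ) dy`. -/
def chiRef (κ a b : ℝ) : ℝ :=
  κ / √(2 * κ - 1) * Real.exp ((a + b) ^ 2 / (4 * (2 * κ - 1)) - (a - b) ^ 2 / 4)

lemma log_lik_sub_logRef (κ m u y : ℝ) :
    Real.log (lik u y) - logRef κ m y =
      (1 / (2 * κ) - 1 / 2) * y ^ 2 + (u - m / κ) * y +
        (1 / 2 * Real.log κ - u ^ 2 / 2 + m ^ 2 / (2 * κ)) := by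
  rw [log_lik, logRef]; ring

lemma integrable_lik_mul_log_sub (κ m u : ℝ) :
    Integrable (fun y => lik u y * (Real.log (lik u y) - logRef κ m y)) (gaussianReal 0 1) := by
  simp only [log_lik_sub_logRef, mul_comm (lik u _)]
  exact integrable_quadratic_mul_lik _ _ _ u

lemma integral_lik_mul_log_sub {κ : ℝ} (hκ : 0 < κ) (m u : ℝ) :
    ∫ y, lik u y * (Real.log (lik u y) - logRef κ m y) ∂(gaussianReal 0 1) =
      klRef κ (u - m) := by
  simp only [log_lik_sub_logRef]
  rw [show (fun y => lik u y * ((1 / (2 * κ) - 1 / 2) * y ^ 2 + (u - m / κ) * y +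
        (1 / 2 * Real.log κ - u ^ 2 / 2 + m ^ 2 / (2 * κ)))) = fun y =>
        ((1 / (2 * κ) - 1 / 2) * y ^ 2 + (u - m / κ) * y +
        (1 / 2 * Real.log κ - u ^ 2 / 2 + m ^ 2 / (2 * κ))) * lik u y from
        funext fun y => mul_comm _ _, integral_quadratic_mul_lik, klRef]
  field_simp; ring

lemma exp_logRef {κ : ℝ} (hκ : 0 < κ) (m : ℝ) :
    Integrable (fun y => Real.exp (logRef κ m y)) (gaussianReal 0 1) ∧
      ∫ y, Real.exp (logRef κ m y) ∂(gaussianReal 0 1) = 1 := by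
  have hb : 1 / 2 - 1 / (2 * κ) < 1 / 2 := by
    have : 0 < 1 / (2 * κ) := by positivity
    linarith
  obtain ⟨h1, h2⟩ := integral_exp_quadratic_stdGaussian hb (m / κ)
    (-(1 / 2) * Real.log κ - m ^ 2 / (2 * κ))
  have e : ∀ y, logRef κ m y = (1 / 2 - 1 / (2 * κ)) * y ^ 2 + m / κ * y +
      (-(1 / 2) * Real.log κ - m ^ 2 / (2 * κ)) := by
    intro y; rw [logRef]; field_simp; ring
  simp only [e]
  refine ⟨h1, h2.trans ?_⟩
  have e2 : 1 - 2 * (1 / 2 - 1 / (2 * κ)) = κ⁻¹ := by field_simp; ring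
  rw [e2, Real.sqrt_inv, inv_inv]
  have e3 : (m / κ) ^ 2 / (2 * κ⁻¹) + (-(1 / 2) * Real.log κ - m ^ 2 / (2 * κ)) =
      -Real.log (√κ) := by
    rw [Real.log_sqrt hκ.le]; field_simp; ring
  rw [e3, Real.exp_neg, Real.exp_log (Real.sqrt_pos.2 hκ)]
  exact mul_inv_cancel₀ (Real.sqrt_pos.2 hκ).ne'

lemma lik_mul_lik_div {κ : ℝ} (hκ : 1 ≤ κ) (m u v : ℝ) :
    Integrable (fun y => lik u y * lik v y * Real.exp (-logRef κ m y)) (gaussianReal 0 1) ∧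
      ∫ y, lik u y * lik v y * Real.exp (-logRef κ m y) ∂(gaussianReal 0 1) =
        chiRef κ (u - m) (v - m) := by
  have hκ0 : 0 < κ := by linarith
  have h21 : 0 < 2 * κ - 1 := by linarith
  have hne : 2 * κ - 1 ≠ 0 := h21.ne'
  have hb : 1 / (2 * κ) - 1 / 2 < 1 / 2 := by
    have : 1 / (2 * κ) ≤ 1 / 2 := by
      apply one_div_le_one_div_of_le <;> linarith
    linarith
  obtain ⟨h1, h2⟩ := integral_exp_quadratic_stdGaussian hb (u + v - m / κ)
    (1 / 2 * Real.log κ + m ^ 2 / (2 * κ) - u ^ 2 / 2 - v ^ 2 / 2)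
  have e : ∀ y, lik u y * lik v y * Real.exp (-logRef κ m y) =
      Real.exp ((1 / (2 * κ) - 1 / 2) * y ^ 2 + (u + v - m / κ) * y +
        (1 / 2 * Real.log κ + m ^ 2 / (2 * κ) - u ^ 2 / 2 - v ^ 2 / 2)) := by
    intro y
    rw [logRef, lik, lik, ← Real.exp_add, ← Real.exp_add]
    congr 1; field_simp; ring
  simp only [e]
  refine ⟨h1, h2.trans ?_⟩
  have e2 : 1 - 2 * (1 / (2 * κ) - 1 / 2) = (2 * κ - 1) / κ := by field_simp; ring
  have hs : 0 < √(2 * κ - 1) := Real.sqrt_pos.2 h21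
  have e3 : (u + v - m / κ) ^ 2 / (2 * ((2 * κ - 1) / κ)) +
      (1 / 2 * Real.log κ + m ^ 2 / (2 * κ) - u ^ 2 / 2 - v ^ 2 / 2) =
      Real.log (√κ) + ((u - m + (v - m)) ^ 2 / (4 * (2 * κ - 1)) - (u - m - (v - m)) ^ 2 / 4) := by
    rw [Real.log_sqrt hκ0.le]
    generalize hr : 2 * κ - 1 = r at *
    field_simp
    rw [← hr]; ring
  rw [e2, e3, Real.exp_add, Real.exp_log (Real.sqrt_pos.2 hκ0), chiRef,
    Real.sqrt_div h21.le, ← mul_assoc]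
  congr 1
  rw [inv_div]
  have := Real.mul_self_sqrt hκ0.le
  field_simp
  linarith

lemma integral_add_sub {α : Type*} [MeasurableSpace α] {μ : Measure α} {f g h : α → ℝ}
    (hf : Integrable f μ) (hg : Integrable g μ) (hh : Integrable h μ) :
    ∫ y, (f y + (g y - h y)) ∂μ = ∫ y, f y ∂μ + (∫ y, g y ∂μ - ∫ y, h y ∂μ) := by
  have hgh : Integrable (fun y => g y - h y) μ := hg.sub hh
  rw [integral_add hf hgh, integral_sub hg hh]

section Scalar

variable {Ω : Type} [Fintype Ω]

/-- Mutual information between a random element of `Ω` with weights `w` and the observation of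
`u σ` in standard Gaussian noise. -/
def scalarInfo (w u : Ω → ℝ) : ℝ :=
  eta w - ∫ y, eta (fun σ => w σ * lik (u σ) y) ∂(gaussianReal 0 1)

/-- Integrand of `scalarInfo` after removal of the terms of integral zero. -/
def infoDensity (w u : Ω → ℝ) (y : ℝ) : ℝ :=
  ∑ σ, w σ * (lik (u σ) y * Real.log (lik (u σ) y)) -
    (∑ σ, w σ * lik (u σ) y) * Real.log (∑ σ, w σ * lik (u σ) y)

lemma mixture_pos {w : Ω → ℝ} (hw : ∀ σ, 0 ≤ w σ) (h1 : ∑ σ, w σ = 1) (u : Ω → ℝ) (y : ℝ) :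
    0 < ∑ σ, w σ * lik (u σ) y := by
  refine (Finset.sum_nonneg fun σ _ => mul_nonneg (hw σ) (lik_pos _ _).le).lt_of_ne fun h => ?_
  have h0 := (Finset.sum_eq_zero_iff_of_nonneg
    (fun σ _ => mul_nonneg (hw σ) (lik_pos (u σ) y).le)).1 h.symm
  have : ∑ σ, w σ = 0 := Finset.sum_eq_zero fun σ hσ => by
    have := h0 σ hσ
    exact (mul_eq_zero.1 this).resolve_right (lik_pos _ _).ne'
  linarith

lemma infoDensity_nonneg {w : Ω → ℝ} (hw : ∀ σ, 0 ≤ w σ) (h1 : ∑ σ, w σ = 1) (u : Ω → ℝ)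
    (y : ℝ) : 0 ≤ infoDensity w u y := by
  have hZ := mixture_pos hw h1 u y
  set Z := ∑ σ, w σ * lik (u σ) y with hZd
  have h : ∀ σ ∈ Finset.univ, w σ * (lik (u σ) y * Real.log Z + lik (u σ) y - Z) ≤
      w σ * (lik (u σ) y * Real.log (lik (u σ) y)) := fun σ _ =>
    mul_le_mul_of_nonneg_left (mul_log_ge (lik_pos _ _).le hZ) (hw σ)
  have h2 := Finset.sum_le_sum h
  have e : ∑ σ, w σ * (lik (u σ) y * Real.log Z + lik (u σ) y - Z) = Z * Real.log Z := by
    calc _ = (∑ σ, w σ * lik (u σ) y) * Real.log Z + ∑ σ, w σ * lik (u σ) y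
          - (∑ σ, w σ) * Z := by
            rw [Finset.sum_mul, Finset.sum_mul, ← Finset.sum_add_distrib,
              ← Finset.sum_sub_distrib]
            exact Finset.sum_congr rfl fun σ _ => by ring
      _ = _ := by rw [h1, ← hZd]; ring
  rw [e] at h2
  unfold infoDensity
  linarith

lemma infoDensity_le {w : Ω → ℝ} (hw : ∀ σ, 0 ≤ w σ) (h1 : ∑ σ, w σ = 1) (u : Ω → ℝ)
    (κ m y : ℝ) : infoDensity w u y ≤
      ∑ σ, w σ * (lik (u σ) y * (Real.log (lik (u σ) y) - logRef κ m y)) +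
        (Real.exp (logRef κ m y) - ∑ σ, w σ * lik (u σ) y) := by
  have hZ := mixture_pos hw h1 u y
  have h := mul_log_ge hZ.le (Real.exp_pos (logRef κ m y))
  rw [Real.log_exp] at h
  have e : ∑ σ, w σ * (lik (u σ) y * (Real.log (lik (u σ) y) - logRef κ m y)) =
      ∑ σ, w σ * (lik (u σ) y * Real.log (lik (u σ) y)) -
        (∑ σ, w σ * lik (u σ) y) * logRef κ m y := by
    rw [Finset.sum_mul, ← Finset.sum_sub_distrib]
    exact Finset.sum_congr rfl fun σ _ => by ring
  rw [e, infoDensity]; linarith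

/-- Convexity of relative entropy reduces a lower bound to the part of the mixture carried by
`g`, on which the relative entropy is bounded by the chi-square divergence. -/
lemma le_infoDensity {w : Ω → ℝ} (hw : ∀ σ, 0 ≤ w σ) (h1 : ∑ σ, w σ = 1) (u : Ω → ℝ)
    (g : Finset Ω) (hg : 0 < ∑ σ ∈ g, w σ) (κ m y : ℝ) :
    ∑ σ ∈ g, w σ * (lik (u σ) y * (Real.log (lik (u σ) y) - logRef κ m y)) +
      (∑ σ ∈ g, w σ * lik (u σ) y - (∑ σ ∈ g, w σ)⁻¹ *
        ((∑ σ ∈ g, w σ * lik (u σ) y) ^ 2 * Real.exp (-logRef κ m y))) ≤ infoDensity w u y := by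
  classical
  have hZ := mixture_pos hw h1 u y
  set Z := ∑ σ, w σ * lik (u σ) y with hZd
  set Zg := ∑ σ ∈ g, w σ * lik (u σ) y with hZg
  set wg := ∑ σ ∈ g, w σ with hwg
  have hZgpos : 0 < Zg := by
    refine (Finset.sum_nonneg fun σ _ => mul_nonneg (hw σ) (lik_pos _ _).le).lt_of_ne fun h => ?_
    have h0 := (Finset.sum_eq_zero_iff_of_nonneg
      (fun σ _ => mul_nonneg (hw σ) (lik_pos (u σ) y).le)).1 h.symm
    have : wg = 0 := Finset.sum_eq_zero fun σ hσ =>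
      (mul_eq_zero.1 (h0 σ hσ)).resolve_right (lik_pos _ _).ne'
    linarith
  have hsplit : ∀ f : Ω → ℝ, ∑ σ, f σ = ∑ σ ∈ g, f σ + ∑ σ ∈ gᶜ, f σ := fun f =>
    (Finset.sum_add_sum_compl g f).symm
  -- tangent line of `x log x` at `Z`, for the bad terms and for the aggregated good part
  have hbad : ∑ σ ∈ gᶜ, w σ * (lik (u σ) y * Real.log Z + lik (u σ) y - Z) ≤
      ∑ σ ∈ gᶜ, w σ * (lik (u σ) y * Real.log (lik (u σ) y)) :=
    Finset.sum_le_sum fun σ _ => mul_le_mul_of_nonneg_left (mul_log_ge (lik_pos _ _).le hZ) (hw σ)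
  have ebad : ∑ σ ∈ gᶜ, w σ * (lik (u σ) y * Real.log Z + lik (u σ) y - Z) =
      (Z - Zg) * Real.log Z + (Z - Zg) - (1 - wg) * Z := by
    have a1 : Z - Zg = ∑ σ ∈ gᶜ, w σ * lik (u σ) y := by rw [hZd, hsplit]; ring
    have a2 : 1 - wg = ∑ σ ∈ gᶜ, w σ := by rw [← h1, hsplit]; ring
    rw [a1, a2, Finset.sum_mul, Finset.sum_mul, ← Finset.sum_add_distrib,
      ← Finset.sum_sub_distrib]
    exact Finset.sum_congr rfl fun σ _ => by ring
  have hgood : Zg / wg * Real.log Z + Zg / wg - Z ≤ Zg / wg * Real.log (Zg / wg) :=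
    mul_log_ge (by positivity) hZ
  have hgood' := mul_le_mul_of_nonneg_left hgood hg.le
  have e1 : wg * (Zg / wg * Real.log Z + Zg / wg - Z) = Zg * Real.log Z + Zg - wg * Z := by
    field_simp
  have e2 : wg * (Zg / wg * Real.log (Zg / wg)) = Zg * Real.log (Zg / wg) := by field_simp
  rw [e1, e2] at hgood'
  have hlog : Real.log (Zg / wg) ≤ logRef κ m y + Zg / wg * Real.exp (-logRef κ m y) - 1 := by
    have := Real.log_le_sub_one_of_pos
      (mul_pos (div_pos hZgpos hg) (Real.exp_pos (-logRef κ m y)))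
    rw [Real.log_mul (div_pos hZgpos hg).ne' (Real.exp_pos _).ne', Real.log_exp] at this
    linarith
  have hlog' := mul_le_mul_of_nonneg_left hlog hZgpos.le
  have e3 : Zg * (logRef κ m y + Zg / wg * Real.exp (-logRef κ m y) - 1) =
      Zg * logRef κ m y + wg⁻¹ * (Zg ^ 2 * Real.exp (-logRef κ m y)) - Zg := by
    field_simp
  rw [e3] at hlog'
  have e4 : ∑ σ ∈ g, w σ * (lik (u σ) y * (Real.log (lik (u σ) y) - logRef κ m y)) =
      ∑ σ ∈ g, w σ * (lik (u σ) y * Real.log (lik (u σ) y)) - Zg * logRef κ m y := by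
    rw [hZg, Finset.sum_mul, ← Finset.sum_sub_distrib]
    exact Finset.sum_congr rfl fun σ _ => by ring
  rw [e4, infoDensity, hsplit (fun σ => w σ * (lik (u σ) y * Real.log (lik (u σ) y)))]
  linarith

lemma measurable_infoDensity (w u : Ω → ℝ) : Measurable (infoDensity w u) := by
  unfold infoDensity lik; fun_prop

lemma integrable_mixture (w u : Ω → ℝ) :
    Integrable (fun y => ∑ σ, w σ * lik (u σ) y) (gaussianReal 0 1) :=
  integrable_finsetSum _ fun σ _ => (integrable_lik (u σ)).const_mul _

lemma integral_mixture {Ω : Type} (g : Finset Ω) (w u : Ω → ℝ) :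
    ∫ y, ∑ σ ∈ g, w σ * lik (u σ) y ∂(gaussianReal 0 1) = ∑ σ ∈ g, w σ := by
  rw [integral_finsetSum _ fun σ _ => (integrable_lik (u σ)).const_mul _]
  simp [integral_const_mul, integral_lik]

lemma integrable_infoDensity_bound (w u : Ω → ℝ) {κ : ℝ} (hκ : 0 < κ) (m : ℝ) :
    Integrable (fun y => ∑ σ, w σ * (lik (u σ) y * (Real.log (lik (u σ) y) - logRef κ m y)) +
        (Real.exp (logRef κ m y) - ∑ σ, w σ * lik (u σ) y)) (gaussianReal 0 1) :=
  (integrable_finsetSum _ fun σ _ => (integrable_lik_mul_log_sub κ m (u σ)).const_mul _).add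
    ((exp_logRef hκ m).1.sub (integrable_mixture w u))

lemma integrable_infoDensity {w : Ω → ℝ} (hw : ∀ σ, 0 ≤ w σ) (h1 : ∑ σ, w σ = 1) (u : Ω → ℝ) :
    Integrable (infoDensity w u) (gaussianReal 0 1) := by
  refine (integrable_infoDensity_bound w u one_pos 0).mono'
    (measurable_infoDensity w u).aestronglyMeasurable (ae_of_all _ fun y => ?_)
  rw [Real.norm_of_nonneg (infoDensity_nonneg hw h1 u y)]
  exact infoDensity_le hw h1 u _ _ _

lemma eta_mul_lik (w u : Ω → ℝ) (y : ℝ) : eta (fun σ => w σ * lik (u σ) y) =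
    ∑ σ, Real.negMulLog (w σ) * lik (u σ) y - infoDensity w u y := by
  simp only [eta, Real.negMulLog_mul, Finset.sum_add_distrib, infoDensity]
  simp only [Real.negMulLog, neg_mul, mul_neg, Finset.sum_neg_distrib]
  have : ∑ x, lik (u x) y * (w x * Real.log (w x)) = ∑ x, w x * Real.log (w x) * lik (u x) y :=
    Finset.sum_congr rfl fun _ _ => mul_comm _ _
  rw [this]; ring

lemma scalarInfo_eq {w : Ω → ℝ} (hw : ∀ σ, 0 ≤ w σ) (h1 : ∑ σ, w σ = 1) (u : Ω → ℝ) :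
    scalarInfo w u = ∫ y, infoDensity w u y ∂(gaussianReal 0 1) := by
  simp only [scalarInfo, eta_mul_lik]
  rw [integral_sub (integrable_mixture _ u) (integrable_infoDensity hw h1 u), integral_mixture]
  simp [eta, h1]

lemma scalarInfo_nonneg {w : Ω → ℝ} (hw : ∀ σ, 0 ≤ w σ) (h1 : ∑ σ, w σ = 1) (u : Ω → ℝ) :
    0 ≤ scalarInfo w u := by
  rw [scalarInfo_eq hw h1]
  exact integral_nonneg (infoDensity_nonneg hw h1 u)

/-- A Gaussian reference law bounds the information from above. -/
lemma scalarInfo_le {w : Ω → ℝ} (hw : ∀ σ, 0 ≤ w σ) (h1 : ∑ σ, w σ = 1) (u : Ω → ℝ)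
    {κ : ℝ} (hκ : 0 < κ) (m : ℝ) : scalarInfo w u ≤ ∑ σ, w σ * klRef κ (u σ - m) := by
  rw [scalarInfo_eq hw h1]
  refine (integral_mono (integrable_infoDensity hw h1 u) (integrable_infoDensity_bound w u hκ m)
    (infoDensity_le hw h1 u κ m)).trans_eq ?_
  rw [integral_add_sub (integrable_finsetSum _ fun σ _ =>
      (integrable_lik_mul_log_sub κ m (u σ)).const_mul _) (exp_logRef hκ m).1
      (integrable_mixture w u),
    integral_finsetSum _ (fun σ _ => (integrable_lik_mul_log_sub κ m (u σ)).const_mul _),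
    (exp_logRef hκ m).2,
    integral_mixture, h1]
  simp [integral_const_mul, integral_lik_mul_log_sub hκ]

/-- Lower bound matching `scalarInfo_le` up to a chi-square divergence. -/
lemma le_scalarInfo {w : Ω → ℝ} (hw : ∀ σ, 0 ≤ w σ) (h1 : ∑ σ, w σ = 1) (u : Ω → ℝ)
    (g : Finset Ω) (hg : 0 < ∑ σ ∈ g, w σ) {κ : ℝ} (hκ : 1 ≤ κ) (m : ℝ) :
    ∑ σ ∈ g, w σ * klRef κ (u σ - m) + (∑ σ ∈ g, w σ - (∑ σ ∈ g, w σ)⁻¹ *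
      ∑ σ ∈ g, ∑ τ ∈ g, w σ * w τ * chiRef κ (u σ - m) (u τ - m)) ≤ scalarInfo w u := by
  have hκ0 : 0 < κ := by linarith
  rw [scalarInfo_eq hw h1]
  have e : ∀ y, (∑ σ ∈ g, w σ * lik (u σ) y) ^ 2 * Real.exp (-logRef κ m y) =
      ∑ σ ∈ g, ∑ τ ∈ g, w σ * w τ * (lik (u σ) y * lik (u τ) y * Real.exp (-logRef κ m y)) := by
    intro y
    rw [sq, Finset.sum_mul_sum, Finset.sum_mul]
    refine Finset.sum_congr rfl fun σ _ => ?_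
    rw [Finset.sum_mul]
    exact Finset.sum_congr rfl fun τ _ => by ring
  have i0 : Integrable (fun y => ∑ σ ∈ g, w σ *
      (lik (u σ) y * (Real.log (lik (u σ) y) - logRef κ m y))) (gaussianReal 0 1) :=
    integrable_finsetSum _ fun σ _ => (integrable_lik_mul_log_sub κ m (u σ)).const_mul _
  have i1 : Integrable (fun y => ∑ σ ∈ g, w σ * lik (u σ) y) (gaussianReal 0 1) :=
    integrable_finsetSum _ fun σ _ => (integrable_lik (u σ)).const_mul _
  have i2 : Integrable (fun y => (∑ σ ∈ g, w σ)⁻¹ *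
      ((∑ σ ∈ g, w σ * lik (u σ) y) ^ 2 * Real.exp (-logRef κ m y))) (gaussianReal 0 1) := by
    simp only [e]
    exact (integrable_finsetSum _ fun σ _ => integrable_finsetSum _ fun τ _ =>
      (lik_mul_lik_div hκ m (u σ) (u τ)).1.const_mul _).const_mul _
  refine le_trans (le_of_eq ?_) (integral_mono (i0.add (i1.sub i2))
    (integrable_infoDensity hw h1 u) (le_infoDensity hw h1 u g hg κ m))
  refine Eq.trans ?_ (integral_add_sub i0 i1 i2).symm
  rw [integral_mixture,
    integral_finsetSum _ (fun σ _ => (integrable_lik_mul_log_sub κ m (u σ)).const_mul _)]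
  simp only [e, integral_const_mul, integral_lik_mul_log_sub hκ0]
  congr 3
  rw [integral_finsetSum _ (fun σ _ => integrable_finsetSum _ fun τ _ =>
      (lik_mul_lik_div hκ m (u σ) (u τ)).1.const_mul _)]
  refine Finset.sum_congr rfl fun σ _ => ?_
  rw [integral_finsetSum _ (fun τ _ => (lik_mul_lik_div hκ m (u σ) (u τ)).1.const_mul _)]
  simp only [integral_const_mul, (lik_mul_lik_div hκ m _ _).2]

end Scalar

/-! ### Gaussian vectors -/

/-- The law of a vector of independent standard Gaussians indexed by `C × Fin B`. -/
def stdLaw (C : Type) [Fintype C] (B : ℕ) : Measure (C → Fin B → ℝ) :=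
  Measure.pi fun _ => Measure.pi fun _ => gaussianReal 0 1

instance {C : Type} [Fintype C] {B : ℕ} : IsProbabilityMeasure (stdLaw C B) := by
  unfold stdLaw; infer_instance

section Linear

variable {C : Type} [Fintype C] {B : ℕ}

/-- The Euclidean pairing of two arrays. -/
def pair (g d : C → Fin B → ℝ) : ℝ := ∑ c, ∑ j, g c j * d c j

lemma pair_add (g d e : C → Fin B → ℝ) : pair g (d + e) = pair g d + pair g e := by
  simp [pair, mul_add, Finset.sum_add_distrib]

lemma pair_sub (g d e : C → Fin B → ℝ) : pair g (d - e) = pair g d - pair g e := by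
  simp [pair, mul_sub, Finset.sum_sub_distrib]

lemma pair_comm (g d : C → Fin B → ℝ) : pair g d = pair d g := by
  simp [pair, mul_comm]

lemma pair_self_nonneg (d : C → Fin B → ℝ) : 0 ≤ pair d d :=
  Finset.sum_nonneg fun _ _ => Finset.sum_nonneg fun _ _ => mul_self_nonneg _

@[fun_prop]
lemma measurable_pair_left (d : C → Fin B → ℝ) : Measurable fun g => pair g d := by
  unfold pair; fun_prop

lemma integral_cexp_stdGaussian (t : ℂ) :
    ∫ y : ℝ, Complex.exp (t * y) ∂(gaussianReal 0 1) = Complex.exp (t ^ 2 / 2) := by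
  have := complexMGF_id_gaussianReal (μ := 0) (v := 1) t
  simpa [complexMGF] using this

lemma integrable_cexp_stdGaussian (t : ℂ) :
    Integrable (fun y : ℝ => Complex.exp (t * y)) (gaussianReal 0 1) := by
  have h := integrable_exp_mul_gaussianReal (μ := 0) (v := 1) t.re
  refine h.mono' (by fun_prop) (ae_of_all _ fun y => ?_)
  rw [Complex.norm_exp]; simp

/-- The Laplace transform of the standard Gaussian vector at complex arguments. -/
lemma cexp_stdLaw (t : C → Fin B → ℂ) :
    Integrable (fun g => Complex.exp (∑ c, ∑ j, t c j * (g c j : ℂ))) (stdLaw C B) ∧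
    ∫ g, Complex.exp (∑ c, ∑ j, t c j * (g c j : ℂ)) ∂(stdLaw C B) =
      Complex.exp (∑ c, ∑ j, t c j ^ 2 / 2) := by
  simp only [Complex.exp_sum]
  unfold stdLaw
  constructor
  · refine Integrable.fintype_prod (f := fun c (g : Fin B → ℝ) =>
      ∏ j, Complex.exp (t c j * (g j : ℂ))) fun c => ?_
    exact Integrable.fintype_prod (f := fun j (y : ℝ) => Complex.exp (t c j * (y : ℂ)))
      fun j => integrable_cexp_stdGaussian _
  · rw [integral_fintype_prod_eq_prod
      (fun c (g : Fin B → ℝ) => ∏ j, Complex.exp (t c j * (g j : ℂ)))]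
    refine Finset.prod_congr rfl fun c _ => ?_
    rw [integral_fintype_prod_eq_prod (fun j (y : ℝ) => Complex.exp (t c j * (y : ℂ)))]
    simp only [integral_cexp_stdGaussian]

/-- A linear functional of a standard Gaussian vector is a centered Gaussian. -/
lemma map_pair_stdLaw (d : C → Fin B → ℝ) :
    (stdLaw C B).map (fun g => pair g d) = gaussianReal 0 ⟨pair d d, pair_self_nonneg d⟩ := by
  obtain ⟨v, hv⟩ : ∃ v : ℝ≥0, v = ⟨pair d d, pair_self_nonneg d⟩ := ⟨_, rfl⟩
  have hv' : (v : ℝ) = pair d d := by rw [hv]; rfl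
  rw [← hv]
  have : IsProbabilityMeasure ((stdLaw C B).map (fun g => pair g d)) :=
    Measure.isProbabilityMeasure_map (measurable_pair_left d).aemeasurable
  refine Measure.ext_of_charFun (funext fun t => ?_)
  rw [charFun_gaussianReal, charFun_apply_real, integral_map (by fun_prop) (by fun_prop)]
  have h := (cexp_stdLaw (fun c j => (t * Complex.I * (d c j : ℂ)) : C → Fin B → ℂ)).2
  convert h using 2
  · ext g
    congr 1
    simp only [pair, Complex.ofReal_sum, Complex.ofReal_mul, Finset.mul_sum, Finset.sum_mul]
    exact Finset.sum_congr rfl fun _ _ => Finset.sum_congr rfl fun _ _ => by ring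
  · rw [hv']
    simp only [mul_pow, Complex.I_sq, pair, Complex.ofReal_sum, Complex.ofReal_mul,
      Complex.ofReal_zero, mul_zero, zero_mul, zero_sub, Finset.sum_mul, Finset.sum_div,
      ← Finset.sum_neg_distrib]
    exact Finset.sum_congr rfl fun _ _ => Finset.sum_congr rfl fun _ _ => by ring

lemma pair_sq_stdLaw (d : C → Fin B → ℝ) :
    Integrable (fun g => pair g d ^ 2) (stdLaw C B) ∧
      ∫ g, pair g d ^ 2 ∂(stdLaw C B) = pair d d := by
  have hm : AEMeasurable (fun g => pair g d) (stdLaw C B) := (measurable_pair_left d).aemeasurable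
  set v : ℝ≥0 := ⟨pair d d, pair_self_nonneg d⟩ with hv
  have h2 : Integrable (fun y : ℝ => y ^ 2) (gaussianReal 0 v) :=
    (memLp_id_gaussianReal (μ := 0) (v := v) 2).integrable_sq
  have hi : ∫ y : ℝ, y ^ 2 ∂(gaussianReal 0 v) = v := by
    have hv := variance_eq_sub (memLp_id_gaussianReal (μ := 0) (v := v) 2)
    rw [variance_id_gaussianReal] at hv
    simpa only [Pi.pow_apply, id, integral_id_gaussianReal, ne_eq, OfNat.ofNat_ne_zero,
      not_false_eq_true, zero_pow, sub_zero] using hv.symm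
  rw [← map_pair_stdLaw] at h2 hi
  constructor
  · exact (integrable_map_measure (by fun_prop) hm).1 h2
  · rw [integral_map hm (by fun_prop)] at hi
    exact hi

/-- Decorrelation bound: a convex and a concave Gaussian exponential of two jointly Gaussian
variables are negatively correlated. Both quadratic exponents are linearized by auxiliary
Gaussian variables, the second one with an imaginary coefficient. -/
lemma integral_exp_sq_sub_sq_le (d e : C → Fin B → ℝ) {p r : ℝ} (hp : 0 ≤ p) (hr : 0 ≤ r)
    (hP : p * pair d d < 1) :
    Integrable (fun g => Real.exp (p * pair g d ^ 2 / 2 - r * pair g e ^ 2 / 2)) (stdLaw C B) ∧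
    ∫ g, Real.exp (p * pair g d ^ 2 / 2 - r * pair g e ^ 2 / 2) ∂(stdLaw C B) ≤
      (√(1 - p * pair d d))⁻¹ * (√(1 + r * pair e e))⁻¹ := by
  obtain ⟨a, rfl⟩ : ∃ a, p = a ^ 2 := ⟨√p, (Real.sq_sqrt hp).symm⟩
  obtain ⟨b, rfl⟩ : ∃ b, r = b ^ 2 := ⟨√r, (Real.sq_sqrt hr).symm⟩
  let G : Measure (ℝ × ℝ) := (gaussianReal 0 1).prod (gaussianReal 0 1)
  let F : (C → Fin B → ℝ) × (ℝ × ℝ) → ℂ := fun q =>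
    Complex.exp ((a * q.2.1 * pair q.1 d : ℝ) + (b * q.2.2 * pair q.1 e : ℝ) * Complex.I)
  have hFm : Measurable F := by
    have : ∀ d : C → Fin B → ℝ, Measurable fun q : (C → Fin B → ℝ) × (ℝ × ℝ) => pair q.1 d :=
      fun d => (measurable_pair_left d).comp measurable_fst
    have h1 := this d
    have h2 := this e
    fun_prop
  have hFn : ∀ q, ‖F q‖ = Real.exp (a * q.2.1 * pair q.1 d) := fun q => by
    simp [F, Complex.norm_exp]
  -- integral over the vector for fixed auxiliary variables
  have hg : ∀ k : ℝ × ℝ, Integrable (fun g => F (g, k)) (stdLaw C B) ∧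
      ∫ g, F (g, k) ∂(stdLaw C B) = Complex.exp (∑ c, ∑ j,
        (a * k.1 * d c j + b * k.2 * e c j * Complex.I : ℂ) ^ 2 / 2) := by
    intro k
    have h := cexp_stdLaw (fun c j => (a * k.1 * d c j + b * k.2 * e c j * Complex.I : ℂ))
    have e1 : ∀ g : C → Fin B → ℝ, F (g, k) = Complex.exp (∑ c, ∑ j,
        (a * k.1 * d c j + b * k.2 * e c j * Complex.I : ℂ) * (g c j : ℂ)) := by
      intro g
      simp only [F, pair]
      congr 1
      push_cast
      simp only [Finset.mul_sum, Finset.sum_mul, ← Finset.sum_add_distrib]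
      exact Finset.sum_congr rfl fun _ _ => Finset.sum_congr rfl fun _ _ => by ring
    simp only [e1]
    exact h
  have hnorm : ∀ k : ℝ × ℝ, ∫ g, ‖F (g, k)‖ ∂(stdLaw C B) =
      Real.exp (a ^ 2 * pair d d / 2 * k.1 ^ 2) := by
    intro k
    have h := (hg (k.1, 0)).2
    have e1 : ∀ g : C → Fin B → ℝ, F (g, (k.1, 0)) = ((‖F (g, k)‖ : ℝ) : ℂ) := by
      intro g; rw [hFn]; simp [F]
    simp only [e1] at h
    rw [integral_complex_ofReal] at h
    have e2 : Complex.exp (∑ c, ∑ j,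
        (a * k.1 * d c j + b * (0 : ℝ) * e c j * Complex.I : ℂ) ^ 2 / 2) =
        ((Real.exp (a ^ 2 * pair d d / 2 * k.1 ^ 2) : ℝ) : ℂ) := by
      rw [Complex.ofReal_exp]
      congr 1
      rw [pair]
      push_cast
      simp only [Finset.mul_sum, Finset.sum_mul, Finset.sum_div]
      exact Finset.sum_congr rfl fun _ _ => Finset.sum_congr rfl fun _ _ => by ring
    rw [e2] at h
    exact_mod_cast h
  have hb1 : a ^ 2 * pair d d / 2 < 1 / 2 := by linarith
  have hb2 : -(b ^ 2 * pair e e / 2) < 1 / 2 := by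
    have := mul_nonneg hr (pair_self_nonneg e); linarith
  obtain ⟨i1, v1⟩ := integral_exp_quadratic_stdGaussian hb1 0 0
  obtain ⟨i2, v2⟩ := integral_exp_quadratic_stdGaussian hb2 0 0
  simp only [zero_mul, add_zero, ne_eq, OfNat.ofNat_ne_zero, not_false_eq_true, zero_pow, zero_div,
    Real.exp_zero, mul_one] at i1 v1 i2 v2
  have hFi : Integrable F ((stdLaw C B).prod G) := by
    rw [integrable_prod_iff' hFm.aestronglyMeasurable]
    refine ⟨ae_of_all _ fun k => (hg k).1, ?_⟩
    simp only [hnorm]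
    simpa using i1.mul_prod (integrable_const (1 : ℝ) (μ := gaussianReal 0 1))
  -- integral over the auxiliary variables for a fixed vector
  have hk : ∀ g, ∫ k, F (g, k) ∂G =
      ((Real.exp (a ^ 2 * pair g d ^ 2 / 2 - b ^ 2 * pair g e ^ 2 / 2) : ℝ) : ℂ) := by
    intro g
    have e1 : ∀ k : ℝ × ℝ, F (g, k) = Complex.exp ((a * pair g d : ℝ) * k.1) *
        Complex.exp ((b * pair g e : ℝ) * Complex.I * k.2) := by
      intro k
      rw [← Complex.exp_add]
      simp only [F]
      congr 1
      push_cast; ring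
    simp only [e1, G]
    rw [integral_prod_mul (fun y : ℝ => Complex.exp ((a * pair g d : ℝ) * (y : ℂ)))
      (fun y : ℝ => Complex.exp ((b * pair g e : ℝ) * Complex.I * (y : ℂ))),
      integral_cexp_stdGaussian, integral_cexp_stdGaussian, ← Complex.exp_add,
      Complex.ofReal_exp]
    congr 1
    rw [mul_pow _ Complex.I, Complex.I_sq]
    push_cast; ring
  have hint : Integrable (fun g => Real.exp (a ^ 2 * pair g d ^ 2 / 2 - b ^ 2 * pair g e ^ 2 / 2))
      (stdLaw C B) := by
    have := hFi.integral_prod_left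
    simp only [hk] at this
    exact this.re
  refine ⟨hint, ?_⟩
  have h1 : ((∫ g, Real.exp (a ^ 2 * pair g d ^ 2 / 2 - b ^ 2 * pair g e ^ 2 / 2)
      ∂(stdLaw C B) : ℝ) : ℂ)
      = ∫ k, ∫ g, F (g, k) ∂(stdLaw C B) ∂G := by
    rw [← integral_integral_swap (f := fun g k => F (g, k)) hFi]
    simp only [hk]
    rw [integral_complex_ofReal]
  have hpos : 0 ≤ ∫ g, Real.exp (a ^ 2 * pair g d ^ 2 / 2 - b ^ 2 * pair g e ^ 2 / 2)
      ∂(stdLaw C B) :=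
    integral_nonneg fun _ => (Real.exp_pos _).le
  have h2 : ∫ g, Real.exp (a ^ 2 * pair g d ^ 2 / 2 - b ^ 2 * pair g e ^ 2 / 2) ∂(stdLaw C B) ≤
      ∫ k, Real.exp (a ^ 2 * pair d d / 2 * k.1 ^ 2) *
        Real.exp (-(b ^ 2 * pair e e / 2) * k.2 ^ 2) ∂G := by
    have := congrArg norm h1
    rw [Complex.norm_real, Real.norm_of_nonneg hpos] at this
    rw [this]
    refine norm_integral_le_of_norm_le (i1.mul_prod i2) (ae_of_all _ fun k => ?_)
    rw [(hg k).2, Complex.norm_exp, ← Real.exp_add]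
    refine le_of_eq (congrArg Real.exp ?_)
    rw [Complex.re_sum, pair, pair]
    simp only [Complex.re_sum, Finset.mul_sum, Finset.sum_mul, Finset.sum_div,
      ← Finset.sum_neg_distrib, ← Finset.sum_add_distrib]
    refine Finset.sum_congr rfl fun c _ => Finset.sum_congr rfl fun j _ => ?_
    have : (a * k.1 * d c j + b * k.2 * e c j * Complex.I : ℂ) ^ 2 / 2 =
        ((((a * k.1 * d c j) ^ 2 - (b * k.2 * e c j) ^ 2) / 2 : ℝ) : ℂ) +
        ((a * k.1 * d c j * (b * k.2 * e c j) : ℝ) : ℂ) * Complex.I := by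
      push_cast
      ring_nf
      rw [Complex.I_sq]; ring
    rw [this, Complex.add_re, Complex.ofReal_re, Complex.re_ofReal_mul, Complex.I_re]
    ring
  refine h2.trans (le_of_eq ?_)
  rw [integral_prod_mul (fun y : ℝ => Real.exp (a ^ 2 * pair d d / 2 * y ^ 2))
    (fun y : ℝ => Real.exp (-(b ^ 2 * pair e e / 2) * y ^ 2)), v1, v2]
  congr 3 <;> ring_nf

/-- For nearly orthogonal vectors of squared norms close to `V`, the average of the
chi-square kernel is close to one. -/
lemma integral_chiRef_le (d e : C → Fin B → ℝ) {V δ : ℝ} (hV : 0 ≤ V) (hδ : δ ≤ 1 / 4)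
    (hd : |pair d d - V| ≤ δ) (he : |pair e e - V| ≤ δ) :
    Integrable (fun g => chiRef (1 + V) (pair g d) (pair g e)) (stdLaw C B) ∧
    ∫ g, chiRef (1 + V) (pair g d) (pair g e) ∂(stdLaw C B) ≤ 1 + 2 * (δ + |pair d e|) := by
  set ε := |pair d e| with hε
  have hP : pair (d + e) (d + e) = pair d d + pair e e + 2 * pair d e := by
    rw [pair_add, pair_comm (d + e) d, pair_comm (d + e) e, pair_add, pair_add, pair_comm e d]
    ring
  have hN : pair (d - e) (d - e) = pair d d + pair e e - 2 * pair d e := by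
    rw [pair_sub, pair_comm (d - e) d, pair_comm (d - e) e, pair_sub, pair_sub, pair_comm e d]
    ring
  have hP0 := pair_self_nonneg (d + e)
  have hN0 := pair_self_nonneg (d - e)
  rw [abs_le] at hd he
  have hε1 : ε ≤ V + δ := by
    rw [hε, abs_le]; constructor <;> linarith [hd.2, he.2]
  have hle := le_abs_self (pair d e)
  have hnle := neg_abs_le (pair d e)
  rw [← hε] at hle hnle
  -- the kernel is a Gaussian exponential in the sum and the difference of the two coordinates;
  -- both normalizations of the decorrelation bound are expressed by `D`
  set r := 1 + 2 * V with hr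
  have hr0 : 0 < r := by linarith
  set D := 1 + V - δ - ε with hD
  have hD0 : 1 / 2 ≤ D := by linarith
  have hbP : D / r ≤ 1 - 1 / (2 * r) * pair (d + e) (d + e) := by
    rw [div_le_iff₀ hr0, sub_mul]
    have : 1 / (2 * r) * pair (d + e) (d + e) * r = pair (d + e) (d + e) / 2 := by field_simp
    rw [this, hP]; linarith [hd.2, he.2]
  have hbN : D ≤ 1 + 1 / 2 * pair (d - e) (d - e) := by
    rw [hN]; linarith [hd.1, he.1]
  have hDr : 0 < D / r := by positivity
  obtain ⟨i, b⟩ := integral_exp_sq_sub_sq_le (d + e) (d - e) (p := 1 / (2 * r)) (r := 1 / 2)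
    (by positivity) (by norm_num) (by linarith)
  have ee : ∀ g, chiRef (1 + V) (pair g d) (pair g e) = (1 + V) / √r *
      Real.exp (1 / (2 * r) * pair g (d + e) ^ 2 / 2 - 1 / 2 * pair g (d - e) ^ 2 / 2) := by
    intro g
    rw [chiRef, pair_add, pair_sub]
    have : 2 * (1 + V) - 1 = r := by rw [hr]; ring
    rw [this]
    congr 2
    field_simp; ring
  simp only [ee]
  refine ⟨i.const_mul _, ?_⟩
  rw [integral_const_mul]
  have hsr : 0 < √r := Real.sqrt_pos.2 hr0
  have h1 : (√(1 - 1 / (2 * r) * pair (d + e) (d + e)))⁻¹ ≤ (√(D / r))⁻¹ :=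
    inv_anti₀ (Real.sqrt_pos.2 hDr) (Real.sqrt_le_sqrt hbP)
  have h2 : (√(1 + 1 / 2 * pair (d - e) (d - e)))⁻¹ ≤ (√D)⁻¹ :=
    inv_anti₀ (Real.sqrt_pos.2 (by linarith)) (Real.sqrt_le_sqrt hbN)
  have h3 : (√(D / r))⁻¹ * (√D)⁻¹ = √r / D := by
    have hs : 0 < √D := Real.sqrt_pos.2 (by linarith)
    rw [Real.sqrt_div (by linarith), inv_div, ← div_eq_mul_inv, div_div,
      Real.mul_self_sqrt (by linarith)]
  have h4 : (1 + V) / √r * (√r / D) = (1 + V) / D := by field_simp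
  calc _ ≤ (1 + V) / √r * ((√(D / r))⁻¹ * (√D)⁻¹) := by
        refine mul_le_mul_of_nonneg_left (b.trans ?_) (by positivity)
        exact mul_le_mul h1 h2 (by positivity) (by positivity)
    _ = (1 + V) / D := by rw [h3, h4]
    _ ≤ 1 + 2 * (δ + ε) := by
        have hδ0 : 0 ≤ δ := by linarith [hd.1, hd.2]
        have hε0 : 0 ≤ ε := abs_nonneg _
        rw [div_le_iff₀ (by linarith)]
        have : 1 + V = D + (δ + ε) := by rw [hD]; ring
        rw [this]
        nlinarith [mul_nonneg (add_nonneg hδ0 hε0) (sub_nonneg.2 hD0)]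

end Linear

/-! ### Entropy inequalities -/

section Eta

variable {Ω : Type} [Fintype Ω]

lemma eta_nonneg {w : Ω → ℝ} (hw : 0 ≤ w) : 0 ≤ eta w := by
  rcases (Finset.sum_nonneg fun σ (_ : σ ∈ Finset.univ) => hw σ).eq_or_lt with h | h
  · have h0 : ∀ σ, w σ = 0 := fun σ =>
      (Finset.sum_eq_zero_iff_of_nonneg fun σ _ => hw σ).1 h.symm σ (Finset.mem_univ _)
    simp [eta, h0]
  · have : ∑ σ, w σ * Real.log (w σ) ≤ ∑ σ, w σ * Real.log (∑ σ, w σ) := by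
      refine Finset.sum_le_sum fun σ _ => ?_
      rcases (hw σ).eq_or_lt with h0 | h0
      · simp [← h0]
      · exact mul_le_mul_of_nonneg_left (Real.log_le_log h0
          (Finset.single_le_sum (fun σ _ => hw σ) (Finset.mem_univ σ))) h0.le
    rw [← Finset.sum_mul] at this
    simp only [eta, Real.negMulLog, neg_mul, Finset.sum_neg_distrib]
    linarith

lemma eta_le {w : Ω → ℝ} (hw : 0 ≤ w) :
    eta w ≤ Real.log (Fintype.card Ω) * ∑ σ, w σ := by
  rcases (Finset.sum_nonneg fun σ (_ : σ ∈ Finset.univ) => hw σ).eq_or_lt with h | h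
  · have h0 : ∀ σ, w σ = 0 := fun σ =>
      (Finset.sum_eq_zero_iff_of_nonneg fun σ _ => hw σ).1 h.symm σ (Finset.mem_univ _)
    simp [eta, h0]
  · have hne : (Finset.univ : Finset Ω).Nonempty := by
      by_contra hc
      rw [Finset.not_nonempty_iff_eq_empty] at hc
      rw [hc] at h; simp at h
    have hn : (0 : ℝ) < Fintype.card Ω := by
      have := Finset.card_pos.2 hne
      exact_mod_cast this
    set W := ∑ σ, w σ with hW
    have : ∑ σ, (w σ * Real.log (W / Fintype.card Ω) + w σ - W / Fintype.card Ω) ≤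
        ∑ σ, w σ * Real.log (w σ) :=
      Finset.sum_le_sum fun σ _ => mul_log_ge (hw σ) (by positivity)
    rw [Finset.sum_sub_distrib, Finset.sum_add_distrib, ← Finset.sum_mul, ← hW,
      Finset.sum_const, Finset.card_univ, nsmul_eq_mul, Real.log_div h.ne' hn.ne'] at this
    have e : (Fintype.card Ω : ℝ) * (W / Fintype.card Ω) = W := by field_simp
    rw [e] at this
    simp only [eta, Real.negMulLog, neg_mul, Finset.sum_neg_distrib, ← hW]
    linarith

lemma eta_smul (c : ℝ) (w : Ω → ℝ) : eta (fun σ => c * w σ) = c * eta w := by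
  simp only [eta, ← Finset.mul_sum, Real.negMulLog_mul, Finset.sum_add_distrib]
  rw [← Finset.sum_mul]; ring

lemma measurable_eta : Measurable (eta : (Ω → ℝ) → ℝ) := by
  have : Continuous (eta : (Ω → ℝ) → ℝ) := by unfold eta; fun_prop
  exact this.measurable

end Eta

/-! ### Functionals of weights and their observation operators -/

/-- The functionals of weight vectors to which the observation operators are applied: measurable,
and bounded by a multiple of the total mass. -/
structure Adm {Ω : Type} [Fintype Ω] (h : (Ω → ℝ) → ℝ) : Prop where
  measurable : Measurable h
  bound : ∃ K, ∀ w, 0 ≤ w → |h w| ≤ K * ∑ σ, w σ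

section Adm

variable {Ω : Type} [Fintype Ω] {h h' : (Ω → ℝ) → ℝ}

lemma adm_eta : Adm (eta : (Ω → ℝ) → ℝ) :=
  ⟨measurable_eta, _, fun w hw => by rw [abs_of_nonneg (eta_nonneg hw)]; exact eta_le hw⟩

lemma adm_mass : Adm (fun w : Ω → ℝ => ∑ σ, w σ) :=
  ⟨by fun_prop, 1, fun w hw => by rw [abs_of_nonneg (Finset.sum_nonneg fun σ _ => hw σ), one_mul]⟩

lemma Adm.add (hh : Adm h) (hh' : Adm h') : Adm (fun w => h w + h' w) := by
  obtain ⟨m, K, hK⟩ := hh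
  obtain ⟨m', K', hK'⟩ := hh'
  refine ⟨m.add m', K + K', fun w hw => ?_⟩
  rw [add_mul]
  exact (abs_add_le _ _).trans (add_le_add (hK w hw) (hK' w hw))

lemma Adm.const_mul (hh : Adm h) (c : ℝ) : Adm (fun w => c * h w) := by
  obtain ⟨m, K, hK⟩ := hh
  refine ⟨m.const_mul c, |c| * K, fun w hw => ?_⟩
  rw [abs_mul, mul_assoc]
  exact mul_le_mul_of_nonneg_left (hK w hw) (abs_nonneg _)

lemma adm_sum {ι : Type*} (s : Finset ι) {f : ι → (Ω → ℝ) → ℝ} (hf : ∀ i ∈ s, Adm (f i)) :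
    Adm (fun w => ∑ i ∈ s, f i w) := by
  classical
  induction s using Finset.induction_on with
  | empty => exact ⟨by simp, 0, by simp⟩
  | insert a s ha ih =>
    simp only [Finset.sum_insert ha]
    exact (hf a (by simp)).add (ih fun i hi => hf i (by simp [hi]))

end Adm

/-- The signal seen by one row of the measurement matrix: `s c` is the standard deviation of the
entries of the row in section `c`, `g` the array of standardized entries, and the section of type
`a` has components `x a`. -/
def coup {A C : Type} [Fintype C] {B : ℕ} (x : A → Fin B → ℝ) (s : C → ℝ) (g : C → Fin B → ℝ)
    (σ : C → A) : ℝ :=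
  pair g fun c j => s c * x (σ c) j

/-- Unnormalized Bayes update of weights by one measurement: `θ.1` is the standardized row of the
matrix and `θ.2` the observation, standard Gaussian under the reference law. -/
def upd {A C : Type} [Fintype C] {B : ℕ} (x : A → Fin B → ℝ) (s : C → ℝ) (w : (C → A) → ℝ)
    (θ : (C → Fin B → ℝ) × ℝ) (σ : C → A) : ℝ :=
  w σ * lik (coup x s θ.1 σ) θ.2

/-- Reference law of a standardized row of the matrix and of the corresponding observation. -/
def rowLaw (C : Type) [Fintype C] (B : ℕ) : Measure ((C → Fin B → ℝ) × ℝ) :=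
  (stdLaw C B).prod (gaussianReal 0 1)

instance {C : Type} [Fintype C] {B : ℕ} : IsProbabilityMeasure (rowLaw C B) := by
  unfold rowLaw; infer_instance

/-- The operator averaging a functional of the weights over the Bayes update by one measurement.
For a `1`-homogeneous functional it is the conditional expectation of its value at the posterior. -/
def obs {A C : Type} [Fintype C] {B : ℕ} (x : A → Fin B → ℝ) (s : C → ℝ)
    (h : ((C → A) → ℝ) → ℝ) (w : (C → A) → ℝ) : ℝ :=
  ∫ θ, h (upd x s w θ) ∂(rowLaw C B)

section Obs

variable {A C : Type} [Fintype A] [Fintype C] [DecidableEq C] {B : ℕ} {x : A → Fin B → ℝ}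
  {h h' : ((C → A) → ℝ) → ℝ} {w : (C → A) → ℝ}

lemma measurable_coup (x : A → Fin B → ℝ) (s : C → ℝ) (σ : C → A) :
    Measurable fun g => coup x s g σ := measurable_pair_left _

lemma measurable_upd (x : A → Fin B → ℝ) (s : C → ℝ) :
    Measurable fun p : ((C → A) → ℝ) × ((C → Fin B → ℝ) × ℝ) => upd x s p.1 p.2 := by
  refine measurable_pi_lambda _ fun σ => ?_
  unfold upd
  have h1 : Measurable fun p : ((C → A) → ℝ) × ((C → Fin B → ℝ) × ℝ) => coup x s p.2.1 σ :=
    (measurable_coup x s σ).comp (measurable_fst.comp measurable_snd)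
  have h2 : Measurable fun p : ((C → A) → ℝ) × ((C → Fin B → ℝ) × ℝ) =>
      lik (coup x s p.2.1 σ) p.2.2 :=
    measurable_lik.comp (h1.prodMk (measurable_snd.comp measurable_snd))
  have h3 : Measurable fun p : ((C → A) → ℝ) × ((C → Fin B → ℝ) × ℝ) => p.1 σ :=
    (measurable_pi_apply σ).comp measurable_fst
  exact h3.mul h2

lemma upd_nonneg (hw : 0 ≤ w) (x : A → Fin B → ℝ) (s : C → ℝ) (θ) : 0 ≤ upd x s w θ :=
  fun σ => mul_nonneg (hw σ) (lik_pos _ _).le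

lemma upd_comm (x : A → Fin B → ℝ) (s t : C → ℝ) (θ θ') :
    upd x t (upd x s w θ) θ' = upd x s (upd x t w θ') θ := by
  funext σ; simp only [upd]; ring

lemma lik_coup (x : A → Fin B → ℝ) (s : C → ℝ) (σ : C → A) :
    Integrable (fun θ : (C → Fin B → ℝ) × ℝ => lik (coup x s θ.1 σ) θ.2) (rowLaw C B) ∧
      ∫ θ, lik (coup x s θ.1 σ) θ.2 ∂(rowLaw C B) = 1 := by
  have hm : Measurable fun θ : (C → Fin B → ℝ) × ℝ => lik (coup x s θ.1 σ) θ.2 :=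
    measurable_lik.comp (((measurable_coup x s σ).comp measurable_fst).prodMk measurable_snd)
  have hi : Integrable (fun θ : (C → Fin B → ℝ) × ℝ => lik (coup x s θ.1 σ) θ.2)
      (rowLaw C B) := by
    unfold rowLaw
    rw [integrable_prod_iff hm.aestronglyMeasurable]
    refine ⟨ae_of_all _ fun g => integrable_lik (coup x s g σ), ?_⟩
    simp only [Real.norm_of_nonneg (lik_pos _ _).le, integral_lik]
    exact integrable_const _
  refine ⟨hi, ?_⟩
  unfold rowLaw at hi ⊢
  rw [integral_prod _ hi]
  simp [integral_lik]

lemma mass_upd (x : A → Fin B → ℝ) (s : C → ℝ) (w : (C → A) → ℝ) :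
    Integrable (fun θ => ∑ σ, upd x s w θ σ) (rowLaw C B) ∧
      ∫ θ, ∑ σ, upd x s w θ σ ∂(rowLaw C B) = ∑ σ, w σ := by
  unfold upd
  refine ⟨integrable_finsetSum _ fun σ _ => (lik_coup x s σ).1.const_mul _, ?_⟩
  rw [integral_finsetSum _ fun σ _ => (lik_coup x s σ).1.const_mul _]
  simp [integral_const_mul, (lik_coup x s _).2]

lemma Adm.integrable_upd (hh : Adm h) (hw : 0 ≤ w) (x : A → Fin B → ℝ) (s : C → ℝ) :
    Integrable (fun θ => h (upd x s w θ)) (rowLaw C B) := by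
  obtain ⟨m, K, hK⟩ := hh
  refine ((mass_upd x s w).1.const_mul K).mono' ?_ (ae_of_all _ fun θ => hK _ (upd_nonneg hw x s θ))
  exact (m.comp ((measurable_upd x s).comp (measurable_const.prodMk
    measurable_id))).aestronglyMeasurable

lemma Adm.obs (hh : Adm h) (x : A → Fin B → ℝ) (s : C → ℝ) : Adm (obs x s h) := by
  have hh' := hh
  obtain ⟨m, K, hK⟩ := hh
  refine ⟨?_, K, fun w hw => ?_⟩
  · have : StronglyMeasurable fun p : ((C → A) → ℝ) × ((C → Fin B → ℝ) × ℝ) =>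
        h (upd x s p.1 p.2) := (m.comp (measurable_upd x s)).stronglyMeasurable
    exact this.integral_prod_right.measurable
  · rw [← (mass_upd x s w).2, ← integral_const_mul]
    unfold LinearEstimation.obs
    rw [← Real.norm_eq_abs]
    exact norm_integral_le_of_norm_le ((mass_upd x s w).1.const_mul K)
      (ae_of_all _ fun θ => hK _ (upd_nonneg hw x s θ))

lemma obs_mono (hh : Adm h) (hh' : Adm h') (hle : ∀ w, 0 ≤ w → h w ≤ h' w) (s : C → ℝ)
    (hw : 0 ≤ w) : obs x s h w ≤ obs x s h' w :=
  integral_mono (hh.integrable_upd hw x s) (hh'.integrable_upd hw x s)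
    fun θ => hle _ (upd_nonneg hw x s θ)

lemma obs_congr (hle : ∀ w, 0 ≤ w → h w = h' w) (s : C → ℝ)
    (hw : 0 ≤ w) : obs x s h w = obs x s h' w :=
  integral_congr_ae (ae_of_all _ fun θ => hle _ (upd_nonneg hw x s θ))

lemma obs_add (hh : Adm h) (hh' : Adm h') (s : C → ℝ) (hw : 0 ≤ w) :
    obs x s (fun w => h w + h' w) w = obs x s h w + obs x s h' w :=
  integral_add (hh.integrable_upd hw x s) (hh'.integrable_upd hw x s)

lemma obs_const_mul (c : ℝ) (s : C → ℝ) :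
    obs x s (fun w => c * h w) w = c * obs x s h w :=
  integral_const_mul _ _

lemma obs_sum {ι : Type*} (I : Finset ι) {f : ι → ((C → A) → ℝ) → ℝ} (hf : ∀ i ∈ I, Adm (f i))
    (s : C → ℝ) (hw : 0 ≤ w) :
    obs x s (fun w => ∑ i ∈ I, f i w) w = ∑ i ∈ I, obs x s (f i) w :=
  integral_finsetSum _ fun i hi => (hf i hi).integrable_upd hw x s

lemma obs_mass (s : C → ℝ) (w : (C → A) → ℝ) :
    obs x s (fun w => ∑ σ, w σ) w = ∑ σ, w σ := (mass_upd x s w).2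

lemma obs_comm (hh : Adm h) (s t : C → ℝ) (hw : 0 ≤ w) :
    obs x s (obs x t h) w = obs x t (obs x s h) w := by
  obtain ⟨m, K, hK⟩ := hh
  unfold obs
  have hF : Integrable (fun p : ((C → Fin B → ℝ) × ℝ) × ((C → Fin B → ℝ) × ℝ) =>
      h (upd x t (upd x s w p.1) p.2)) ((rowLaw C B).prod (rowLaw C B)) := by
    have hb : Integrable (fun p : ((C → Fin B → ℝ) × ℝ) × ((C → Fin B → ℝ) × ℝ) =>
        K * ∑ σ, upd x t (upd x s w p.1) p.2 σ) ((rowLaw C B).prod (rowLaw C B)) := by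
      refine (integrable_finsetSum _ fun σ _ => ?_).const_mul K
      simp only [upd, mul_assoc]
      exact ((lik_coup x s σ).1.mul_prod (lik_coup x t σ).1).const_mul _
    refine hb.mono' ?_ (ae_of_all _ fun p => hK _ (upd_nonneg (upd_nonneg hw x s _) x t _))
    have h1 : Measurable fun p : ((C → Fin B → ℝ) × ℝ) × ((C → Fin B → ℝ) × ℝ) =>
        upd x s w p.1 := (measurable_upd x s).comp (measurable_const.prodMk measurable_fst)
    exact (m.comp ((measurable_upd x t).comp (h1.prodMk measurable_snd))).aestronglyMeasurable
  rw [integral_integral_swap (f := fun θ θ' => h (upd x t (upd x s w θ) θ')) hF]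
  simp only [upd_comm x s t]

/-- Successive measurements by rows with the given standard deviations. -/
def obsList {A C : Type} [Fintype C] {B : ℕ} (x : A → Fin B → ℝ) (l : List (C → ℝ))
    (h : ((C → A) → ℝ) → ℝ) : ((C → A) → ℝ) → ℝ :=
  l.foldr (fun s h => obs x s h) h

@[simp] lemma obsList_nil : obsList x [] h = h := rfl

@[simp] lemma obsList_cons (s : C → ℝ) (l) : obsList x (s :: l) h = obs x s (obsList x l h) := rfl

lemma obsList_append (l l' : List (C → ℝ)) :
    obsList x (l ++ l') h = obsList x l (obsList x l' h) := by
  simp [obsList]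

lemma Adm.obsList (hh : Adm h) (x : A → Fin B → ℝ) (l : List (C → ℝ)) : Adm (obsList x l h) := by
  induction l with
  | nil => exact hh
  | cons s l ih => exact ih.obs x s

lemma obsList_mono (hh : Adm h) (hh' : Adm h') (hle : ∀ w, 0 ≤ w → h w ≤ h' w)
    (l : List (C → ℝ)) (hw : 0 ≤ w) : obsList x l h w ≤ obsList x l h' w := by
  induction l generalizing w with
  | nil => exact hle w hw
  | cons s l ih => exact obs_mono (hh.obsList x l) (hh'.obsList x l) (fun w hw => ih hw) s hw

lemma obsList_add (hh : Adm h) (hh' : Adm h') (l : List (C → ℝ)) (hw : 0 ≤ w) :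
    obsList x l (fun w => h w + h' w) w = obsList x l h w + obsList x l h' w := by
  induction l generalizing w with
  | nil => rfl
  | cons s l ih =>
    rw [obsList_cons, obs_congr (fun w hw => ih hw) s hw]
    exact obs_add (hh.obsList x l) (hh'.obsList x l) s hw

lemma obsList_mass (l : List (C → ℝ)) (hw : 0 ≤ w) (c : ℝ) :
    obsList x l (fun w => c * ∑ σ, w σ) w = c * ∑ σ, w σ := by
  induction l generalizing w with
  | nil => rfl
  | cons s l ih =>
    rw [obsList_cons, obs_congr (fun w hw => ih hw) s hw, obs_const_mul, obs_mass]

lemma obsList_perm (hh : Adm h) {l l' : List (C → ℝ)} (hl : l.Perm l') (hw : 0 ≤ w) :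
    obsList x l h w = obsList x l' h w := by
  induction hl generalizing w with
  | nil => rfl
  | cons s _ ih => exact obs_congr (fun w hw => ih hw) s hw
  | swap s t l => exact obs_comm (hh.obsList x l) t s hw
  | trans _ _ ih1 ih2 => exact (ih1 hw).trans (ih2 hw)

end Obs

/-! ### Revealing sections -/

section Reveal

variable {A C : Type} [Fintype A] [DecidableEq A] [Fintype C] [DecidableEq C] {B : ℕ}
  {x : A → Fin B → ℝ} {h h' : ((C → A) → ℝ) → ℝ} {w : (C → A) → ℝ}

/-- Conditioning on the event that section `c` has type `k`, without normalization. -/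
def restr (c : C) (k : A) (w : (C → A) → ℝ) (σ : C → A) : ℝ := if σ c = k then w σ else 0

/-- The operator averaging a functional of the weights over the disclosure of a uniformly random
section. -/
def reveal (h : ((C → A) → ℝ) → ℝ) (w : (C → A) → ℝ) : ℝ :=
  (Fintype.card C : ℝ)⁻¹ * ∑ c, ∑ k, h (restr c k w)

lemma restr_nonneg (hw : 0 ≤ w) (c : C) (k : A) : 0 ≤ restr c k w := fun σ => by
  unfold restr; split_ifs
  · exact hw σ
  · exact le_rfl

lemma sum_restr (c : C) (w : (C → A) → ℝ) :
    ∑ k, ∑ σ, restr c k w σ = ∑ σ, w σ := by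
  rw [Finset.sum_comm]
  simp [restr]

lemma reveal_mono (hle : ∀ w, 0 ≤ w → h w ≤ h' w) (hw : 0 ≤ w) : reveal h w ≤ reveal h' w :=
  mul_le_mul_of_nonneg_left (Finset.sum_le_sum fun c _ => Finset.sum_le_sum fun k _ =>
    hle _ (restr_nonneg hw c k)) (by positivity)

lemma reveal_congr (hle : ∀ w, 0 ≤ w → h w = h' w) (hw : 0 ≤ w) : reveal h w = reveal h' w :=
  le_antisymm (reveal_mono (fun w hw => (hle w hw).le) hw)
    (reveal_mono (fun w hw => (hle w hw).ge) hw)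

lemma reveal_add : reveal (fun w => h w + h' w) w = reveal h w + reveal h' w := by
  simp [reveal, Finset.sum_add_distrib, mul_add]

lemma reveal_const_mul (c : ℝ) : reveal (fun w => c * h w) w = c * reveal h w := by
  simp only [reveal, ← Finset.mul_sum]; ring

lemma reveal_mass [Nonempty C] (w : (C → A) → ℝ) : reveal (fun w => ∑ σ, w σ) w = ∑ σ, w σ := by
  simp only [reveal, sum_restr]
  have : (Fintype.card C : ℝ) ≠ 0 := by exact_mod_cast Fintype.card_ne_zero
  simp [this]

lemma Adm.reveal (hh : Adm h) : Adm (reveal h) := by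
  have hres : ∀ c k, Adm (fun w => h (restr c k w)) := fun c k => by
    obtain ⟨m, K, hK⟩ := hh
    refine ⟨m.comp (measurable_pi_lambda _ fun σ => ?_), |K|, fun w hw => ?_⟩
    · unfold restr; split_ifs <;> fun_prop
    · refine (hK _ (restr_nonneg hw c k)).trans ?_
      refine mul_le_mul (le_abs_self K) (Finset.sum_le_sum fun σ _ => ?_)
        (Finset.sum_nonneg fun σ _ => restr_nonneg hw c k σ) (abs_nonneg K)
      unfold restr; split_ifs
      · exact le_rfl
      · exact hw σ
  exact (adm_sum _ fun c _ => adm_sum _ fun k _ => hres c k).const_mul _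

lemma obs_reveal (hh : Adm h) (s : C → ℝ) (hw : 0 ≤ w) :
    obs x s (reveal h) w = reveal (obs x s h) w := by
  have e : ∀ c k θ, restr c k (upd x s w θ) = upd x s (restr c k w) θ := by
    intro c k θ; funext σ; simp only [restr, upd]; split_ifs <;> simp
  unfold obs reveal
  rw [integral_const_mul]
  simp only [e]
  rw [integral_finsetSum _ fun c _ => integrable_finsetSum _ fun k _ =>
    hh.integrable_upd (restr_nonneg hw c k) x s]
  congr 1
  refine Finset.sum_congr rfl fun c _ => ?_
  rw [integral_finsetSum _ fun k _ => hh.integrable_upd (restr_nonneg hw c k) x s]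

lemma Adm.reveal_iterate (hh : Adm h) (t : ℕ) : Adm (LinearEstimation.reveal^[t] h) := by
  induction t with
  | zero => exact hh
  | succ t ih => rw [Function.iterate_succ_apply']; exact ih.reveal

lemma obs_reveal_iterate (hh : Adm h) (s : C → ℝ) (t : ℕ) (hw : 0 ≤ w) :
    obs x s (reveal^[t] h) w = reveal^[t] (obs x s h) w := by
  induction t generalizing w with
  | zero => rfl
  | succ t ih =>
    rw [Function.iterate_succ_apply', Function.iterate_succ_apply',
      obs_reveal (hh.reveal_iterate t) s hw]
    exact reveal_congr (fun w hw => ih hw) hw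

lemma reveal_iterate_mono (hle : ∀ w, 0 ≤ w → h w ≤ h' w) (t : ℕ) (hw : 0 ≤ w) :
    reveal^[t] h w ≤ reveal^[t] h' w := by
  induction t generalizing w with
  | zero => exact hle w hw
  | succ t ih =>
    rw [Function.iterate_succ_apply', Function.iterate_succ_apply']
    exact reveal_mono (fun w hw => ih hw) hw

lemma reveal_iterate_add (t : ℕ) :
    reveal^[t] (fun w => h w + h' w) w = reveal^[t] h w + reveal^[t] h' w := by
  induction t generalizing w with
  | zero => rfl
  | succ t ih =>
    simp only [Function.iterate_succ_apply']
    rw [show reveal^[t] (fun w => h w + h' w) = fun w => reveal^[t] h w + reveal^[t] h' w from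
      funext fun w => ih, reveal_add]

lemma reveal_iterate_const_mul (c : ℝ) (t : ℕ) :
    reveal^[t] (fun w => c * h w) w = c * reveal^[t] h w := by
  induction t generalizing w with
  | zero => rfl
  | succ t ih =>
    simp only [Function.iterate_succ_apply']
    rw [show reveal^[t] (fun w => c * h w) = fun w => c * reveal^[t] h w from
      funext fun w => ih, reveal_const_mul]

lemma reveal_iterate_mass [Nonempty C] (t : ℕ) (w : (C → A) → ℝ) :
    reveal^[t] (fun w => ∑ σ, w σ) w = ∑ σ, w σ := by
  induction t generalizing w with
  | zero => rfl
  | succ t ih =>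
    rw [Function.iterate_succ_apply', show reveal^[t] (fun w : (C → A) → ℝ => ∑ σ, w σ) =
      fun w => ∑ σ, w σ from funext fun w => ih w, reveal_mass]

/-- Disclosing one section lowers the entropy by the entropy of that section. -/
lemma eta_eq_sum_restr (c : C) (w : (C → A) → ℝ) :
    eta w = ∑ k, eta (restr c k w) + eta (fun k => ∑ σ, restr c k w σ) := by
  have e : ∑ k, ∑ σ, Real.negMulLog (restr c k w σ) = ∑ σ, Real.negMulLog (w σ) := by
    rw [Finset.sum_comm]
    refine Finset.sum_congr rfl fun σ _ => ?_
    rw [Finset.sum_eq_single (σ c)]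
    · simp [restr]
    · intro k _ hk; simp [restr, hk.symm]
    · simp
  simp only [eta, Finset.sum_sub_distrib, e, sum_restr]
  ring

lemma reveal_eta_le [Nonempty C] (hw : 0 ≤ w) : reveal eta w ≤ eta w := by
  have hc : (0 : ℝ) < Fintype.card C := by exact_mod_cast Fintype.card_pos
  have : ∑ c : C, ∑ k, eta (restr c k w) ≤ ∑ c : C, eta w := Finset.sum_le_sum fun c _ => by
    have := eta_nonneg (w := fun k => ∑ σ, restr c k w σ)
      fun k => Finset.sum_nonneg fun σ _ => restr_nonneg hw c k σ
    rw [eta_eq_sum_restr c w]; linarith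
  rw [reveal, inv_mul_le_iff₀ hc]
  simpa using this

lemma le_reveal_eta [Nonempty C] (hw : 0 ≤ w) :
    eta w ≤ reveal eta w + Real.log (Fintype.card A) * ∑ σ, w σ := by
  have hc : (0 : ℝ) < Fintype.card C := by exact_mod_cast Fintype.card_pos
  have : ∑ c : C, eta w ≤
      ∑ c : C, (∑ k, eta (restr c k w) + Real.log (Fintype.card A) * ∑ σ, w σ) :=
    Finset.sum_le_sum fun c _ => by
      have := eta_le (w := fun k => ∑ σ, restr c k w σ)
        fun k => Finset.sum_nonneg fun σ _ => restr_nonneg hw c k σ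
      rw [sum_restr] at this
      rw [eta_eq_sum_restr c w]; linarith
  rw [Finset.sum_add_distrib, Finset.sum_const, Finset.sum_const, Finset.card_univ, nsmul_eq_mul,
    nsmul_eq_mul] at this
  rw [reveal, ← mul_le_mul_iff_right₀ hc, mul_add, mul_inv_cancel_left₀ hc.ne']
  exact this

lemma reveal_iterate_eta_le [Nonempty C] (t : ℕ) (hw : 0 ≤ w) : reveal^[t] eta w ≤ eta w := by
  induction t generalizing w with
  | zero => exact le_rfl
  | succ t ih =>
    rw [Function.iterate_succ_apply']
    exact (reveal_mono (fun w hw => ih hw) hw).trans (reveal_eta_le hw)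

lemma le_reveal_iterate_eta [Nonempty C] (t : ℕ) (hw : 0 ≤ w) :
    eta w ≤ reveal^[t] eta w + t * Real.log (Fintype.card A) * ∑ σ, w σ := by
  induction t generalizing w with
  | zero => simp
  | succ t ih =>
    have h1 := reveal_mono (h := eta) (h' := fun w => reveal^[t] eta w +
      t * Real.log (Fintype.card A) * ∑ σ, w σ) (fun w hw => ih hw) hw
    rw [reveal_add, reveal_const_mul, reveal_mass] at h1
    rw [Function.iterate_succ_apply']
    have h2 := le_reveal_eta hw
    push_cast
    linarith

/-- Average over the disclosure of `t` random sections, with `t` uniform in `{0, …, T - 1}`. -/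
def avgReveal (T : ℕ) (h : ((C → A) → ℝ) → ℝ) (w : (C → A) → ℝ) : ℝ :=
  (T : ℝ)⁻¹ * ∑ t ∈ Finset.range T, reveal^[t] h w

lemma Adm.avgReveal (hh : Adm h) (T : ℕ) : Adm (avgReveal T h) :=
  (adm_sum _ fun t _ => hh.reveal_iterate t).const_mul _

lemma obs_avgReveal (hh : Adm h) (s : C → ℝ) (T : ℕ) (hw : 0 ≤ w) :
    obs x s (avgReveal T h) w = avgReveal T (obs x s h) w := by
  unfold avgReveal
  rw [obs_const_mul, obs_sum _ (fun t _ => hh.reveal_iterate t) s hw]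
  congr 1
  exact Finset.sum_congr rfl fun t _ => obs_reveal_iterate hh s t hw

lemma avgReveal_mono (hle : ∀ w, 0 ≤ w → h w ≤ h' w) (T : ℕ) (hw : 0 ≤ w) :
    avgReveal T h w ≤ avgReveal T h' w :=
  mul_le_mul_of_nonneg_left (Finset.sum_le_sum fun t _ => reveal_iterate_mono hle t hw)
    (by positivity)

lemma avgReveal_add (T : ℕ) :
    avgReveal T (fun w => h w + h' w) w = avgReveal T h w + avgReveal T h' w := by
  simp only [avgReveal, reveal_iterate_add, Finset.sum_add_distrib, mul_add]

lemma avgReveal_const_mul (c : ℝ) (T : ℕ) :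
    avgReveal T (fun w => c * h w) w = c * avgReveal T h w := by
  simp only [avgReveal, reveal_iterate_const_mul, ← Finset.mul_sum]; ring

lemma avgReveal_mass [Nonempty C] {T : ℕ} (hT : T ≠ 0) (w : (C → A) → ℝ) :
    avgReveal T (fun w => ∑ σ, w σ) w = ∑ σ, w σ := by
  simp only [avgReveal, reveal_iterate_mass]
  have : (T : ℝ) ≠ 0 := by exact_mod_cast hT
  simp [this]

/-- The disclosure increments of a functional telescope. -/
lemma avgReveal_increment (T : ℕ) :
    avgReveal T (fun w => reveal h w + (-1) * h w) w = (T : ℝ)⁻¹ * (reveal^[T] h w - h w) := by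
  simp only [avgReveal, reveal_iterate_add, reveal_iterate_const_mul]
  congr 1
  have := Finset.sum_range_sub (fun t => reveal^[t] h w) T
  rw [Function.iterate_zero_apply] at this
  rw [← this]
  refine Finset.sum_congr rfl fun t _ => ?_
  rw [Function.iterate_succ_apply]; ring

lemma avgReveal_eta_le [Nonempty C] (T : ℕ) (hw : 0 ≤ w) : avgReveal T eta w ≤ eta w := by
  rcases Nat.eq_zero_or_pos T with rfl | hT
  · simpa [avgReveal] using eta_nonneg hw
  have hT' : (0 : ℝ) < T := by exact_mod_cast hT
  rw [avgReveal, inv_mul_le_iff₀ hT']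
  refine (Finset.sum_le_sum fun t _ => reveal_iterate_eta_le t hw).trans ?_
  simp

lemma le_avgReveal_eta [Nonempty C] {T : ℕ} (hT : T ≠ 0) (hw : 0 ≤ w) :
    eta w ≤ avgReveal T eta w + T * Real.log (Fintype.card A) * ∑ σ, w σ := by
  have hT' : (0 : ℝ) < T := by exact_mod_cast Nat.pos_of_ne_zero hT
  have hlog : 0 ≤ Real.log (Fintype.card A) := Real.log_natCast_nonneg _
  have hW : 0 ≤ ∑ σ, w σ := Finset.sum_nonneg fun σ _ => hw σ
  have h1 : ∑ t ∈ Finset.range T, eta w ≤ ∑ t ∈ Finset.range T, (reveal^[t] eta w +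
      T * Real.log (Fintype.card A) * ∑ σ, w σ) := Finset.sum_le_sum fun t ht => by
    refine (le_reveal_iterate_eta t hw).trans ?_
    have : (t : ℝ) ≤ T := by exact_mod_cast (Finset.mem_range.1 ht).le
    gcongr
  rw [Finset.sum_add_distrib, Finset.sum_const, Finset.sum_const, Finset.card_range, nsmul_eq_mul,
    nsmul_eq_mul] at h1
  rw [avgReveal, ← mul_le_mul_iff_right₀ hT', mul_add, mul_inv_cancel_left₀ hT'.ne']
  exact h1

end Reveal

/-! ### Information gained from one additional measurement -/

section OneRow

variable {A C : Type} [Fintype A] [DecidableEq A] [Fintype C] [DecidableEq C] {B : ℕ}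

/-- Weight of the event that section `c` has type `k`. -/
def marg (w : (C → A) → ℝ) (c : C) (k : A) : ℝ := ∑ σ, restr c k w σ

/-- Covariance, under weights of total mass one, of the events that sections `c` and `c'` have
types `k` and `k'`. -/
def margCov (w : (C → A) → ℝ) (c : C) (k : A) (c' : C) (k' : A) : ℝ :=
  marg (restr c' k' w) c k - marg w c k * marg w c' k'

/-- Average over all pairs of sections of the squared covariances of their types. -/
def pairDep (w : (C → A) → ℝ) : ℝ :=
  (Fintype.card C : ℝ)⁻¹ ^ 2 * ∑ c, ∑ c', ∑ k, ∑ k', margCov w c k c' k' ^ 2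

/-- Average over the sections of the collision probability of their type, as a `1`-homogeneous
functional. -/
def collision (w : (C → A) → ℝ) : ℝ :=
  (Fintype.card C : ℝ)⁻¹ * ∑ c, ∑ k, marg w c k ^ 2 / ∑ σ, w σ

variable {w : (C → A) → ℝ}

lemma marg_nonneg (hw : 0 ≤ w) (c : C) (k : A) : 0 ≤ marg w c k :=
  Finset.sum_nonneg fun σ _ => restr_nonneg hw c k σ

lemma sum_marg (w : (C → A) → ℝ) (c : C) : ∑ k, marg w c k = ∑ σ, w σ := sum_restr c w

lemma restr_comm (c c' : C) (k k' : A) (w : (C → A) → ℝ) :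
    restr c k (restr c' k' w) = restr c' k' (restr c k w) := by
  funext σ; simp only [restr]; split_ifs <;> rfl

lemma sum_marg_restr (w : (C → A) → ℝ) (c c' : C) (k : A) :
    ∑ k', marg (restr c' k' w) c k = marg w c k := by
  simp only [marg, restr_comm c c' k]
  exact sum_restr c' _

lemma marg_le_mass (hw : 0 ≤ w) (c : C) (k : A) : marg w c k ≤ ∑ σ, w σ := by
  refine Finset.sum_le_sum fun σ _ => ?_
  unfold restr; split_ifs
  · exact le_rfl
  · exact hw σ

/-- Disclosing a random section raises the collision probability by at least the average squared
pairwise covariance. -/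
lemma pairDep_le_reveal_collision (hw : 0 ≤ w) (h1 : ∑ σ, w σ = 1) :
    pairDep w ≤ reveal collision w + (-1) * collision w := by
  rcases isEmpty_or_nonempty C with hC | hC
  · simp [pairDep, reveal, collision]
  have hn : (Fintype.card C : ℝ) ≠ 0 := by exact_mod_cast Fintype.card_ne_zero
  -- the increase of the squared probability that `c` has type `k`, when `c'` is disclosed, is the
  -- variance of its conditional probability
  have key : ∀ c c' k, ∑ k', margCov w c k c' k' ^ 2 ≤
      ∑ k', marg (restr c' k' w) c k ^ 2 / marg w c' k' - marg w c k ^ 2 := by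
    intro c c' k
    have hterm : ∀ k', margCov w c k c' k' ^ 2 ≤ marg (restr c' k' w) c k ^ 2 / marg w c' k' -
        2 * marg w c k * marg (restr c' k' w) c k + marg w c k ^ 2 * marg w c' k' := by
      intro k'
      have hq0 := marg_nonneg hw c' k'
      have hq1 : marg w c' k' ≤ 1 := h1 ▸ marg_le_mass hw c' k'
      have hp0 := marg_nonneg (restr_nonneg hw c' k') c k
      have hpq : marg (restr c' k' w) c k ≤ marg w c' k' :=
        marg_le_mass (restr_nonneg hw c' k') c k
      rcases hq0.eq_or_lt with h0 | h0
      · have hp : marg (restr c' k' w) c k = 0 := le_antisymm (h0 ▸ hpq) hp0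
        simp [margCov, ← h0, hp]
      · have e : marg (restr c' k' w) c k ^ 2 / marg w c' k' -
            2 * marg w c k * marg (restr c' k' w) c k + marg w c k ^ 2 * marg w c' k' =
            margCov w c k c' k' ^ 2 / marg w c' k' := by
          rw [margCov]; field_simp; ring
        rw [e, le_div_iff₀ h0]
        exact mul_le_of_le_one_right (sq_nonneg _) hq1
    refine (Finset.sum_le_sum fun k' _ => hterm k').trans_eq ?_
    rw [Finset.sum_add_distrib, Finset.sum_sub_distrib, ← Finset.mul_sum, ← Finset.mul_sum,
      sum_marg_restr, sum_marg, h1]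
    ring
  have e1 : reveal collision w = (Fintype.card C : ℝ)⁻¹ ^ 2 *
      ∑ c, ∑ c', ∑ k, ∑ k', marg (restr c' k' w) c k ^ 2 / marg w c' k' := by
    simp only [reveal, collision, ← Finset.mul_sum]
    rw [← mul_assoc, ← sq]
    congr 1
    symm
    rw [Finset.sum_comm]
    refine Finset.sum_congr rfl fun c' _ => ?_
    symm
    rw [Finset.sum_comm]
    refine Finset.sum_congr rfl fun c _ => ?_
    rw [Finset.sum_comm]
    rfl
  have e2 : collision w = (Fintype.card C : ℝ)⁻¹ ^ 2 *
      ∑ c : C, ∑ _c' : C, ∑ k, marg w c k ^ 2 := by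
    simp only [collision, h1, div_one, Finset.sum_const, Finset.card_univ, nsmul_eq_mul,
      ← Finset.mul_sum]
    field_simp
  rw [e1, e2, pairDep, neg_one_mul, ← sub_eq_add_neg, ← mul_sub]
  refine mul_le_mul_of_nonneg_left ?_ (by positivity)
  simp only [← Finset.sum_sub_distrib]
  exact Finset.sum_le_sum fun c _ => Finset.sum_le_sum fun c' _ => Finset.sum_le_sum fun k _ =>
    key c c' k

lemma expect_pair (w : (C → A) → ℝ) (c c' : C) (f f' : A → ℝ) :
    ∑ σ, w σ * (f (σ c) * f' (σ c')) = ∑ k, ∑ k', f k * f' k' * marg (restr c' k' w) c k := by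
  have e : ∀ k k', f k * f' k' * marg (restr c' k' w) c k =
      ∑ σ, if σ c = k then (if σ c' = k' then f k * f' k' * w σ else 0) else 0 := by
    intro k k'
    rw [marg, Finset.mul_sum]
    refine Finset.sum_congr rfl fun σ _ => ?_
    simp only [restr]; split_ifs <;> simp
  simp only [e]
  have e2 : ∀ k, ∑ k', ∑ σ : C → A, (if σ c = k then (if σ c' = k' then f k * f' k' * w σ else 0)
      else 0) = ∑ σ : C → A, if σ c = k then f k * f' (σ c') * w σ else 0 := by
    intro k
    rw [Finset.sum_comm]
    refine Finset.sum_congr rfl fun σ _ => ?_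
    split_ifs <;> simp
  simp only [e2]
  rw [Finset.sum_comm]
  refine Finset.sum_congr rfl fun σ _ => ?_
  simp only [Finset.sum_ite_eq, Finset.mem_univ, if_true]
  ring

lemma expect_single (w : (C → A) → ℝ) (c : C) (f : A → ℝ) :
    ∑ σ, w σ * f (σ c) = ∑ k, f k * marg w c k := by
  have e : ∀ k, f k * marg w c k = ∑ σ, if σ c = k then f k * w σ else 0 := by
    intro k
    rw [marg, Finset.mul_sum]
    refine Finset.sum_congr rfl fun σ _ => ?_
    simp only [restr]; split_ifs <;> simp
  simp only [e]
  rw [Finset.sum_comm]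
  refine Finset.sum_congr rfl fun σ _ => ?_
  simp only [Finset.sum_ite_eq, Finset.mem_univ, if_true]
  ring

lemma cov_eq (w : (C → A) → ℝ) (c c' : C) (f f' : A → ℝ) :
    ∑ σ, w σ * (f (σ c) * f' (σ c')) - (∑ σ, w σ * f (σ c)) * ∑ σ, w σ * f' (σ c') =
      ∑ k, ∑ k', f k * f' k' * margCov w c k c' k' := by
  rw [expect_pair, expect_single, expect_single, Finset.sum_mul_sum, ← Finset.sum_sub_distrib]
  refine Finset.sum_congr rfl fun k _ => ?_
  rw [← Finset.sum_sub_distrib]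
  refine Finset.sum_congr rfl fun k' _ => ?_
  rw [margCov]; ring

variable (x : A → Fin B → ℝ) (s : C → ℝ)

/-- Posterior mean of component `j` of section `c`. -/
def meanComp (w : (C → A) → ℝ) (c : C) (j : Fin B) : ℝ := ∑ σ, w σ * x (σ c) j

/-- Deviation of the signal `σ` from its posterior mean, weighted by the standard deviations of a
row. -/
def dev (w : (C → A) → ℝ) (σ : C → A) (c : C) (j : Fin B) : ℝ :=
  s c * (x (σ c) j - meanComp x w c j)

/-- Posterior variance of the signal seen by a row, averaged over the row. -/
def rowVar (w : (C → A) → ℝ) : ℝ := ∑ σ, w σ * pair (dev x s w σ) (dev x s w σ)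

lemma coup_sub_mean (w : (C → A) → ℝ) (g : C → Fin B → ℝ) (σ : C → A) :
    coup x s g σ - pair g (fun c j => s c * meanComp x w c j) = pair g (dev x s w σ) := by
  rw [coup, ← pair_sub]
  congr 1
  funext c j
  simp only [Pi.sub_apply, dev]; ring

lemma eta_sub_obs (hw : 0 ≤ w) :
    Integrable (fun g => scalarInfo w (coup x s g)) (stdLaw C B) ∧
      eta w - obs x s eta w = ∫ g, scalarInfo w (coup x s g) ∂(stdLaw C B) := by
  have h := adm_eta.integrable_upd hw x s
  unfold rowLaw at h
  have h' := h.integral_prod_left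
  refine ⟨(integrable_const (eta w)).sub h', ?_⟩
  have e : ∀ g, scalarInfo w (coup x s g) =
      eta w - ∫ y, eta (upd x s w (g, y)) ∂(gaussianReal 0 1) := fun g => rfl
  simp only [e]
  rw [integral_sub (integrable_const _) h', obs, rowLaw, integral_prod _ h]
  simp

lemma obs_eta_le (hw : 0 ≤ w) (h1 : ∑ σ, w σ = 1) : obs x s eta w ≤ eta w := by
  have := (eta_sub_obs x s hw).2
  have h2 : 0 ≤ ∫ g, scalarInfo w (coup x s g) ∂(stdLaw C B) :=
    integral_nonneg fun g => scalarInfo_nonneg hw h1 _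
  linarith

lemma integral_klRef (d : C → Fin B → ℝ) (κ : ℝ) :
    Integrable (fun g => klRef κ (pair g d)) (stdLaw C B) ∧
    ∫ g, klRef κ (pair g d) ∂(stdLaw C B) =
      1 / 2 * Real.log κ + (1 + pair d d) / (2 * κ) - 1 / 2 := by
  have e : ∀ g, klRef κ (pair g d) = (1 / 2 * Real.log κ + 1 / (2 * κ) - 1 / 2) +
      (2 * κ)⁻¹ * pair g d ^ 2 := by intro g; rw [klRef]; ring
  simp only [e]
  have h := (pair_sq_stdLaw d).1.const_mul (2 * κ)⁻¹
  refine ⟨(integrable_const _).add h, ?_⟩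
  rw [integral_add (integrable_const _) h, integral_const_mul, (pair_sq_stdLaw d).2]
  simp; ring

/-- The information gained from one row is at most that of a Gaussian signal with the same
variance; `κ` is the free parameter of the Gaussian reference law. -/
lemma eta_sub_obs_le (hw : 0 ≤ w) (h1 : ∑ σ, w σ = 1) {κ : ℝ} (hκ : 0 < κ) :
    eta w - obs x s eta w ≤ 1 / 2 * Real.log κ + (1 + rowVar x s w) / (2 * κ) - 1 / 2 := by
  obtain ⟨hi, he⟩ := eta_sub_obs x s hw
  rw [he]
  have hint : Integrable (fun g => ∑ σ, w σ * klRef κ (pair g (dev x s w σ))) (stdLaw C B) :=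
    integrable_finsetSum _ fun σ _ => (integral_klRef _ κ).1.const_mul _
  have hle : ∀ g, scalarInfo w (coup x s g) ≤ ∑ σ, w σ * klRef κ (pair g (dev x s w σ)) := by
    intro g
    have := scalarInfo_le hw h1 (coup x s g) hκ (pair g fun c j => s c * meanComp x w c j)
    simpa only [coup_sub_mean] using this
  refine (integral_mono hi hint hle).trans_eq ?_
  rw [integral_finsetSum _ fun σ _ => (integral_klRef _ κ).1.const_mul _]
  simp only [integral_const_mul, (integral_klRef _ κ).2]
  have : ∀ σ, w σ * (1 / 2 * Real.log κ + (1 + pair (dev x s w σ) (dev x s w σ)) / (2 * κ) - 1 / 2)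
      = w σ * (1 / 2 * Real.log κ + 1 / (2 * κ) - 1 / 2) +
        w σ * pair (dev x s w σ) (dev x s w σ) * (2 * κ)⁻¹ := by intro σ; ring
  simp only [this]
  rw [Finset.sum_add_distrib, ← Finset.sum_mul, ← Finset.sum_mul, h1, rowVar]
  ring

lemma rowVar_nonneg (hw : 0 ≤ w) : 0 ≤ rowVar x s w :=
  Finset.sum_nonneg fun σ _ => mul_nonneg (hw σ) (pair_self_nonneg _)

lemma rowVar_eq (w : (C → A) → ℝ) : rowVar x s w =
    ∑ c, s c ^ 2 * ∑ σ, w σ * ∑ j, (x (σ c) j - meanComp x w c j) ^ 2 := by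
  simp only [rowVar, pair, dev, Finset.mul_sum]
  rw [Finset.sum_comm]
  refine Finset.sum_congr rfl fun c _ => Finset.sum_congr rfl fun σ _ =>
    Finset.sum_congr rfl fun j _ => by ring

/-- The Gaussian bound is attained up to the probability that the signal has an atypical deviation
from the posterior mean, and up to the average overlap of the deviations of two replicas. -/
lemma le_eta_sub_obs (hw : 0 ≤ w) (h1 : ∑ σ, w σ = 1) {δ D : ℝ} (hδ0 : 0 < δ) (hδ : δ ≤ 1 / 4)
    (hD : ∀ σ, pair (dev x s w σ) (dev x s w σ) ≤ D) :
    1 / 2 * Real.log (1 + rowVar x s w) - D *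
        (δ⁻¹ ^ 2 * ∑ σ, w σ * (pair (dev x s w σ) (dev x s w σ) - rowVar x s w) ^ 2) -
      4 * (δ + ∑ σ, ∑ τ, w σ * w τ * |pair (dev x s w σ) (dev x s w τ)|) ≤
      eta w - obs x s eta w := by
  classical
  set V := rowVar x s w with hV
  set a := fun σ τ => pair (dev x s w σ) (dev x s w τ) with ha
  have hV0 : 0 ≤ V := rowVar_nonneg x s hw
  have hVD : V ≤ D := by
    calc V ≤ ∑ σ, w σ * D := Finset.sum_le_sum fun σ _ => mul_le_mul_of_nonneg_left (hD σ) (hw σ)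
      _ = D := by rw [← Finset.sum_mul, h1, one_mul]
  have hD0 : 0 ≤ D := hV0.trans hVD
  set g : Finset (C → A) := Finset.univ.filter fun σ => |a σ σ - V| ≤ δ with hg
  set S := ∑ σ, ∑ τ, w σ * w τ * |a σ τ| with hS
  have hS0 : 0 ≤ S := Finset.sum_nonneg fun σ _ => Finset.sum_nonneg fun τ _ =>
    mul_nonneg (mul_nonneg (hw σ) (hw τ)) (abs_nonneg _)
  have hsplit : ∀ f : (C → A) → ℝ, ∑ σ, f σ = ∑ σ ∈ g, f σ + ∑ σ ∈ gᶜ, f σ := fun f =>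
    (Finset.sum_add_sum_compl g f).symm
  set wb := ∑ σ ∈ gᶜ, w σ with hwb
  set wg := ∑ σ ∈ g, w σ with hwg
  have hsum : wg + wb = 1 := by rw [← h1, hsplit]
  have hwb0 : 0 ≤ wb := Finset.sum_nonneg fun σ _ => hw σ
  -- Chebyshev
  have hcheb : wb ≤ δ⁻¹ ^ 2 * ∑ σ, w σ * (a σ σ - V) ^ 2 := by
    have h2 : wb * δ ^ 2 ≤ ∑ σ, w σ * (a σ σ - V) ^ 2 := by
      rw [hwb, Finset.sum_mul]
      refine (Finset.sum_le_sum fun σ hσ => ?_).trans (Finset.sum_le_sum_of_subset_of_nonneg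
        (Finset.subset_univ gᶜ) fun σ _ _ => mul_nonneg (hw σ) (sq_nonneg _))
      refine mul_le_mul_of_nonneg_left ?_ (hw σ)
      have : δ < |a σ σ - V| := by
        simpa [hg] using hσ
      rw [← sq_abs (a σ σ - V)]
      exact pow_le_pow_left₀ hδ0.le this.le 2
    calc wb = δ⁻¹ ^ 2 * (wb * δ ^ 2) := by field_simp
      _ ≤ _ := mul_le_mul_of_nonneg_left h2 (by positivity)
  have hlogV : 1 / 2 * Real.log (1 + V) ≤ V / 2 := by
    have := Real.log_le_sub_one_of_pos (show 0 < 1 + V by linarith)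
    linarith
  have hDb := mul_le_mul_of_nonneg_left hcheb hD0
  suffices h : 1 / 2 * Real.log (1 + V) - D * wb - 4 * (δ + S) ≤ eta w - obs x s eta w by
    linarith
  rcases lt_or_ge wg (1 / 2) with hlt | hge
  · -- the bad event is likely: the bound is trivial
    have h0 := obs_eta_le x s hw h1
    have : D * (1 / 2) ≤ D * wb := mul_le_mul_of_nonneg_left (by linarith) hD0
    linarith
  · have hwg0 : 0 < wg := by linarith
    have hκ : 1 ≤ 1 + V := by linarith
    obtain ⟨hi, he⟩ := eta_sub_obs x s hw
    rw [he]
    have hmem : ∀ σ ∈ g, |a σ σ - V| ≤ δ := fun σ hσ => (Finset.mem_filter.1 hσ).2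
    have hchi : ∀ σ ∈ g, ∀ τ ∈ g, Integrable (fun y => chiRef (1 + V) (pair y (dev x s w σ))
        (pair y (dev x s w τ))) (stdLaw C B) ∧ ∫ y, chiRef (1 + V) (pair y (dev x s w σ))
        (pair y (dev x s w τ)) ∂(stdLaw C B) ≤ 1 + 2 * (δ + |a σ τ|) := fun σ hσ τ hτ =>
      integral_chiRef_le _ _ hV0 hδ (hmem σ hσ) (hmem τ hτ)
    have i1 : Integrable (fun y => ∑ σ ∈ g, w σ * klRef (1 + V) (pair y (dev x s w σ)))
        (stdLaw C B) := integrable_finsetSum _ fun σ _ => (integral_klRef _ _).1.const_mul _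
    have i3 : Integrable (fun y => wg⁻¹ * ∑ σ ∈ g, ∑ τ ∈ g, w σ * w τ *
        chiRef (1 + V) (pair y (dev x s w σ)) (pair y (dev x s w τ))) (stdLaw C B) :=
      (integrable_finsetSum _ fun σ hσ => integrable_finsetSum _ fun τ hτ =>
        (hchi σ hσ τ hτ).1.const_mul _).const_mul _
    have hle : ∀ y, ∑ σ ∈ g, w σ * klRef (1 + V) (pair y (dev x s w σ)) + (wg - wg⁻¹ *
        ∑ σ ∈ g, ∑ τ ∈ g, w σ * w τ *
          chiRef (1 + V) (pair y (dev x s w σ)) (pair y (dev x s w τ))) ≤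
        scalarInfo w (coup x s y) := by
      intro y
      have := le_scalarInfo hw h1 (coup x s y) g hwg0 hκ (pair y fun c j => s c * meanComp x w c j)
      simpa only [coup_sub_mean] using this
    refine le_trans ?_ (integral_mono (i1.add ((integrable_const wg).sub i3)) hi hle)
    refine le_trans ?_ (integral_add_sub i1 (integrable_const wg) i3).ge
    have v1 : ∫ y, ∑ σ ∈ g, w σ * klRef (1 + V) (pair y (dev x s w σ)) ∂(stdLaw C B) =
        ∑ σ ∈ g, w σ * (1 / 2 * Real.log (1 + V) + (1 + a σ σ) / (2 * (1 + V)) - 1 / 2) := by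
      rw [integral_finsetSum _ fun σ _ => (integral_klRef _ _).1.const_mul _]
      simp only [integral_const_mul, (integral_klRef _ _).2, ha]
    have v3 : ∫ y, wg⁻¹ * ∑ σ ∈ g, ∑ τ ∈ g, w σ * w τ *
        chiRef (1 + V) (pair y (dev x s w σ)) (pair y (dev x s w τ)) ∂(stdLaw C B) ≤
        wg + 4 * (δ + S) := by
      rw [integral_const_mul, integral_finsetSum _ fun σ hσ => integrable_finsetSum _ fun τ hτ =>
        (hchi σ hσ τ hτ).1.const_mul _]
      have : ∑ σ ∈ g, ∫ y, ∑ τ ∈ g, w σ * w τ *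
          chiRef (1 + V) (pair y (dev x s w σ)) (pair y (dev x s w τ)) ∂(stdLaw C B) ≤
          ∑ σ ∈ g, ∑ τ ∈ g, w σ * w τ * (1 + 2 * (δ + |a σ τ|)) := by
        refine Finset.sum_le_sum fun σ hσ => ?_
        rw [integral_finsetSum _ fun τ hτ => (hchi σ hσ τ hτ).1.const_mul _]
        refine Finset.sum_le_sum fun τ hτ => ?_
        rw [integral_const_mul]
        exact mul_le_mul_of_nonneg_left (hchi σ hσ τ hτ).2 (mul_nonneg (hw σ) (hw τ))
      have h5 : ∑ σ ∈ g, ∑ τ ∈ g, w σ * w τ * (1 + 2 * (δ + |a σ τ|)) ≤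
          wg ^ 2 + 2 * (δ + S) := by
        have e6 : ∑ σ ∈ g, ∑ τ ∈ g, w σ * w τ * (1 + 2 * (δ + |a σ τ|)) = (1 + 2 * δ) * wg ^ 2 +
            2 * ∑ σ ∈ g, ∑ τ ∈ g, w σ * w τ * |a σ τ| := by
          rw [sq, hwg, Finset.sum_mul_sum, Finset.mul_sum, Finset.mul_sum,
            ← Finset.sum_add_distrib]
          refine Finset.sum_congr rfl fun σ _ => ?_
          rw [Finset.mul_sum, Finset.mul_sum, ← Finset.sum_add_distrib]
          exact Finset.sum_congr rfl fun τ _ => by ring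
        have h7 : ∑ σ ∈ g, ∑ τ ∈ g, w σ * w τ * |a σ τ| ≤ S := by
          refine (Finset.sum_le_sum fun σ _ => Finset.sum_le_sum_of_subset_of_nonneg
            (Finset.subset_univ g) fun τ _ _ => mul_nonneg (mul_nonneg (hw σ) (hw τ))
            (abs_nonneg _)).trans (Finset.sum_le_sum_of_subset_of_nonneg
            (Finset.subset_univ g) fun σ _ _ => Finset.sum_nonneg fun τ _ =>
              mul_nonneg (mul_nonneg (hw σ) (hw τ)) (abs_nonneg _))
        have h8 : wg ^ 2 ≤ 1 := pow_le_one₀ hwg0.le (by linarith)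
        rw [e6]
        have := mul_le_mul_of_nonneg_left h8 (show 0 ≤ 2 * δ by linarith)
        linarith
      have hinv : wg⁻¹ ≤ 2 := by
        rw [inv_le_comm₀ hwg0 (by norm_num)]; linarith
      calc _ ≤ wg⁻¹ * (wg ^ 2 + 2 * (δ + S)) :=
            mul_le_mul_of_nonneg_left (this.trans h5) (by positivity)
        _ = wg + wg⁻¹ * (2 * (δ + S)) := by field_simp
        _ ≤ wg + 2 * (2 * (δ + S)) := by gcongr
        _ = _ := by ring
    have hall : ∑ σ, w σ * (1 / 2 * Real.log (1 + V) + (1 + a σ σ) / (2 * (1 + V)) - 1 / 2) =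
        1 / 2 * Real.log (1 + V) := by
      have : ∀ σ, w σ * (1 / 2 * Real.log (1 + V) + (1 + a σ σ) / (2 * (1 + V)) - 1 / 2)
        = w σ * (1 / 2 * Real.log (1 + V) + 1 / (2 * (1 + V)) - 1 / 2) +
          w σ * a σ σ * (2 * (1 + V))⁻¹ := by intro σ; ring
      simp only [this]
      have hVs : ∑ σ, w σ * a σ σ = V := rfl
      rw [Finset.sum_add_distrib, ← Finset.sum_mul, ← Finset.sum_mul, h1, hVs]
      field_simp; ring
    have hbad : ∑ σ ∈ gᶜ, w σ * (1 / 2 * Real.log (1 + V) + (1 + a σ σ) / (2 * (1 + V)) - 1 / 2) ≤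
        D * wb := by
      rw [hwb, mul_comm D, Finset.sum_mul]
      refine Finset.sum_le_sum fun σ _ => mul_le_mul_of_nonneg_left ?_ (hw σ)
      have h3 : (1 + a σ σ) / (2 * (1 + V)) ≤ (1 + a σ σ) / 2 :=
        div_le_div_of_nonneg_left (by linarith [show 0 ≤ a σ σ from pair_self_nonneg _])
          (by norm_num) (by linarith)
      have h4 : a σ σ ≤ D := hD σ
      linarith
    rw [hsplit] at hall
    rw [v1, integral_const]
    simp only [probReal_univ, smul_eq_mul, one_mul]
    linarith

end OneRow

section Quantitative

variable {A C : Type} [Fintype A] [DecidableEq A] [Fintype C] [DecidableEq C] {B : ℕ}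
  {w : (C → A) → ℝ} {x : A → Fin B → ℝ} {s : C → ℝ} {X κ : ℝ}

lemma abs_sub_meanComp_le (hw : 0 ≤ w) (h1 : ∑ σ, w σ = 1) (hX : ∀ a j, |x a j| ≤ X) (a : A)
    (c : C) (j : Fin B) : |x a j - meanComp x w c j| ≤ 2 * X := by
  have h : |meanComp x w c j| ≤ X := by
    calc |meanComp x w c j| ≤ ∑ σ, |w σ * x (σ c) j| := Finset.abs_sum_le_sum_abs _ _
      _ ≤ ∑ σ, w σ * X := Finset.sum_le_sum fun σ _ => by
          rw [abs_mul, abs_of_nonneg (hw σ)]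
          exact mul_le_mul_of_nonneg_left (hX _ _) (hw σ)
      _ = X := by rw [← Finset.sum_mul, h1, one_mul]
  have := abs_sub (x a j) (meanComp x w c j)
  linarith [hX a j]

lemma expect_centered (h1 : ∑ σ, w σ = 1) (c : C) (j : Fin B) :
    ∑ σ, w σ * (x (σ c) j - meanComp x w c j) = 0 := by
  simp only [mul_sub, Finset.sum_sub_distrib]
  rw [← Finset.sum_mul, h1, one_mul, meanComp, sub_self]

lemma sq_sum_mul_margCov_le (c c' : C) {f : A → A → ℝ} {K : ℝ} (hf : ∀ k k', f k k' ^ 2 ≤ K) :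
    (∑ k, ∑ k', f k k' * margCov w c k c' k') ^ 2 ≤
      (Fintype.card A : ℝ) ^ 2 * K * ∑ k, ∑ k', margCov w c k c' k' ^ 2 := by
  have h := Finset.sum_mul_sq_le_sq_mul_sq (Finset.univ : Finset (A × A))
    (fun p => f p.1 p.2) (fun p => margCov w c p.1 c' p.2)
  simp only [Fintype.sum_prod_type] at h
  refine h.trans (mul_le_mul_of_nonneg_right ?_ (Finset.sum_nonneg fun k _ =>
    Finset.sum_nonneg fun k' _ => sq_nonneg _))
  refine (Finset.sum_le_sum fun k _ => Finset.sum_le_sum fun k' _ => hf k k').trans_eq ?_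
  simp; ring

lemma sum_comm_cycle {α β γ : Type*} [Fintype α] [Fintype β] [Fintype γ] (f : α → β → γ → ℝ) :
    ∑ a, ∑ b, ∑ c, f a b c = ∑ b, ∑ c, ∑ a, f a b c := by
  rw [Finset.sum_comm]
  exact Finset.sum_congr rfl fun b _ => Finset.sum_comm

lemma sum_sum_sq_expand {ι Ω : Type*} [Fintype ι] [Fintype Ω] (w : Ω → ℝ) (F : ι → Ω → ℝ) :
    ∑ σ, ∑ τ, w σ * w τ * (∑ i, F i σ * F i τ) ^ 2 =
      ∑ i, ∑ i', (∑ σ, w σ * (F i σ * F i' σ)) ^ 2 := by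
  have e : ∀ i i', (∑ σ, w σ * (F i σ * F i' σ)) ^ 2 =
      ∑ σ, ∑ τ, w σ * w τ * ((F i σ * F i τ) * (F i' σ * F i' τ)) := by
    intro i i'
    rw [sq, Finset.sum_mul_sum]
    exact Finset.sum_congr rfl fun σ _ => Finset.sum_congr rfl fun τ _ => by ring
  have e' : ∀ σ τ, w σ * w τ * (∑ i, F i σ * F i τ) ^ 2 =
      ∑ i, ∑ i', w σ * w τ * ((F i σ * F i τ) * (F i' σ * F i' τ)) := by
    intro σ τ
    rw [sq, Finset.sum_mul_sum]
    simp only [Finset.mul_sum]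
  simp only [e, e']
  rw [Finset.sum_congr rfl fun σ _ => sum_comm_cycle fun τ i i' =>
    w σ * w τ * ((F i σ * F i τ) * (F i' σ * F i' τ))]
  exact sum_comm_cycle _

/-- The overlap of the deviations of two replicas is controlled by the pairwise dependence. -/
lemma overlap_sq_le (hw : 0 ≤ w) (h1 : ∑ σ, w σ = 1) (hX : ∀ a j, |x a j| ≤ X) (hκ : 0 ≤ κ)
    (hs : ∀ c, s c ^ 2 ≤ κ / Fintype.card C) :
    ∑ σ, ∑ τ, w σ * w τ * pair (dev x s w σ) (dev x s w τ) ^ 2 ≤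
      16 * κ ^ 2 * B ^ 2 * X ^ 4 * (Fintype.card A : ℝ) ^ 2 * pairDep w := by
  have e : ∀ σ τ, pair (dev x s w σ) (dev x s w τ) =
      ∑ i : C × Fin B, dev x s w σ i.1 i.2 * dev x s w τ i.1 i.2 := by
    intro σ τ; rw [Fintype.sum_prod_type]; rfl
  simp only [e]
  rw [sum_sum_sq_expand w fun i : C × Fin B => fun σ => dev x s w σ i.1 i.2]
  set n := (Fintype.card C : ℝ) with hn
  have hterm : ∀ i i' : C × Fin B, (∑ σ, w σ * (dev x s w σ i.1 i.2 * dev x s w σ i'.1 i'.2)) ^ 2 ≤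
      (κ / n) ^ 2 * ((Fintype.card A : ℝ) ^ 2 * (16 * X ^ 4) *
        ∑ k, ∑ k', margCov w i.1 k i'.1 k' ^ 2) := by
    rintro ⟨c, j⟩ ⟨c', j'⟩
    -- since the deviations are centered, this is a covariance of functions of the types
    have h2 := cov_eq w c c' (fun k => x k j - meanComp x w c j)
      (fun k => x k j' - meanComp x w c' j')
    rw [expect_centered h1, zero_mul, sub_zero] at h2
    have h3 : ∑ σ, w σ * (dev x s w σ c j * dev x s w σ c' j') = s c * s c' *
        ∑ σ, w σ * ((x (σ c) j - meanComp x w c j) * (x (σ c') j' - meanComp x w c' j')) := by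
      rw [Finset.mul_sum]
      exact Finset.sum_congr rfl fun σ _ => by simp only [dev]; ring
    simp only []
    rw [h3, h2, mul_pow]
    refine mul_le_mul ?_ ?_ (sq_nonneg _) (sq_nonneg _)
    · rw [mul_pow, sq (κ / n)]
      exact mul_le_mul (hs c) (hs c') (sq_nonneg _) (by positivity)
    · refine sq_sum_mul_margCov_le c c' fun k k' => ?_
      rw [mul_pow]
      have b1 := abs_sub_meanComp_le hw h1 hX k c j
      have b2 := abs_sub_meanComp_le hw h1 hX k' c' j'
      have b1' : (x k j - meanComp x w c j) ^ 2 ≤ (2 * X) ^ 2 := by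
        rw [← sq_abs]; exact pow_le_pow_left₀ (abs_nonneg _) b1 2
      have b2' : (x k' j' - meanComp x w c' j') ^ 2 ≤ (2 * X) ^ 2 := by
        rw [← sq_abs]; exact pow_le_pow_left₀ (abs_nonneg _) b2 2
      calc _ ≤ (2 * X) ^ 2 * (2 * X) ^ 2 := mul_le_mul b1' b2' (sq_nonneg _) (sq_nonneg _)
        _ = 16 * X ^ 4 := by ring
  refine (Finset.sum_le_sum fun i _ => Finset.sum_le_sum fun i' _ => hterm i i').trans_eq ?_
  simp only [← Finset.mul_sum, Fintype.sum_prod_type, Finset.sum_const, Finset.card_univ,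
    nsmul_eq_mul, Fintype.card_fin]
  rw [pairDep, ← hn]
  ring

lemma pair_dev_self (w : (C → A) → ℝ) (σ : C → A) : pair (dev x s w σ) (dev x s w σ) =
    ∑ c, s c ^ 2 * ∑ j, (x (σ c) j - meanComp x w c j) ^ 2 := by
  simp only [pair, dev, Finset.mul_sum]
  exact Finset.sum_congr rfl fun c _ => Finset.sum_congr rfl fun j _ => by ring

lemma sum_sq_sub_meanComp_le (hw : 0 ≤ w) (h1 : ∑ σ, w σ = 1) (hX : ∀ a j, |x a j| ≤ X) (a : A)
    (c : C) : ∑ j, (x a j - meanComp x w c j) ^ 2 ≤ 4 * B * X ^ 2 := by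
  calc _ ≤ ∑ _j : Fin B, (2 * X) ^ 2 := Finset.sum_le_sum fun j _ => by
        rw [← sq_abs]; exact pow_le_pow_left₀ (abs_nonneg _) (abs_sub_meanComp_le hw h1 hX a c j) 2
    _ = 4 * B * X ^ 2 := by simp; ring

lemma pair_dev_self_le (hw : 0 ≤ w) (h1 : ∑ σ, w σ = 1) (hX : ∀ a j, |x a j| ≤ X) (σ : C → A) :
    pair (dev x s w σ) (dev x s w σ) ≤ (∑ c, s c ^ 2) * (4 * B * X ^ 2) := by
  rw [pair_dev_self, Finset.sum_mul]
  exact Finset.sum_le_sum fun c _ =>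
    mul_le_mul_of_nonneg_left (sum_sq_sub_meanComp_le hw h1 hX _ c) (sq_nonneg _)

/-- The squared norm of the deviation concentrates when the pairwise dependence is small. -/
lemma variance_norm_dev_le (hw : 0 ≤ w) (h1 : ∑ σ, w σ = 1) (hX : ∀ a j, |x a j| ≤ X)
    (hκ : 0 ≤ κ) (hs : ∀ c, s c ^ 2 ≤ κ / Fintype.card C) {l : ℝ} (hl : 0 < l) :
    ∑ σ, w σ * (pair (dev x s w σ) (dev x s w σ) - rowVar x s w) ^ 2 ≤
      16 * κ ^ 2 * B ^ 2 * X ^ 4 * ((Fintype.card A : ℝ) ^ 2 * l + l⁻¹ * pairDep w) := by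
  set n := (Fintype.card C : ℝ) with hn
  set f : C → A → ℝ := fun c k => ∑ j, (x k j - meanComp x w c j) ^ 2 with hf
  have hf0 : ∀ c k, 0 ≤ f c k := fun c k => Finset.sum_nonneg fun j _ => sq_nonneg _
  have hfb : ∀ c k, f c k ≤ 4 * B * X ^ 2 := fun c k => sum_sq_sub_meanComp_le hw h1 hX k c
  have e1 : ∀ σ, pair (dev x s w σ) (dev x s w σ) = ∑ c, s c ^ 2 * f c (σ c) := pair_dev_self w
  have e2 : ∑ σ, w σ * (pair (dev x s w σ) (dev x s w σ) - rowVar x s w) ^ 2 =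
      ∑ σ, w σ * (∑ c, s c ^ 2 * f c (σ c)) ^ 2 - rowVar x s w ^ 2 := by
    have : ∀ σ, w σ * (pair (dev x s w σ) (dev x s w σ) - rowVar x s w) ^ 2 =
        w σ * (∑ c, s c ^ 2 * f c (σ c)) ^ 2 -
          2 * rowVar x s w * (w σ * pair (dev x s w σ) (dev x s w σ)) +
          w σ * rowVar x s w ^ 2 := by intro σ; rw [← e1]; ring
    simp only [this]
    rw [Finset.sum_add_distrib, Finset.sum_sub_distrib, ← Finset.mul_sum, ← Finset.sum_mul, h1]
    have : ∑ σ, w σ * pair (dev x s w σ) (dev x s w σ) = rowVar x s w := rfl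
    rw [this]; ring
  -- the variance of a sum of functions of single sections is a sum of pairwise covariances
  have e3 : ∑ σ, w σ * (∑ c, s c ^ 2 * f c (σ c)) ^ 2 - rowVar x s w ^ 2 =
      ∑ c, ∑ c', s c ^ 2 * s c' ^ 2 * ∑ k, ∑ k', f c k * f c' k' * margCov w c k c' k' := by
    have r1 : rowVar x s w = ∑ c, s c ^ 2 * ∑ σ, w σ * f c (σ c) := rowVar_eq x s w
    have r2 : ∑ σ, w σ * (∑ c, s c ^ 2 * f c (σ c)) ^ 2 =
        ∑ c, ∑ c', s c ^ 2 * s c' ^ 2 * ∑ σ, w σ * (f c (σ c) * f c' (σ c')) := by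
      have e' : ∀ σ, w σ * (∑ c, s c ^ 2 * f c (σ c)) ^ 2 =
          ∑ c, ∑ c', s c ^ 2 * s c' ^ 2 * (w σ * (f c (σ c) * f c' (σ c'))) := by
        intro σ
        rw [sq, Finset.sum_mul_sum]
        simp only [Finset.mul_sum]
        exact Finset.sum_congr rfl fun c _ => Finset.sum_congr rfl fun c' _ => by ring
      simp only [e', Finset.mul_sum]
      exact sum_comm_cycle _
    rw [r1, r2, sq, Finset.sum_mul_sum, ← Finset.sum_sub_distrib]
    refine Finset.sum_congr rfl fun c _ => ?_
    rw [← Finset.sum_sub_distrib]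
    refine Finset.sum_congr rfl fun c' _ => ?_
    rw [← cov_eq]; ring
  rw [e2, e3]
  have hterm : ∀ c c' k k', s c ^ 2 * s c' ^ 2 * (f c k * f c' k' * margCov w c k c' k') ≤
      (κ / n) ^ 2 * (4 * B * X ^ 2) ^ 2 * (l + l⁻¹ * margCov w c k c' k' ^ 2) := by
    intro c c' k k'
    have hcov : |margCov w c k c' k'| ≤ l + l⁻¹ * margCov w c k c' k' ^ 2 := by
      have h := two_mul_le_add_sq l |margCov w c k c' k'|
      rw [sq_abs] at h
      have h' : |margCov w c k c' k'| * l ≤ l * l + margCov w c k c' k' ^ 2 := by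
        have := mul_nonneg (abs_nonneg (margCov w c k c' k')) hl.le
        nlinarith
      have := mul_le_mul_of_nonneg_left h' (inv_pos.2 hl).le
      have e : l⁻¹ * (|margCov w c k c' k'| * l) = |margCov w c k c' k'| := by field_simp
      rw [e] at this
      refine this.trans_eq ?_
      field_simp
    have hss : s c ^ 2 * s c' ^ 2 ≤ (κ / n) ^ 2 := by
      rw [sq (κ / n)]
      exact mul_le_mul (hs c) (hs c') (sq_nonneg _) (by positivity)
    have hff : f c k * f c' k' ≤ (4 * B * X ^ 2) ^ 2 := by
      rw [sq]
      exact mul_le_mul (hfb c k) (hfb c' k') (hf0 _ _) (by positivity)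
    have hf2 := mul_nonneg (hf0 c k) (hf0 c' k')
    calc _ ≤ s c ^ 2 * s c' ^ 2 * (f c k * f c' k' * |margCov w c k c' k'|) := by
          gcongr; exact le_abs_self _
      _ = s c ^ 2 * s c' ^ 2 * (f c k * f c' k') * |margCov w c k c' k'| := by ring
      _ ≤ _ := by
          have hp := mul_le_mul hss hff hf2 (by positivity)
          exact mul_le_mul hp hcov (abs_nonneg _) (by positivity)
  have hsum : ∑ c, ∑ c', s c ^ 2 * s c' ^ 2 * ∑ k, ∑ k', f c k * f c' k' * margCov w c k c' k' ≤
      ∑ c : C, ∑ c' : C, ∑ k, ∑ k',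
        (κ / n) ^ 2 * (4 * B * X ^ 2) ^ 2 * (l + l⁻¹ * margCov w c k c' k' ^ 2) := by
    refine Finset.sum_le_sum fun c _ => Finset.sum_le_sum fun c' _ => ?_
    simp only [Finset.mul_sum]
    exact Finset.sum_le_sum fun k _ => Finset.sum_le_sum fun k' _ => hterm c c' k k'
  refine hsum.trans ?_
  simp only [← Finset.mul_sum, Finset.sum_add_distrib, Finset.sum_const, Finset.card_univ,
    nsmul_eq_mul, ← hn]
  rw [pairDep, ← hn]
  have hnn : (κ / n) ^ 2 * (n * n) ≤ κ ^ 2 := by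
    rcases eq_or_ne n 0 with h0 | h0
    · rw [h0]; simp; positivity
    · apply le_of_eq; field_simp
  set R := ∑ c, ∑ c', ∑ k, ∑ k', margCov w c k c' k' ^ 2
  have : 0 ≤ 16 * (B : ℝ) ^ 2 * X ^ 4 * ((Fintype.card A : ℝ) ^ 2 * l) := by positivity
  have h3 := mul_le_mul_of_nonneg_right hnn this
  have e4 : (κ / n) ^ 2 * (4 * B * X ^ 2) ^ 2 * (Fintype.card A * (Fintype.card A * (n * (n * l)))
      + l⁻¹ * R) = (κ / n) ^ 2 * (n * n) * (16 * (B : ℝ) ^ 2 * X ^ 4 * ((Fintype.card A : ℝ) ^ 2 * l))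
      + 16 * κ ^ 2 * B ^ 2 * X ^ 4 * (l⁻¹ * (n⁻¹ ^ 2 * R)) := by
    ring
  rw [e4]
  linarith

/-- Constant in the error terms of the comparison of rows; it does not depend on the number of
sections. -/
def errConst (a B : ℕ) (X κ : ℝ) : ℝ :=
  κ * (4 * B * X ^ 2) * (16 * κ ^ 2 * B ^ 2 * X ^ 4 * (a : ℝ) ^ 2) + 8 +
    4 * (16 * κ ^ 2 * B ^ 2 * X ^ 4 * (a : ℝ) ^ 2)

lemma errConst_nonneg (a B : ℕ) (X : ℝ) (hκ : 0 ≤ κ) : 0 ≤ errConst a B X κ := by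
  unfold errConst; positivity

lemma pairDep_nonneg (w : (C → A) → ℝ) : 0 ≤ pairDep w :=
  mul_nonneg (by positivity) (Finset.sum_nonneg fun _ _ => Finset.sum_nonneg fun _ _ =>
    Finset.sum_nonneg fun _ _ => Finset.sum_nonneg fun _ _ => sq_nonneg _)

/-- A row with entries of variance of order `1 / n` attains the Gaussian bound up to the pairwise
dependence of the sections. -/
lemma log_le_eta_sub_obs [Nonempty C] (hw : 0 ≤ w) (h1 : ∑ σ, w σ = 1) (hX : ∀ a j, |x a j| ≤ X)
    (hκ : 0 ≤ κ) (hs : ∀ c, s c ^ 2 ≤ κ / Fintype.card C) {δ : ℝ} (hδ0 : 0 < δ)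
    (hδ : δ ≤ 1 / 4) :
    1 / 2 * Real.log (1 + rowVar x s w) - errConst (Fintype.card A) B X κ *
      (δ + δ⁻¹ ^ 5 * pairDep w) ≤ eta w - obs x s eta w := by
  have hA : (1 : ℝ) ≤ (Fintype.card A : ℝ) ^ 2 := by
    have : Nonempty A := by
      by_contra hc
      rw [not_nonempty_iff] at hc
      have : IsEmpty (C → A) := inferInstance
      simp at h1
    have h : (1 : ℝ) ≤ Fintype.card A := by exact_mod_cast Fintype.card_pos
    exact one_le_pow₀ h
  have hn : (0 : ℝ) < Fintype.card C := by exact_mod_cast Fintype.card_pos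
  set D := κ * (4 * B * X ^ 2) with hD
  have hD0 : 0 ≤ D := by positivity
  have hDb : ∀ σ, pair (dev x s w σ) (dev x s w σ) ≤ D := fun σ => by
    refine (pair_dev_self_le hw h1 hX σ).trans (mul_le_mul_of_nonneg_right ?_ (by positivity))
    refine (Finset.sum_le_sum fun c _ => hs c).trans_eq ?_
    simp; field_simp
  set ρ := pairDep w with hρ
  have hρ0 : 0 ≤ ρ := pairDep_nonneg w
  set E := 16 * κ ^ 2 * B ^ 2 * X ^ 4 * (Fintype.card A : ℝ) ^ 2 with hE
  have hE0 : 0 ≤ E := by positivity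
  have hmain := le_eta_sub_obs x s hw h1 hδ0 hδ hDb
  -- the scale `δ ^ 3` leaves a factor `δ` after division by `δ ^ 2` in `le_eta_sub_obs`
  have hS1 := variance_norm_dev_le hw h1 hX hκ hs (pow_pos hδ0 3)
  have hS2 := overlap_sq_le hw h1 hX hκ hs
  rw [← hρ, ← hE] at hS2
  set S1 := ∑ σ, w σ * (pair (dev x s w σ) (dev x s w σ) - rowVar x s w) ^ 2
  have hS1' : S1 ≤ E * (δ ^ 3 + (δ ^ 3)⁻¹ * ρ) := by
    refine hS1.trans ?_
    have h0 : 0 ≤ 16 * κ ^ 2 * B ^ 2 * X ^ 4 := by positivity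
    have h2 : (Fintype.card A : ℝ) ^ 2 * δ ^ 3 + (δ ^ 3)⁻¹ * ρ ≤
        (Fintype.card A : ℝ) ^ 2 * (δ ^ 3 + (δ ^ 3)⁻¹ * ρ) := by
      have h3 : 0 ≤ (δ ^ 3)⁻¹ * ρ := by positivity
      have := mul_le_mul_of_nonneg_right hA h3
      rw [mul_add]; linarith
    calc _ ≤ _ := mul_le_mul_of_nonneg_left h2 h0
      _ = _ := by rw [hE]; ring
  -- `|a| ≤ δ + a ^ 2 / δ` bounds the mean overlap by its second moment
  have habs : ∑ σ, ∑ τ, w σ * w τ * |pair (dev x s w σ) (dev x s w τ)| ≤ δ + δ⁻¹ * (E * ρ) := by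
    have hterm : ∀ σ τ, w σ * w τ * |pair (dev x s w σ) (dev x s w τ)| ≤
        w σ * w τ * δ + δ⁻¹ * (w σ * w τ * pair (dev x s w σ) (dev x s w τ) ^ 2) := by
      intro σ τ
      set a := pair (dev x s w σ) (dev x s w τ)
      have h2 : |a| ≤ δ + δ⁻¹ * a ^ 2 := by
        have e : δ + δ⁻¹ * a ^ 2 = δ⁻¹ * (δ ^ 2 + |a| ^ 2) := by rw [sq_abs]; field_simp
        have e' : |a| = δ⁻¹ * (δ * |a|) := by field_simp
        rw [e]
        conv_lhs => rw [e']
        refine mul_le_mul_of_nonneg_left ?_ (inv_pos.2 hδ0).le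
        nlinarith [two_mul_le_add_sq δ |a|, mul_nonneg hδ0.le (abs_nonneg a)]
      calc _ ≤ w σ * w τ * (δ + δ⁻¹ * a ^ 2) :=
            mul_le_mul_of_nonneg_left h2 (mul_nonneg (hw σ) (hw τ))
        _ = _ := by ring
    refine (Finset.sum_le_sum fun σ _ => Finset.sum_le_sum fun τ _ => hterm σ τ).trans ?_
    simp only [Finset.sum_add_distrib, ← Finset.mul_sum, ← Finset.sum_mul, h1, one_mul, mul_one]
    have := mul_le_mul_of_nonneg_left hS2 (inv_pos.2 hδ0).le
    linarith
  have hb1 : D * (δ⁻¹ ^ 2 * S1) ≤ D * E * (δ + δ⁻¹ ^ 5 * ρ) := by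
    calc D * (δ⁻¹ ^ 2 * S1) ≤ D * (δ⁻¹ ^ 2 * (E * (δ ^ 3 + (δ ^ 3)⁻¹ * ρ))) := by gcongr
      _ = _ := by field_simp
  have hb2 : δ⁻¹ * (E * ρ) ≤ E * (δ⁻¹ ^ 5 * ρ) := by
    have h1δ : 1 ≤ δ⁻¹ := by rw [one_le_inv₀ hδ0]; linarith
    have : δ⁻¹ ≤ δ⁻¹ ^ 5 := le_self_pow₀ h1δ (by norm_num)
    calc δ⁻¹ * (E * ρ) ≤ δ⁻¹ ^ 5 * (E * ρ) := by gcongr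
      _ = _ := by ring
  have hfin : errConst (Fintype.card A) B X κ * (δ + δ⁻¹ ^ 5 * ρ) =
      D * E * (δ + δ⁻¹ ^ 5 * ρ) + 8 * (δ + δ⁻¹ ^ 5 * ρ) + 4 * (E * δ + E * (δ⁻¹ ^ 5 * ρ)) := by
    rw [errConst, ← hD, ← hE]; ring
  have hp1 : 0 ≤ δ⁻¹ ^ 5 * ρ := by positivity
  have hp2 : 0 ≤ E * δ := by positivity
  rw [hfin]
  linarith

/-- Replacing a row by a random one with the same average variances loses information, up to the
pairwise dependence of the sections. -/
lemma obs_le_mix_of_mass_one [Nonempty C] (hw : 0 ≤ w) (h1 : ∑ σ, w σ = 1)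
    (hX : ∀ a j, |x a j| ≤ X) (hκ : 0 ≤ κ) (hs : ∀ c, s c ^ 2 ≤ κ / Fintype.card C) {δ : ℝ}
    (hδ0 : 0 < δ) (hδ : δ ≤ 1 / 4) {ι : Type} [Fintype ι] {q : ι → ℝ} (hq : ∀ i, 0 ≤ q i)
    (hq1 : ∑ i, q i = 1) (amp : ι → C → ℝ) (hamp : ∀ c, ∑ i, q i * amp i c ^ 2 ≤ s c ^ 2) :
    obs x s eta w ≤ ∑ i, q i * obs x (amp i) eta w + errConst (Fintype.card A) B X κ *
      (δ * ∑ σ, w σ + δ⁻¹ ^ 5 * (reveal collision w + (-1) * collision w)) := by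
  have hV0 := rowVar_nonneg x s hw
  set V := rowVar x s w with hV
  have hlow := log_le_eta_sub_obs hw h1 hX hκ hs hδ0 hδ
  have hpin := pairDep_le_reveal_collision hw h1
  -- the same Gaussian reference, of variance `1 + V`, is used for all the rows: its bound is affine
  -- in the variance, and is tangent at `V` to `log (1 + ·) / 2`
  have hup : ∀ i, q i * (eta w - obs x (amp i) eta w) ≤
      q i * (1 / 2 * Real.log (1 + V) + (1 + rowVar x (amp i) w) / (2 * (1 + V)) - 1 / 2) :=
    fun i => mul_le_mul_of_nonneg_left (eta_sub_obs_le x (amp i) hw h1 (by linarith)) (hq i)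
  have hsum := Finset.sum_le_sum fun i (_ : i ∈ Finset.univ) => hup i
  have e1 : ∑ i, q i * (eta w - obs x (amp i) eta w) = eta w - ∑ i, q i * obs x (amp i) eta w := by
    simp only [mul_sub, Finset.sum_sub_distrib]
    rw [← Finset.sum_mul, hq1, one_mul]
  have e2 : ∑ i, q i * (1 / 2 * Real.log (1 + V) + (1 + rowVar x (amp i) w) / (2 * (1 + V)) - 1 / 2)
      = 1 / 2 * Real.log (1 + V) + (1 + ∑ i, q i * rowVar x (amp i) w) / (2 * (1 + V)) - 1 / 2 := by
    have : ∀ i, q i * (1 / 2 * Real.log (1 + V) + (1 + rowVar x (amp i) w) / (2 * (1 + V)) - 1 / 2)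
      = q i * (1 / 2 * Real.log (1 + V) + 1 / (2 * (1 + V)) - 1 / 2) +
        q i * rowVar x (amp i) w * (2 * (1 + V))⁻¹ := by intro i; ring
    simp only [this]
    rw [Finset.sum_add_distrib, ← Finset.sum_mul, ← Finset.sum_mul, hq1]
    ring
  have hVle : ∑ i, q i * rowVar x (amp i) w ≤ V := by
    set v : C → ℝ := fun c => ∑ σ, w σ * ∑ j, (x (σ c) j - meanComp x w c j) ^ 2 with hv
    have hv0 : ∀ c, 0 ≤ v c := fun c => Finset.sum_nonneg fun σ _ =>
      mul_nonneg (hw σ) (Finset.sum_nonneg fun j _ => sq_nonneg _)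
    have ev : ∀ t : C → ℝ, rowVar x t w = ∑ c, t c ^ 2 * v c := fun t => rowVar_eq x t w
    simp only [hV, ev, Finset.mul_sum]
    rw [Finset.sum_comm]
    refine Finset.sum_le_sum fun c _ => ?_
    simp only [← mul_assoc]
    rw [← Finset.sum_mul]
    exact mul_le_mul_of_nonneg_right (hamp c) (hv0 c)
  have h3 : (1 + ∑ i, q i * rowVar x (amp i) w) / (2 * (1 + V)) ≤ 1 / 2 := by
    rw [div_le_iff₀ (by linarith)]; linarith
  rw [e1, e2] at hsum
  have hC := errConst_nonneg (Fintype.card A) B X hκ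
  have h4 : errConst (Fintype.card A) B X κ * (δ + δ⁻¹ ^ 5 * pairDep w) ≤
      errConst (Fintype.card A) B X κ *
        (δ * ∑ σ, w σ + δ⁻¹ ^ 5 * (reveal collision w + (-1) * collision w)) := by
    rw [h1, mul_one]
    gcongr
  linarith

lemma marg_smul (r : ℝ) (w : (C → A) → ℝ) (c : C) (k : A) :
    marg (fun σ => r * w σ) c k = r * marg w c k := by
  simp only [marg, restr, Finset.mul_sum, mul_ite, mul_zero]

lemma collision_smul (r : ℝ) (w : (C → A) → ℝ) :
    collision (fun σ => r * w σ) = r * collision w := by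
  have h : ∀ a b : ℝ, (r * a) ^ 2 / (r * b) = r * (a ^ 2 / b) := by
    intro a b
    rcases eq_or_ne r 0 with rfl | hr
    · simp
    · rcases eq_or_ne b 0 with rfl | hb
      · simp
      · field_simp
  simp only [collision, marg_smul, ← Finset.mul_sum, h]
  ring

lemma reveal_collision_smul (r : ℝ) (w : (C → A) → ℝ) :
    reveal collision (fun σ => r * w σ) = r * reveal collision w := by
  have e : ∀ c k, restr c k (fun σ => r * w σ) = fun σ => r * restr c k w σ := by
    intro c k; funext σ; simp only [restr]; split_ifs <;> simp
  simp only [reveal, e, collision_smul, ← Finset.mul_sum]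
  ring

lemma obs_eta_smul (s : C → ℝ) (r : ℝ) (w : (C → A) → ℝ) :
    obs x s eta (fun σ => r * w σ) = r * obs x s eta w := by
  have e : ∀ θ, upd x s (fun σ => r * w σ) θ = fun σ => r * upd x s w θ σ := by
    intro θ; funext σ; simp only [upd]; ring
  simp only [obs, e, eta_smul, integral_const_mul]

/-- Nonnegative weights are a multiple of weights of total mass one; the zero weights are kept as
a multiple by `0`, so that no nonemptiness is needed. -/
lemma exists_eq_smul (hw : 0 ≤ w) : ∃ (r : ℝ) (w' : (C → A) → ℝ), 0 ≤ r ∧ 0 ≤ w' ∧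
    (r = 0 ∨ ∑ σ, w' σ = 1) ∧ w = fun σ => r * w' σ := by
  rcases (Finset.sum_nonneg fun σ (_ : σ ∈ Finset.univ) => hw σ).eq_or_lt with h | h
  · have h0 : ∀ σ, w σ = 0 := fun σ =>
      (Finset.sum_eq_zero_iff_of_nonneg fun σ _ => hw σ).1 h.symm σ (Finset.mem_univ _)
    exact ⟨0, w, le_rfl, hw, Or.inl rfl, funext fun σ => by simp [h0]⟩
  · refine ⟨∑ σ, w σ, fun σ => (∑ σ, w σ)⁻¹ * w σ, h.le,
      fun σ => mul_nonneg (inv_pos.2 h).le (hw σ), Or.inr ?_, funext fun σ => ?_⟩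
    · rw [← Finset.mul_sum, inv_mul_cancel₀ h.ne']
    · rw [mul_inv_cancel_left₀ h.ne']

/-- The comparison of rows in `1`-homogeneous form. -/
lemma obs_le_mix [Nonempty C] (hX : ∀ a j, |x a j| ≤ X) (hκ : 0 ≤ κ)
    (hs : ∀ c, s c ^ 2 ≤ κ / Fintype.card C) {δ : ℝ}
    (hδ0 : 0 < δ) (hδ : δ ≤ 1 / 4) {ι : Type} [Fintype ι] {q : ι → ℝ} (hq : ∀ i, 0 ≤ q i)
    (hq1 : ∑ i, q i = 1) (amp : ι → C → ℝ) (hamp : ∀ c, ∑ i, q i * amp i c ^ 2 ≤ s c ^ 2)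
    (hw : 0 ≤ w) :
    obs x s eta w ≤ ∑ i, q i * obs x (amp i) eta w + errConst (Fintype.card A) B X κ *
      (δ * ∑ σ, w σ + δ⁻¹ ^ 5 * (reveal collision w + (-1) * collision w)) := by
  obtain ⟨r, w', hr, hw', h1, rfl⟩ := exists_eq_smul hw
  simp only [obs_eta_smul, collision_smul, reveal_collision_smul, ← Finset.mul_sum]
  have e1 : ∑ i, q i * (r * obs x (amp i) eta w') = r * ∑ i, q i * obs x (amp i) eta w' := by
    rw [Finset.mul_sum]; exact Finset.sum_congr rfl fun i _ => by ring
  rw [e1]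
  rcases h1 with rfl | h1
  · simp
  · have := mul_le_mul_of_nonneg_left
      (obs_le_mix_of_mass_one hw' h1 hX hκ hs hδ0 hδ hq hq1 amp hamp) hr
    refine this.trans_eq ?_
    ring

/-- The information gained from one row is at most proportional to the total variance of its
entries. -/
lemma eta_le_obs_add (hw : 0 ≤ w) (h1 : ∑ σ, w σ = 1) (hX : ∀ a j, |x a j| ≤ X) (s : C → ℝ) :
    eta w ≤ obs x s eta w + (∑ c, s c ^ 2) * (2 * B * X ^ 2) := by
  have h := eta_sub_obs_le x s hw h1 one_pos
  have hV : rowVar x s w ≤ (∑ c, s c ^ 2) * (4 * B * X ^ 2) := by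
    calc _ ≤ ∑ σ, w σ * ((∑ c, s c ^ 2) * (4 * B * X ^ 2)) := Finset.sum_le_sum fun σ _ =>
          mul_le_mul_of_nonneg_left (pair_dev_self_le hw h1 hX σ) (hw σ)
      _ = _ := by rw [← Finset.sum_mul, h1, one_mul]
  rw [Real.log_one] at h
  linarith

end Quantitative

/-! ### Random lists -/

section ExpList

variable {ρ ι : Type} [Fintype ι] [DecidableEq ι] {q : ρ → ι → ℝ}

/-- Expectation of `F` at the random list whose entries are independent, the entry replacing
`r : ρ` having law `q r`. -/
def expList (q : ρ → ι → ℝ) : List ρ → (List ι → ℝ) → ℝ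
  | [], F => F []
  | r :: l, F => ∑ i, q r i * expList q l fun l' => F (i :: l')

lemma expList_mono (hq : ∀ r i, 0 ≤ q r i) (l : List ρ) {F G : List ι → ℝ} (h : ∀ l, F l ≤ G l) :
    expList q l F ≤ expList q l G := by
  induction l generalizing F G with
  | nil => exact h _
  | cons r l ih =>
    exact Finset.sum_le_sum fun i _ => mul_le_mul_of_nonneg_left (ih fun l => h _) (hq r i)

lemma expList_add (l : List ρ) (F G : List ι → ℝ) :
    expList q l (fun l => F l + G l) = expList q l F + expList q l G := by
  induction l generalizing F G with
  | nil => rfl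
  | cons r l ih => simp only [expList, ih, mul_add, Finset.sum_add_distrib]

lemma expList_const_mul (l : List ρ) (c : ℝ) (F : List ι → ℝ) :
    expList q l (fun l => c * F l) = c * expList q l F := by
  induction l generalizing F with
  | nil => rfl
  | cons r l ih =>
    simp only [expList, ih, Finset.mul_sum]
    exact Finset.sum_congr rfl fun i _ => by ring

lemma expList_const (hq1 : ∀ r, ∑ i, q r i = 1) (l : List ρ) (c : ℝ) :
    expList q l (fun _ => c) = c := by
  induction l with
  | nil => rfl
  | cons r l ih => simp only [expList, ih]; rw [← Finset.sum_mul, hq1, one_mul]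

lemma expList_sum {κ : Type*} (l : List ρ) (I : Finset κ) (F : κ → List ι → ℝ) :
    expList q l (fun l => ∑ k ∈ I, F k l) = ∑ k ∈ I, expList q l (F k) := by
  induction l generalizing F with
  | nil => rfl
  | cons r l ih =>
    simp only [expList, ih, Finset.mul_sum]
    exact Finset.sum_comm

/-- Expected number of entries equal to `i` in the random list. -/
def meanCount (q : ρ → ι → ℝ) (l : List ρ) (i : ι) : ℝ := (l.map fun r => q r i).sum

@[simp] lemma meanCount_cons (r : ρ) (l : List ρ) (i : ι) :
    meanCount q (r :: l) i = q r i + meanCount q l i := by simp [meanCount]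

lemma sum_meanCount (hq1 : ∀ r, ∑ i, q r i = 1) (l : List ρ) :
    ∑ i, meanCount q l i = l.length := by
  induction l with
  | nil => simp [meanCount]
  | cons r l ih => simp [Finset.sum_add_distrib, hq1, ih, add_comm]

/-- The variance of a count is at most its mean. -/
lemma expList_count_sq_le (hq1 : ∀ r, ∑ i, q r i = 1) (hq : ∀ r i, 0 ≤ q r i) (l : List ρ) (i : ι)
    (y : ℝ) :
    expList q l (fun l => ((l.count i : ℝ) + y) ^ 2) ≤
      (meanCount q l i + y) ^ 2 + meanCount q l i := by
  induction l generalizing y with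
  | nil => simp [expList, meanCount]
  | cons r l ih =>
    have h : ∀ j, q r j * expList q l (fun l => (((j :: l).count i : ℝ) + y) ^ 2) ≤
        q r j * ((meanCount q l i + y) ^ 2 + meanCount q l i) +
        if j = i then q r j * (2 * (meanCount q l i + y) + 1) else 0 := by
      intro j
      split_ifs with hji
      · subst hji
        have := mul_le_mul_of_nonneg_left (ih (y + 1)) (hq r j)
        simp only [List.count_cons_self, Nat.cast_add, Nat.cast_one, add_assoc, add_comm (1 : ℝ) y]
        refine this.trans_eq ?_
        ring
      · have := mul_le_mul_of_nonneg_left (ih y) (hq r j)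
        simp only [List.count_cons_of_ne hji, add_zero]
        exact this
    refine (Finset.sum_le_sum fun j _ => h j).trans ?_
    rw [Finset.sum_add_distrib, ← Finset.sum_mul, hq1, Finset.sum_ite_eq' Finset.univ i,
      if_pos (Finset.mem_univ i), meanCount_cons]
    nlinarith [sq_nonneg (q r i)]

lemma expList_deficit_le (hq1 : ∀ r, ∑ i, q r i = 1) (hq : ∀ r i, 0 ≤ q r i) (l : List ρ) (i : ι)
    (N : ℕ) {δ : ℝ} (hδ : 0 < δ) :
    expList q l (fun l => ((N - l.count i : ℕ) : ℝ)) ≤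
      |N - meanCount q l i| + δ * meanCount q l i + δ⁻¹ := by
  set μ := meanCount q l i
  have h : ∀ l : List ι, ((N - l.count i : ℕ) : ℝ) ≤
      (|N - μ| + δ⁻¹) + δ * ((l.count i : ℝ) + -μ) ^ 2 := by
    intro l
    set k := l.count i
    have h1 : ((N - k : ℕ) : ℝ) ≤ |N - μ| + |(k : ℝ) + -μ| := by
      rcases le_total N k with hk | hk
      · rw [Nat.sub_eq_zero_of_le hk]; simp only [Nat.cast_zero]; positivity
      · rw [Nat.cast_sub hk]
        have := le_abs_self ((N : ℝ) - μ)
        have := neg_abs_le ((k : ℝ) + -μ)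
        linarith
    have h2 : |(k : ℝ) + -μ| ≤ δ⁻¹ + δ * ((k : ℝ) + -μ) ^ 2 := by
      rw [← sq_abs ((k : ℝ) + -μ)]
      set a := |(k : ℝ) + -μ|
      have ha : 0 ≤ a := abs_nonneg _
      have e : δ⁻¹ + δ * a ^ 2 = δ⁻¹ * (1 + (δ * a) ^ 2) := by field_simp
      have e' : a = δ⁻¹ * (δ * a) := by field_simp
      rw [e]
      conv_lhs => rw [e']
      refine mul_le_mul_of_nonneg_left ?_ (inv_pos.2 hδ).le
      nlinarith [sq_nonneg (δ * a - 1), mul_nonneg hδ.le ha]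
    linarith
  refine (expList_mono hq l h).trans ?_
  rw [expList_add, expList_const_mul, expList_const hq1]
  have := mul_le_mul_of_nonneg_left (expList_count_sq_le hq1 hq l i (-μ)) hδ.le
  have e : (meanCount q l i + -μ) ^ 2 + meanCount q l i = μ := by simp [μ]
  rw [e] at this
  linarith

end ExpList

/-! ### Comparison of measurement designs -/

section Gain

variable {A C : Type} [Fintype A] [DecidableEq A] [Fintype C] [DecidableEq C] {B : ℕ}
  {x : A → Fin B → ℝ} {w : (C → A) → ℝ} {h : ((C → A) → ℝ) → ℝ}

/-- The information gained from successive measurements. -/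
def gain (x : A → Fin B → ℝ) (l : List (C → ℝ)) (w : (C → A) → ℝ) : ℝ :=
  eta w - obsList x l eta w

lemma gain_perm {l l' : List (C → ℝ)} (hl : l.Perm l') (hw : 0 ≤ w) :
    gain x l w = gain x l' w := by rw [gain, gain, obsList_perm adm_eta hl hw]

lemma obs_eta_le_eta (s : C → ℝ) (hw : 0 ≤ w) : obs x s eta w ≤ eta w := by
  obtain ⟨r, w', hr, hw', h1, rfl⟩ := exists_eq_smul hw
  rw [obs_eta_smul, eta_smul]
  rcases h1 with rfl | h1
  · simp
  · exact mul_le_mul_of_nonneg_left (obs_eta_le x s hw' h1) hr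

lemma eta_le_obs_add_mass {X : ℝ} (hX : ∀ a j, |x a j| ≤ X) (s : C → ℝ) (hw : 0 ≤ w) :
    eta w ≤ obs x s eta w + (∑ c, s c ^ 2) * (2 * B * X ^ 2) * ∑ σ, w σ := by
  obtain ⟨r, w', hr, hw', h1, rfl⟩ := exists_eq_smul hw
  rw [obs_eta_smul, eta_smul, ← Finset.mul_sum]
  rcases h1 with rfl | h1
  · simp
  · have := mul_le_mul_of_nonneg_left (eta_le_obs_add hw' h1 hX s) hr
    rw [h1]; linarith

lemma obsList_eta_le (l : List (C → ℝ)) (hw : 0 ≤ w) : obsList x l eta w ≤ eta w := by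
  induction l generalizing w with
  | nil => exact le_rfl
  | cons s l ih =>
    exact (obs_mono (adm_eta.obsList x l) adm_eta (fun w hw => ih hw) s hw).trans
      (obs_eta_le_eta s hw)

lemma eta_le_obsList_add {X c : ℝ} (hX : ∀ a j, |x a j| ≤ X) (l : List (C → ℝ))
    (hl : ∀ s ∈ l, (∑ c, s c ^ 2) * (2 * B * X ^ 2) ≤ c) (hw : 0 ≤ w) :
    eta w ≤ obsList x l eta w + l.length * c * ∑ σ, w σ := by
  induction l generalizing w with
  | nil => simp
  | cons s l ih =>
    have h1 := obs_mono (x := x) adm_eta ((adm_eta.obsList x l).add (adm_mass.const_mul _))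
      (fun w hw => ih (fun s hs => hl s (List.mem_cons_of_mem _ hs)) hw) s hw
    rw [obs_add (adm_eta.obsList x l) (adm_mass.const_mul _) s hw, obs_const_mul, obs_mass] at h1
    have h2 := eta_le_obs_add_mass hX s hw
    have h3 := mul_le_mul_of_nonneg_right (hl s List.mem_cons_self)
      (Finset.sum_nonneg fun σ (_ : σ ∈ Finset.univ) => hw σ)
    rw [obsList_cons]
    push_cast [List.length_cons]
    linarith

lemma gain_nonneg (l : List (C → ℝ)) (hw : 0 ≤ w) : 0 ≤ gain x l w :=
  sub_nonneg.2 (obsList_eta_le l hw)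

lemma gain_le (l : List (C → ℝ)) (hw : 0 ≤ w) (h1 : ∑ σ, w σ = 1) :
    gain x l w ≤ Fintype.card C * Real.log (Fintype.card A) := by
  have h2 : 0 ≤ obsList x l eta w := by
    have := obsList_mono (x := x) (adm_mass.const_mul 0) adm_eta
      (fun w hw => by rw [zero_mul]; exact eta_nonneg hw) l hw
    rwa [obsList_mass l hw, zero_mul] at this
  have h3 := eta_le hw
  rw [h1, mul_one, Fintype.card_fun, Nat.cast_pow, Real.log_pow] at h3
  unfold gain; linarith

lemma gain_append_le {X c : ℝ} (hX : ∀ a j, |x a j| ≤ X) (l l' : List (C → ℝ))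
    (hl : ∀ s ∈ l', (∑ c, s c ^ 2) * (2 * B * X ^ 2) ≤ c) (hw : 0 ≤ w) (h1 : ∑ σ, w σ = 1) :
    gain x (l ++ l') w ≤ gain x l w + l'.length * c := by
  have h := obsList_mono (x := x) adm_eta ((adm_eta.obsList x l').add (adm_mass.const_mul _))
    (fun w hw => eta_le_obsList_add hX l' hl hw) l hw
  rw [obsList_add (adm_eta.obsList x l') (adm_mass.const_mul _) l hw, obsList_mass l hw, h1,
    mul_one, ← obsList_append] at h
  unfold gain; linarith

lemma gain_le_append (l l' : List (C → ℝ)) (hw : 0 ≤ w) : gain x l w ≤ gain x (l ++ l') w := by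
  have h := obsList_mono (x := x) (adm_eta.obsList x l') adm_eta
    (fun w hw => obsList_eta_le l' hw) l hw
  rw [← obsList_append] at h
  unfold gain; linarith

/-- The gain is Lipschitz in the number of rows of each type. -/
lemma gain_le_add_deficit {ι : Type} [Fintype ι] [DecidableEq ι] {X c : ℝ}
    (hX : ∀ a j, |x a j| ≤ X) (amp : ι → C → ℝ)
    (hc : ∀ i, (∑ c, amp i c ^ 2) * (2 * B * X ^ 2) ≤ c) (l l' : List ι)
    (hw : 0 ≤ w) (h1 : ∑ σ, w σ = 1) :
    gain x (l'.map amp) w ≤ gain x (l.map amp) w +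
      c * ∑ i, ((l'.count i - l.count i : ℕ) : ℝ) := by
  obtain ⟨d, hd⟩ : ∃ d : List ι, (d : Multiset ι) = (l' : Multiset ι) - l :=
    ⟨_, Multiset.coe_toList _⟩
  obtain ⟨e, he⟩ : ∃ e : List ι, ((l' ++ e : List ι) : Multiset ι) = (l ++ d : List ι) := by
    have : (l' : Multiset ι) ≤ (l : Multiset ι) + d := by rw [hd]; exact le_add_tsub
    obtain ⟨e, he⟩ := Multiset.le_iff_exists_add.1 this
    exact ⟨e.toList, by rw [← Multiset.coe_add, ← Multiset.coe_add, he, Multiset.coe_toList]⟩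
  have hperm := Multiset.coe_eq_coe.1 he
  have hlen : (d.length : ℝ) = ∑ i, ((l'.count i - l.count i : ℕ) : ℝ) := by
    have : d.length = ∑ i, (l'.count i - l.count i : ℕ) := by
      rw [← Multiset.coe_card, hd, ← Multiset.sum_count_eq_card (s := Finset.univ)
        (fun _ _ => Finset.mem_univ _)]
      exact Finset.sum_congr rfl fun i _ => by
        rw [Multiset.count_sub, Multiset.coe_count, Multiset.coe_count]
    rw [this]; push_cast; rfl
  rw [← hlen, mul_comm c]
  calc gain x (l'.map amp) w ≤ gain x (l'.map amp ++ e.map amp) w := gain_le_append _ _ hw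
    _ = gain x (l.map amp ++ d.map amp) w := by
        rw [← List.map_append, ← List.map_append]
        exact gain_perm (hperm.map amp) hw
    _ ≤ _ := by
        have := gain_append_le hX (l.map amp) (d.map amp) (c := c) (by simpa using fun i _ => hc i)
          hw h1
        simpa using this

lemma avgReveal_sum {κ : Type*} (I : Finset κ) (T : ℕ) (f : κ → ((C → A) → ℝ) → ℝ) :
    avgReveal T (fun w => ∑ i ∈ I, f i w) w = ∑ i ∈ I, avgReveal T (f i) w := by
  classical
  induction I using Finset.induction_on with
  | empty =>
    have := avgReveal_const_mul (w := w) (h := fun _ : (C → A) → ℝ => (0 : ℝ)) 0 T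
    simpa using this
  | insert a s ha ih => simp only [Finset.sum_insert ha]; rw [avgReveal_add, ih]

lemma collision_nonneg (hw : 0 ≤ w) : 0 ≤ collision w :=
  mul_nonneg (by positivity) (Finset.sum_nonneg fun _ _ => Finset.sum_nonneg fun _ _ =>
    div_nonneg (sq_nonneg _) (Finset.sum_nonneg fun σ _ => hw σ))

lemma collision_le_mass [Nonempty C] (hw : 0 ≤ w) : collision w ≤ ∑ σ, w σ := by
  have hn : (0 : ℝ) < Fintype.card C := by exact_mod_cast Fintype.card_pos
  have hW : 0 ≤ ∑ σ, w σ := Finset.sum_nonneg fun σ _ => hw σ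
  rw [collision, inv_mul_le_iff₀ hn]
  have : ∀ c : C, ∑ k, marg w c k ^ 2 / ∑ σ, w σ ≤ ∑ σ, w σ := by
    intro c
    calc _ ≤ ∑ k, marg w c k := Finset.sum_le_sum fun k _ => by
          have hm := marg_nonneg hw c k
          refine div_le_of_le_mul₀ hW hm ?_
          rw [sq]
          exact mul_le_mul_of_nonneg_left (marg_le_mass hw c k) hm
      _ = _ := sum_marg w c
  refine (Finset.sum_le_sum fun c _ => this c).trans_eq ?_
  simp

lemma reveal_iterate_collision_sub_le [Nonempty C] (T : ℕ) (hw : 0 ≤ w) :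
    reveal^[T] collision w - collision w ≤ ∑ σ, w σ := by
  have h1 := reveal_iterate_mono (h := collision) (fun w hw => collision_le_mass hw) T hw
  rw [reveal_iterate_mass] at h1
  linarith [collision_nonneg hw]

variable {ι : Type} [Fintype ι] [DecidableEq ι] {X κ δ : ℝ}

/-- For the entropy averaged over the disclosure of a few random sections, replacing a row by a
random one with the same average variances loses information up to a small error, uniformly over
the weights: the pairwise dependence of the sections is on average small after the
disclosure. -/
lemma obs_avgReveal_le_mix [Nonempty C] (hX : ∀ a j, |x a j| ≤ X) (hκ : 0 ≤ κ) {s : C → ℝ}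
    (hs : ∀ c, s c ^ 2 ≤ κ / Fintype.card C) (hδ0 : 0 < δ) (hδ : δ ≤ 1 / 4) {T : ℕ} (hT : T ≠ 0)
    {q : ι → ℝ} (hq : ∀ i, 0 ≤ q i) (hq1 : ∑ i, q i = 1) (amp : ι → C → ℝ)
    (hamp : ∀ c, ∑ i, q i * amp i c ^ 2 ≤ s c ^ 2) (hw : 0 ≤ w) :
    obs x s (avgReveal T eta) w ≤ ∑ i, q i * obs x (amp i) (avgReveal T eta) w +
      errConst (Fintype.card A) B X κ * (δ + δ⁻¹ ^ 5 * (T : ℝ)⁻¹) * ∑ σ, w σ := by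
  simp only [obs_avgReveal adm_eta _ T hw]
  refine (avgReveal_mono (fun w hw => obs_le_mix hX hκ hs hδ0 hδ hq hq1 amp hamp hw) T hw).trans ?_
  rw [avgReveal_add, avgReveal_sum, avgReveal_const_mul, avgReveal_add, avgReveal_const_mul,
    avgReveal_const_mul, avgReveal_mass hT, avgReveal_increment]
  simp only [avgReveal_const_mul]
  rw [mul_assoc]
  gcongr
  · exact errConst_nonneg _ _ _ hκ
  · have h1 := reveal_iterate_collision_sub_le T hw
    have h2 : δ⁻¹ ^ 5 * ((T : ℝ)⁻¹ * (reveal^[T] collision w - collision w)) ≤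
        δ⁻¹ ^ 5 * ((T : ℝ)⁻¹ * ∑ σ, w σ) := by gcongr
    linarith

lemma obsList_mix (l : List (C → ℝ)) (hh : Adm h) (q : ι → ℝ) (amp : ι → C → ℝ) (c : ℝ)
    (hw : 0 ≤ w) :
    obsList x l (fun w => ∑ i, q i * obs x (amp i) h w + c * ∑ σ, w σ) w =
      ∑ i, q i * obs x (amp i) (obsList x l h) w + c * ∑ σ, w σ := by
  have hA : ∀ i, Adm (fun w => q i * obs x (amp i) h w) := fun i => (hh.obs x _).const_mul _
  rw [obsList_add (adm_sum _ fun i _ => hA i) (adm_mass.const_mul c) l hw, obsList_mass l hw]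
  congr 1
  induction l generalizing w with
  | nil => rfl
  | cons s l ih =>
    rw [obsList_cons, obs_congr (fun w hw => ih hw) s hw,
      obs_sum _ (fun i _ => ((hh.obsList x l).obs x _).const_mul _) s hw]
    refine Finset.sum_congr rfl fun i _ => ?_
    rw [obs_const_mul, obs_comm (hh.obsList x l) s _ hw, obsList_cons]

variable {ρ : Type} {q : ρ → ι → ℝ}

lemma adm_expList (l : List ρ) {G : List ι → ((C → A) → ℝ) → ℝ} (hG : ∀ l, Adm (G l)) :
    Adm (fun w => expList q l fun l' => G l' w) := by
  induction l generalizing G with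
  | nil => exact hG _
  | cons r l ih =>
    exact adm_sum _ fun i _ => (ih fun l' => hG (i :: l')).const_mul _

lemma obs_expList (l : List ρ) {G : List ι → ((C → A) → ℝ) → ℝ} (hG : ∀ l, Adm (G l)) (s : C → ℝ)
    (hw : 0 ≤ w) :
    obs x s (fun w => expList q l fun l' => G l' w) w = expList q l fun l' => obs x s (G l') w := by
  induction l generalizing G with
  | nil => rfl
  | cons r l ih =>
    simp only [expList]
    rw [obs_sum _ (fun i _ => (adm_expList l fun l' => hG (i :: l')).const_mul _) s hw]
    refine Finset.sum_congr rfl fun i _ => ?_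
    rw [obs_const_mul, ih fun l' => hG (i :: l')]

lemma obsList_le_expList {h : ((C → A) → ℝ) → ℝ} (hh : Adm h) (s : ρ → C → ℝ) (amp : ι → C → ℝ)
    {ε : ℝ} (hq : ∀ r i, 0 ≤ q r i) (hq1 : ∀ r, ∑ i, q r i = 1)
    (hstep : ∀ r w, 0 ≤ w → obs x (s r) h w ≤ ∑ i, q r i * obs x (amp i) h w + ε * ∑ σ, w σ)
    (l : List ρ) (hw : 0 ≤ w) :
    obsList x (l.map s) h w ≤
      expList q l (fun l' => obsList x (l'.map amp) h w) + l.length * ε * ∑ σ, w σ := by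
  induction l generalizing w with
  | nil => simp [expList]
  | cons r l ih =>
    have hAdm : Adm (fun w => expList q l fun l' => obsList x (l'.map amp) h w) :=
      adm_expList l fun l' => hh.obsList x _
    have h1 := obs_mono (x := x) (hh.obsList x (l.map s)) (hAdm.add (adm_mass.const_mul _))
      (fun w hw => ih hw) (s r) hw
    rw [obs_add hAdm (adm_mass.const_mul _) _ hw, obs_const_mul, obs_mass,
      obs_expList l (fun l' => hh.obsList x _) _ hw] at h1
    have h2 : ∀ l' : List ι, obs x (s r) (obsList x (l'.map amp) h) w ≤
        ∑ i, q r i * obs x (amp i) (obsList x (l'.map amp) h) w + ε * ∑ σ, w σ := by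
      intro l'
      have hp : ((s r) :: l'.map amp).Perm (l'.map amp ++ [s r]) :=
        (List.perm_append_singleton _ _).symm
      have e1 := obsList_perm (x := x) hh hp hw
      rw [obsList_cons, obsList_append, obsList_cons, obsList_nil] at e1
      rw [e1, ← obsList_mix _ hh _ _ _ hw]
      exact obsList_mono (hh.obs x _)
        ((adm_sum _ fun i _ => (hh.obs x _).const_mul _).add (adm_mass.const_mul _))
        (fun w hw => hstep r w hw) _ hw
    have h3 := expList_mono hq l h2
    rw [expList_add, expList_const hq1, expList_sum] at h3
    simp only [expList_const_mul] at h3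
    simp only [List.map_cons, obsList_cons, expList, List.length_cons]
    push_cast
    linarith

/-- Number of entries of a list equal to `i`. -/
def typeCount {ι : Type} [DecidableEq ι] (l : List ι) (i : ι) : ℕ := l.count i

/-- Replacing independently each row by a random row with the same average variances decreases the
gain, up to an error which is small compared to the number of rows. The random rows are then
compared with a fixed list `l'`, the loss being controlled by the bias of the counts. -/
theorem exists_gain_comparison (A : Type) [Fintype A] [DecidableEq A] (x : A → Fin B → ℝ)
    {κ : ℝ} (hκ : 0 ≤ κ) {ε : ℝ} (hε : 0 < ε) :
    ∃ K : ℝ, 0 ≤ K ∧ ∀ (C ρ ι : Type) [Fintype C] [DecidableEq C] [Nonempty C] [Fintype ι]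
      [DecidableEq ι] (w : (C → A) → ℝ) (s : ρ → C → ℝ) (q : ρ → ι → ℝ) (amp : ι → C → ℝ)
      (l : List ρ) (l' : List ι), 0 ≤ w → ∑ σ, w σ = 1 →
      (∀ r c, s r c ^ 2 ≤ κ / Fintype.card C) → (∀ r i, 0 ≤ q r i) → (∀ r, ∑ i, q r i = 1) →
      (∀ r c, ∑ i, q r i * amp i c ^ 2 ≤ s r c ^ 2) → (∀ i, ∑ c, amp i c ^ 2 ≤ κ) →
      gain x (l'.map amp) w ≤ gain x (l.map s) w + ε * l.length + K * (1 + Fintype.card ι) +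
        K * ∑ i, |(typeCount l' i : ℝ) - meanCount q l i| := by
  obtain ⟨X, hX⟩ : ∃ X : ℝ, ∀ a j, |x a j| ≤ X := by
    refine ⟨∑ a, ∑ j, |x a j|, fun a j => ?_⟩
    have h1 : |x a j| ≤ ∑ j, |x a j| :=
      Finset.single_le_sum (f := fun j => |x a j|) (fun _ _ => abs_nonneg _) (Finset.mem_univ j)
    exact h1.trans (Finset.single_le_sum (f := fun a => ∑ j, |x a j|)
      (fun _ _ => Finset.sum_nonneg fun _ _ => abs_nonneg _) (Finset.mem_univ a))
  set E := errConst (Fintype.card A) B X κ with hE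
  have hE0 : 0 ≤ E := errConst_nonneg _ _ _ hκ
  set c := κ * (2 * B * X ^ 2) with hc
  have hc0 : 0 ≤ c := by positivity
  -- `δ` is chosen first, as the factor `δ⁻¹ ^ 5` in the error is compensated by the number `T` of
  -- disclosures
  obtain ⟨δ, hδ0, hδ, hδε⟩ : ∃ δ : ℝ, 0 < δ ∧ δ ≤ 1 / 4 ∧ (E + c) * δ ≤ ε / 2 := by
    refine ⟨min (1 / 4) (ε / (2 * (E + c + 1))), by positivity, min_le_left _ _, ?_⟩
    calc (E + c) * min (1 / 4) (ε / (2 * (E + c + 1))) ≤ (E + c) * (ε / (2 * (E + c + 1))) :=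
          mul_le_mul_of_nonneg_left (min_le_right _ _) (by positivity)
      _ ≤ (E + c + 1) * (ε / (2 * (E + c + 1))) :=
          mul_le_mul_of_nonneg_right (by linarith) (by positivity)
      _ = ε / 2 := by field_simp
  obtain ⟨T, hT0, hTε⟩ : ∃ T : ℕ, T ≠ 0 ∧ E * (δ⁻¹ ^ 5 * (T : ℝ)⁻¹) ≤ ε / 2 := by
    obtain ⟨T, hT⟩ := exists_nat_gt (E * δ⁻¹ ^ 5 * (2 / ε))
    have hT' : (0 : ℝ) < T := lt_of_le_of_lt (by positivity) hT
    refine ⟨T, by rintro rfl; simp at hT', ?_⟩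
    rw [← mul_assoc, ← div_eq_mul_inv, div_le_iff₀ hT']
    have := mul_le_mul_of_nonneg_left hT.le (by positivity : 0 ≤ ε / 2)
    calc _ = ε / 2 * (E * δ⁻¹ ^ 5 * (2 / ε)) := by field_simp
      _ ≤ _ := this
  have hlog : 0 ≤ Real.log (Fintype.card A) := Real.log_natCast_nonneg _
  refine ⟨T * Real.log (Fintype.card A) + c * δ⁻¹ + c, by positivity, ?_⟩
  intro C ρ ι _ _ _ _ _ w s q amp l l' hw h1 hs hq hq1 hqs hamp
  have hch : ∀ i, (∑ c, amp i c ^ 2) * (2 * B * X ^ 2) ≤ c := fun i =>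
    mul_le_mul_of_nonneg_right (hamp i) (by positivity)
  have hAR : Adm (avgReveal T (eta : ((C → A) → ℝ) → ℝ)) := adm_eta.avgReveal T
  have hcmp := obsList_le_expList (x := x) hAR s amp hq hq1
    (fun r w hw => obs_avgReveal_le_mix hX hκ (hs r) hδ0 hδ hT0 (hq r) (hq1 r) amp (hqs r) hw) l hw
  rw [h1, mul_one, ← hE] at hcmp
  -- return from the averaged entropy to the entropy, on both sides of the comparison
  have hleft := obsList_mono (x := x) adm_eta (hAR.add (adm_mass.const_mul _))
    (fun w hw => le_avgReveal_eta hT0 hw) (l.map s) hw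
  rw [obsList_add hAR (adm_mass.const_mul _) _ hw, obsList_mass _ hw, h1, mul_one] at hleft
  have hright : ∀ l'' : List ι, obsList x (l''.map amp) (avgReveal T eta) w ≤
      (eta w - gain x (l'.map amp) w) + c * ∑ i, ((l'.count i - l''.count i : ℕ) : ℝ) := by
    intro l''
    have h2 := obsList_mono (x := x) hAR adm_eta (fun w hw => avgReveal_eta_le T hw)
      (l''.map amp) hw
    have h3 := gain_le_add_deficit hX amp hch l'' l' hw h1
    have h4 : gain x (l''.map amp) w = eta w - obsList x (l''.map amp) eta w := rfl
    linarith
  have hexp := expList_mono hq l hright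
  rw [expList_add, expList_const hq1, expList_const_mul, expList_sum] at hexp
  have hdef : ∑ i, expList q l (fun l'' => ((l'.count i - l''.count i : ℕ) : ℝ)) ≤
      ∑ i, |(l'.count i : ℝ) - meanCount q l i| + δ * l.length + Fintype.card ι * δ⁻¹ := by
    refine (Finset.sum_le_sum fun i _ => expList_deficit_le hq1 hq l i (l'.count i) hδ0).trans ?_
    rw [Finset.sum_add_distrib, Finset.sum_add_distrib, ← Finset.mul_sum, sum_meanCount hq1]
    simp
  have hdef' := mul_le_mul_of_nonneg_left hdef hc0
  have hg : gain x (l.map s) w = eta w - obsList x (l.map s) eta w := rfl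
  unfold typeCount
  set S := ∑ i, |(l'.count i : ℝ) - meanCount q l i|
  have hS : 0 ≤ S := Finset.sum_nonneg fun _ _ => abs_nonneg _
  set n := (Fintype.card ι : ℝ)
  have hn : 0 ≤ n := Nat.cast_nonneg _
  have hlen : (0 : ℝ) ≤ l.length := Nat.cast_nonneg _
  have e1 : (l.length : ℝ) * (E * (δ + δ⁻¹ ^ 5 * (T : ℝ)⁻¹)) + c * (δ * l.length) ≤ ε * l.length := by
    have : E * (δ + δ⁻¹ ^ 5 * (T : ℝ)⁻¹) + c * δ ≤ ε := by linarith
    have := mul_le_mul_of_nonneg_right this hlen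
    linarith
  have hi : 0 ≤ δ⁻¹ := (inv_pos.2 hδ0).le
  have t1 : 0 ≤ T * Real.log (Fintype.card A) * n := by positivity
  have t2 : 0 ≤ c * δ⁻¹ := by positivity
  have t3 : 0 ≤ c * n := by positivity
  have t4 : 0 ≤ T * Real.log (Fintype.card A) * S := by positivity
  have t5 : 0 ≤ c * δ⁻¹ * S := by positivity
  nlinarith

end Gain

/-! ### Product priors and decoupled designs -/

/-- The weights of i.i.d. sections with type probabilities `p`. -/
def prior {A : Type} (C : Type) [Fintype C] (p : A → ℝ) (σ : C → A) : ℝ := ∏ c, p (σ c)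

lemma prior_nonneg {A C : Type} [Fintype C] {p : A → ℝ} (hp : ∀ a, 0 ≤ p a) : 0 ≤ prior C p :=
  fun _ => Finset.prod_nonneg fun _ _ => hp _

lemma sum_prior {A C : Type} [Fintype A] [Fintype C] [DecidableEq C] {p : A → ℝ}
    (hp1 : ∑ a, p a = 1) : ∑ σ, prior C p σ = 1 := by
  have := Fintype.prod_sum fun (_ : C) a => p a
  simp only [hp1, Finset.prod_const_one] at this
  exact this.symm

lemma measurePreserving_pi_comp {ι ι' Ω : Type} [Fintype ι] [Fintype ι'] [MeasurableSpace Ω]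
    (μ : Measure Ω) [IsProbabilityMeasure μ] {f : ι' → ι} (hf : f.Injective) :
    MeasurePreserving (fun (g : ι → Ω) i => g (f i)) (Measure.pi fun _ => μ)
      (Measure.pi fun _ => μ) := by
  refine ⟨by fun_prop, ?_⟩
  have h1 : iIndepFun (fun (i : ι) (g : ι → Ω) => g i) (Measure.pi fun _ => μ) :=
    iIndepFun_pi (X := fun (_ : ι) (y : Ω) => y) fun _ => aemeasurable_id
  have h2 := (iIndepFun_iff_map_fun_eq_pi_map (fun i => (measurable_pi_apply (f i)).aemeasurable)).1
    (h1.precomp hf)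
  refine h2.trans ?_
  congr 1
  funext i
  exact (measurePreserving_eval (fun _ : ι => μ) (f i)).map_eq

section Extend

variable {A C C' : Type} [Fintype A] [DecidableEq A] [Fintype C] [DecidableEq C] [Fintype C']
  [DecidableEq C'] {B : ℕ} {x : A → Fin B → ℝ} {w : (C → A) → ℝ} {h : ((C → A) → ℝ) → ℝ}
  {f : C' → C}

lemma coup_extend (hf : f.Injective) (s : C' → ℝ) (g : C → Fin B → ℝ) (σ : C → A) :
    coup x (Function.extend f s 0) g σ = coup x s (fun c => g (f c)) (fun c => σ (f c)) := by
  refine (Fintype.sum_of_injective f hf _ _ (fun c hc => ?_) fun c => ?_).symm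
  · have h0 : Function.extend f s 0 c = 0 := Function.extend_apply' _ _ _ (by simpa using hc)
    simp [h0]
  · simp only [hf.extend_apply]

/-- A row supported on some of the sections only involves the corresponding entries. -/
lemma obs_extend (hf : f.Injective) (hh : Adm h) (s : C' → ℝ) :
    obs x (Function.extend f s 0) h w =
      ∫ θ, h (fun σ => w σ * lik (coup x s θ.1 fun c => σ (f c)) θ.2) ∂(rowLaw C' B) := by
  have hmp : MeasurePreserving (Prod.map (fun (g : C → Fin B → ℝ) c => g (f c)) (id : ℝ → ℝ))
      (rowLaw C B) (rowLaw C' B) :=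
    (measurePreserving_pi_comp (Measure.pi fun _ : Fin B => gaussianReal 0 1) hf).prod
      (MeasurePreserving.id _)
  rw [← hmp.map_eq, integral_map hmp.measurable.aemeasurable]
  · unfold obs upd
    simp only [coup_extend hf]
    rfl
  · refine (hh.measurable.comp (measurable_pi_lambda _ fun σ => ?_)).aestronglyMeasurable
    exact (measurable_lik.comp (((measurable_coup x s _).comp measurable_fst).prodMk
      measurable_snd)).const_mul _

end Extend

section Factor

variable {A C C₁ R : Type} [Fintype A] [DecidableEq A] [Fintype C] [DecidableEq C] [Fintype C₁]
  [DecidableEq C₁] [Fintype R] [DecidableEq R] {B : ℕ} {x : A → Fin B → ℝ} {p : A → ℝ}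

/-- Sums over configurations of the sections of a disjoint union. -/
lemma sum_config (E : C₁ ⊕ R ≃ C) (F : (C₁ → A) → (R → A) → ℝ) :
    ∑ σ : C → A, F (fun c => σ (E (.inl c))) (fun r => σ (E (.inr r))) = ∑ τ, ∑ ρ, F τ ρ := by
  rw [← Fintype.sum_prod_type']
  exact Fintype.sum_equiv ((Equiv.arrowCongr E.symm (Equiv.refl A)).trans
    (Equiv.sumArrowEquivProdArrow C₁ R A)) _ _ fun σ => rfl

lemma eta_factor (E : C₁ ⊕ R ≃ C) (u : (C₁ → A) → ℝ) (v : (R → A) → ℝ) :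
    eta (fun σ : C → A => u (fun c => σ (E (.inl c))) * v (fun r => σ (E (.inr r)))) =
      eta u * ∑ ρ, v ρ + (∑ τ, u τ) * eta v := by
  have e1 := sum_config E fun τ ρ => u τ * v ρ
  have e2 := sum_config E fun τ ρ => Real.negMulLog (u τ * v ρ)
  simp only [eta]
  rw [e1, e2]
  simp only [Real.negMulLog_mul, Finset.sum_add_distrib, ← Finset.mul_sum, ← Finset.sum_mul]
  ring

/-- Rows which do not involve some of the sections do not change their weights. -/
lemma obsList_factor (E : C₁ ⊕ R ≃ C) (l : List (C₁ → ℝ)) {u : (C₁ → A) → ℝ} (hu : 0 ≤ u)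
    (v : (R → A) → ℝ) :
    obsList x (l.map fun s => Function.extend (fun c => E (.inl c)) s 0) eta
      (fun σ : C → A => u (fun c => σ (E (.inl c))) * v (fun r => σ (E (.inr r)))) =
      obsList x l eta u * ∑ ρ, v ρ + (∑ τ, u τ) * eta v := by
  have hinj : Function.Injective fun c => E (.inl c) := E.injective.comp Sum.inl_injective
  induction l generalizing u with
  | nil => exact eta_factor E u v
  | cons s l ih =>
    have hA : Adm fun u : (C₁ → A) → ℝ => (∑ ρ, v ρ) * obsList x l eta u :=
      (adm_eta.obsList x l).const_mul _
    have key := obs_congr (x := x)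
      (h := fun u => obsList x (l.map fun s => Function.extend (fun c => E (.inl c)) s 0) eta
        (fun σ : C → A => u (fun c => σ (E (.inl c))) * v (fun r => σ (E (.inr r)))))
      (h' := fun u => (∑ ρ, v ρ) * obsList x l eta u + eta v * ∑ τ, u τ)
      (fun u hu => by rw [ih hu]; ring) s hu
    rw [obs_add hA (adm_mass.const_mul _) s hu, obs_const_mul, obs_const_mul, obs_mass] at key
    rw [List.map_cons, obsList_cons, obs_extend hinj (adm_eta.obsList x _)]
    rw [obsList_cons, mul_comm (obs x s _ u), mul_comm (∑ τ, u τ)]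
    rw [← key]
    refine integral_congr_ae (ae_of_all _ fun θ => ?_)
    simp only [upd]
    congr 1
    funext σ
    ring

lemma prior_factor (E : C₁ ⊕ R ≃ C) (σ : C → A) :
    prior C p σ = prior C₁ p (fun c => σ (E (.inl c))) * prior R p (fun r => σ (E (.inr r))) := by
  simp only [prior]
  rw [← E.prod_comp, Fintype.prod_sum_type]

/-- Sections which are not measured do not contribute to the gain. -/
theorem gain_extend (E : C₁ ⊕ R ≃ C) (hp : ∀ a, 0 ≤ p a) (hp1 : ∑ a, p a = 1)
    (l : List (C₁ → ℝ)) :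
    gain x (l.map fun s => Function.extend (fun c => E (.inl c)) s 0) (prior C p) =
      gain x l (prior C₁ p) := by
  have e : prior C p = fun σ => prior C₁ p (fun c => σ (E (.inl c))) *
      prior R p (fun r => σ (E (.inr r))) := funext fun σ => prior_factor E σ
  rw [gain, e, obsList_factor E l (prior_nonneg hp), eta_factor, gain,
    sum_prior hp1, sum_prior hp1]
  ring

end Factor

section Tensor

variable {A β D : Type} [Fintype A] [DecidableEq A] [Fintype β] [DecidableEq β] [Fintype D]
  [DecidableEq D] {B : ℕ} {x : A → Fin B → ℝ} {p : A → ℝ}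

/-- The weights of independent blocks of sections. -/
def tensor (w : β → (D → A) → ℝ) (σ : β × D → A) : ℝ := ∏ b, w b fun d => σ (b, d)

lemma negMulLog_prod {ι : Type*} [DecidableEq ι] (s : Finset ι) (a : ι → ℝ) :
    Real.negMulLog (∏ i ∈ s, a i) = ∑ i ∈ s, Real.negMulLog (a i) * ∏ j ∈ s.erase i, a j := by
  induction s using Finset.induction_on with
  | empty => simp
  | insert i s hi ih =>
    rw [Finset.prod_insert hi, Real.negMulLog_mul, ih, Finset.sum_insert hi,
      Finset.erase_insert hi, Finset.mul_sum, mul_comm]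
    congr 1
    refine Finset.sum_congr rfl fun j hj => ?_
    have hij : i ≠ j := fun h => hi (h ▸ hj)
    rw [Finset.erase_insert_of_ne hij, Finset.prod_insert (fun h => hi (Finset.mem_of_mem_erase h))]
    ring

lemma sum_blocks (F : (β → D → A) → ℝ) :
    ∑ σ : β × D → A, F (fun b d => σ (b, d)) = ∑ τ, F τ :=
  Fintype.sum_equiv (Equiv.curry β D A) _ _ fun _ => rfl

lemma sum_tensor (w : β → (D → A) → ℝ) : ∑ σ, tensor w σ = ∏ b, ∑ τ, w b τ := by
  have := sum_blocks fun τ : β → D → A => ∏ b, w b (τ b)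
  rw [Fintype.prod_sum]
  exact this

lemma eta_tensor (w : β → (D → A) → ℝ) :
    eta (tensor w) = ∑ b, eta (w b) * ∏ b' ∈ Finset.univ.erase b, ∑ τ, w b' τ := by
  have e1 : ∑ σ, Real.negMulLog (tensor w σ) = ∑ b, (∑ τ, Real.negMulLog (w b τ)) *
      ∏ b' ∈ Finset.univ.erase b, ∑ τ, w b' τ := by
    have h1 := sum_blocks fun τ : β → D → A => Real.negMulLog (∏ b, w b (τ b))
    refine h1.trans ?_
    simp only [negMulLog_prod]
    rw [Finset.sum_comm]
    refine Finset.sum_congr rfl fun b _ => ?_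
    have h2 := Fintype.prod_sum fun (b' : β) (τ : D → A) =>
      if b' = b then Real.negMulLog (w b' τ) else w b' τ
    rw [← Finset.mul_prod_erase _ _ (Finset.mem_univ b)] at h2
    have h3 : ∏ b' ∈ Finset.univ.erase b, ∑ τ, (if b' = b then Real.negMulLog (w b' τ) else w b' τ)
        = ∏ b' ∈ Finset.univ.erase b, ∑ τ, w b' τ :=
      Finset.prod_congr rfl fun b' hb' => by simp [Finset.ne_of_mem_erase hb']
    rw [h3] at h2
    simp only [if_true] at h2
    rw [h2]
    refine Finset.sum_congr rfl fun τ _ => ?_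
    rw [← Finset.mul_prod_erase _ _ (Finset.mem_univ b), if_pos rfl]
    congr 1
    exact Finset.prod_congr rfl fun b' hb' => by rw [if_neg (Finset.ne_of_mem_erase hb')]
  rw [eta, e1, sum_tensor, negMulLog_prod, ← Finset.sum_sub_distrib]
  exact Finset.sum_congr rfl fun b _ => by rw [eta]; ring

/-- Measurements of independent blocks, each row involving a single block. -/
lemma obsList_tensor {ι : Type} (tag : ι → β) (row : ι → D → ℝ) (l : List ι)
    {w : β → (D → A) → ℝ} (hw : ∀ b, 0 ≤ w b) :
    obsList x (l.map fun i => Function.extend (fun d => (tag i, d)) (row i) 0) eta (tensor w) =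
      ∑ b, obsList x ((l.filter fun i => tag i = b).map row) eta (w b) *
        ∏ b' ∈ Finset.univ.erase b, ∑ τ, w b' τ := by
  induction l generalizing w with
  | nil => exact eta_tensor w
  | cons i l ih =>
    set b₀ := tag i with hb₀
    set L : β → List (D → ℝ) := fun b => (l.filter fun i => tag i = b).map row with hL
    set L' : β → List (D → ℝ) := fun b => ((i :: l).filter fun i => tag i = b).map row with hL'
    have hinj : Function.Injective fun d : D => (b₀, d) := fun d d' h => (Prod.mk.inj h).2
    have hup : ∀ (u : (D → A) → ℝ) (σ : β × D → A), tensor (Function.update w b₀ u) σ =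
        u (fun d => σ (b₀, d)) * ∏ b' ∈ Finset.univ.erase b₀, w b' fun d => σ (b', d) := by
      intro u σ
      rw [tensor, ← Finset.mul_prod_erase _ _ (Finset.mem_univ b₀), Function.update_self]
      congr 1
      exact Finset.prod_congr rfl fun b' hb' => by
        rw [Function.update_of_ne (Finset.ne_of_mem_erase hb')]
    have h1 : obs x (Function.extend (fun d => (b₀, d)) (row i) 0)
        (obsList x (l.map fun i => Function.extend (fun d => (tag i, d)) (row i) 0) eta) (tensor w) =
        obs x (row i) (fun u => obsList x (l.map fun i =>
          Function.extend (fun d => (tag i, d)) (row i) 0) eta (tensor (Function.update w b₀ u)))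
          (w b₀) := by
      rw [obs_extend hinj (adm_eta.obsList x _)]
      refine integral_congr_ae (ae_of_all _ fun θ => ?_)
      simp only []
      congr 1
      funext σ
      rw [hup, upd, tensor, ← Finset.mul_prod_erase _ _ (Finset.mem_univ b₀)]
      ring
    have hupn : ∀ u : (D → A) → ℝ, 0 ≤ u → ∀ b, 0 ≤ Function.update w b₀ u b := by
      intro u hu b
      rcases eq_or_ne b b₀ with rfl | hb
      · rw [Function.update_self]; exact hu
      · rw [Function.update_of_ne hb]; exact hw b
    -- each term is linear in the weights of the block `b₀`
    have hterm : ∀ b, ∃ a c : ℝ, (∀ u, obsList x (L b) eta (Function.update w b₀ u b) *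
        ∏ b' ∈ Finset.univ.erase b, ∑ τ, Function.update w b₀ u b' τ =
          a * obsList x (L b₀) eta u + c * ∑ τ, u τ) ∧
        obsList x (L' b) eta (w b) * ∏ b' ∈ Finset.univ.erase b, ∑ τ, w b' τ =
          a * obsList x (L' b₀) eta (w b₀) + c * ∑ τ, w b₀ τ := by
      intro b
      rcases eq_or_ne b b₀ with rfl | hb
      · refine ⟨∏ b' ∈ Finset.univ.erase b₀, ∑ τ, w b' τ, 0, fun u => ?_, by ring⟩
        rw [Function.update_self, zero_mul, add_zero, mul_comm]
        congr 1
        exact Finset.prod_congr rfl fun b' hb' => by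
          rw [Function.update_of_ne (Finset.ne_of_mem_erase hb')]
      · have hmem : b₀ ∈ Finset.univ.erase b := Finset.mem_erase.2 ⟨hb.symm, Finset.mem_univ _⟩
        have hLb : L' b = L b := by
          simp only [hL, hL']
          rw [List.filter_cons_of_neg]
          simpa using fun h => hb h.symm
        refine ⟨0, obsList x (L b) eta (w b) *
          ∏ b' ∈ (Finset.univ.erase b).erase b₀, ∑ τ, w b' τ, fun u => ?_, ?_⟩
        · rw [Function.update_of_ne hb, ← Finset.mul_prod_erase _ _ hmem, Function.update_self,
            Finset.prod_congr rfl fun b' hb' => by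
              rw [Function.update_of_ne (Finset.ne_of_mem_erase hb')]]
          ring
        · rw [hLb, ← Finset.mul_prod_erase _ _ hmem]
          ring
    choose a c h2 h3 using hterm
    have hL0 : L' b₀ = row i :: L b₀ := by
      simp only [hL, hL']
      rw [List.filter_cons_of_pos (by simp [hb₀]), List.map_cons]
    rw [List.map_cons, obsList_cons, h1]
    rw [obs_congr (h' := fun u => ∑ b, (a b * obsList x (L b₀) eta u + c b * ∑ τ, u τ))
      (fun u hu => by rw [ih (hupn u hu)]; exact Finset.sum_congr rfl fun b _ => h2 b u) _ (hw b₀)]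
    rw [obs_sum _ (fun b _ => ((adm_eta.obsList x _).const_mul _).add (adm_mass.const_mul _)) _
      (hw b₀)]
    refine Finset.sum_congr rfl fun b _ => ?_
    rw [obs_add ((adm_eta.obsList x _).const_mul _) (adm_mass.const_mul _) _ (hw b₀),
      obs_const_mul, obs_const_mul, obs_mass]
    refine Eq.trans ?_ (h3 b).symm
    rw [hL0, obsList_cons]

/-- The gain is additive over decoupled blocks. -/
theorem gain_tensor {ι : Type} (hp : ∀ a, 0 ≤ p a) (hp1 : ∑ a, p a = 1) (tag : ι → β)
    (row : ι → D → ℝ) (l : List ι) :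
    gain x (l.map fun i => Function.extend (fun d => (tag i, d)) (row i) 0) (prior (β × D) p) =
      ∑ b, gain x ((l.filter fun i => tag i = b).map row) (prior D p) := by
  have e : prior (β × D) p = tensor fun _ : β => prior D p := by
    funext σ; simp only [prior, tensor, Fintype.prod_prod_type]
  rw [gain, e, obsList_tensor tag row l fun _ => prior_nonneg hp, eta_tensor,
    ← Finset.sum_sub_distrib]
  simp only [sum_prior hp1, Finset.prod_const_one, mul_one]
  rfl

end Tensor

/-! ### Joint law of several measurements -/

section Rows

variable {A C R : Type} [Fintype A] [DecidableEq A] [Fintype C] [DecidableEq C] [Fintype R] {B : ℕ}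
  {x : A → Fin B → ℝ} {w : (C → A) → ℝ} {h : ((C → A) → ℝ) → ℝ}

/-- Unnormalized Bayes update of weights by the measurements `y`, with rows of standard deviations
`s` and standardized entries `g`. -/
def updRows (x : A → Fin B → ℝ) (s : R → C → ℝ) (w : (C → A) → ℝ) (g : R → C → Fin B → ℝ)
    (y : R → ℝ) (σ : C → A) : ℝ :=
  w σ * ∏ μ, lik (coup x (s μ) (g μ) σ) (y μ)

lemma measurable_updRows (x : A → Fin B → ℝ) (s : R → C → ℝ) (w : (C → A) → ℝ) :
    Measurable fun p : (R → C → Fin B → ℝ) × (R → ℝ) => updRows x s w p.1 p.2 := by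
  refine measurable_pi_lambda _ fun σ => ?_
  refine (Finset.measurable_prod _ fun μ _ => ?_).const_mul _
  exact measurable_lik.comp (((measurable_coup x (s μ) σ).comp
    ((measurable_pi_apply μ).comp measurable_fst)).prodMk
    ((measurable_pi_apply μ).comp measurable_snd))

lemma updRows_nonneg (hw : 0 ≤ w) (x : A → Fin B → ℝ) (s : R → C → ℝ) (g y) :
    0 ≤ updRows x s w g y :=
  fun σ => mul_nonneg (hw σ) (Finset.prod_nonneg fun _ _ => (lik_pos _ _).le)

lemma integrable_rows (hh : Adm h) (hw : 0 ≤ w) (s : R → C → ℝ) :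
    Integrable (fun θ : R → (C → Fin B → ℝ) × ℝ =>
      h (updRows x s w (fun μ => (θ μ).1) fun μ => (θ μ).2)) (Measure.pi fun _ => rowLaw C B) := by
  obtain ⟨m, K, hK⟩ := hh
  have h1 : ∀ σ, Integrable (fun θ : R → (C → Fin B → ℝ) × ℝ =>
      ∏ μ, lik (coup x (s μ) (θ μ).1 σ) (θ μ).2) (Measure.pi fun _ => rowLaw C B) := fun σ =>
    Integrable.fintype_prod (f := fun μ (θ : (C → Fin B → ℝ) × ℝ) =>
      lik (coup x (s μ) θ.1 σ) θ.2) fun μ => (lik_coup x (s μ) σ).1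
  have hb := (integrable_finsetSum Finset.univ fun σ _ => (h1 σ).const_mul (w σ)).const_mul K
  have hm : Measurable fun θ : R → (C → Fin B → ℝ) × ℝ =>
      ((fun μ => (θ μ).1, fun μ => (θ μ).2) : (R → C → Fin B → ℝ) × (R → ℝ)) :=
    (measurable_pi_lambda _ fun μ => measurable_fst.comp (measurable_pi_apply μ)).prodMk
      (measurable_pi_lambda _ fun μ => measurable_snd.comp (measurable_pi_apply μ))
  exact hb.mono' (m.comp ((measurable_updRows x s w).comp hm)).aestronglyMeasurable
    (ae_of_all _ fun θ => hK _ (updRows_nonneg hw x s _ _))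

lemma integral_rows_fin (hh : Adm h) {n : ℕ} (s : Fin n → C → ℝ) (hw : 0 ≤ w) :
    ∫ θ : Fin n → (C → Fin B → ℝ) × ℝ, h (updRows x s w (fun μ => (θ μ).1) fun μ => (θ μ).2)
      ∂(Measure.pi fun _ => rowLaw C B) = obsList x (List.ofFn s) h w := by
  induction n generalizing w with
  | zero =>
    have e : ∀ g y, updRows x s w g y = w := fun g y => by funext σ; simp [updRows]
    simp only [e, integral_const, probReal_univ, one_smul]
    rfl
  | succ n ih =>
    have hmp := measurePreserving_piFinSuccAbove (fun _ : Fin (n + 1) => rowLaw C B) 0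
    set G : ((C → Fin B → ℝ) × ℝ) × (Fin n → (C → Fin B → ℝ) × ℝ) → ℝ := fun p =>
      h (updRows x (fun i => s i.succ) (upd x (s 0) w p.1) (fun μ => (p.2 μ).1)
        fun μ => (p.2 μ).2) with hG
    have e : ∀ θ : Fin (n + 1) → (C → Fin B → ℝ) × ℝ,
        h (updRows x s w (fun μ => (θ μ).1) fun μ => (θ μ).2) =
        G (MeasurableEquiv.piFinSuccAbove (fun _ => (C → Fin B → ℝ) × ℝ) 0 θ) := by
      intro θ
      simp only [hG]
      congr 1
      funext σ
      simp only [updRows, upd, Fin.prod_univ_succ, mul_assoc]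
      rfl
    have hint := integrable_rows (x := x) hh hw s
    simp only [e] at hint ⊢
    have hGi := (hmp.integrable_comp_emb (MeasurableEquiv.measurableEmbedding _) (g := G)).1 hint
    rw [hmp.integral_comp' G, integral_prod _ hGi, List.ofFn_succ, obsList_cons]
    unfold obs
    refine integral_congr_ae (ae_of_all _ fun θ => ?_)
    exact ih (fun i => s i.succ) (upd_nonneg hw x (s 0) θ)

/-- The joint average over all the measurements is the composition of the observation operators of
the rows. -/
theorem integral_rows (hh : Adm h) (s : R → C → ℝ) (hw : 0 ≤ w) :
    ∫ g, ∫ y, h (updRows x s w g y) ∂(Measure.pi fun _ => gaussianReal 0 1)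
      ∂(Measure.pi fun _ => stdLaw C B) = obsList x (Finset.univ.toList.map s) h w := by
  classical
  set F : (R → (C → Fin B → ℝ) × ℝ) → ℝ := fun θ =>
    h (updRows x s w (fun μ => (θ μ).1) fun μ => (θ μ).2) with hF
  have hFi := integrable_rows (x := x) hh hw s
  have hmp := measurePreserving_arrowProdEquivProdArrow (C → Fin B → ℝ) ℝ R
    (fun _ => stdLaw C B) (fun _ => gaussianReal 0 1)
  set G : (R → C → Fin B → ℝ) × (R → ℝ) → ℝ := fun p => h (updRows x s w p.1 p.2)
  have hGi : Integrable G ((Measure.pi fun _ => stdLaw C B).prod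
      (Measure.pi fun _ => gaussianReal 0 1)) :=
    (hmp.integrable_comp_emb (MeasurableEquiv.measurableEmbedding _) (g := G)).1 hFi
  have e1 : ∫ θ, F θ ∂(Measure.pi fun _ => rowLaw C B) = ∫ g, ∫ y, h (updRows x s w g y)
      ∂(Measure.pi fun _ => gaussianReal 0 1) ∂(Measure.pi fun _ => stdLaw C B) :=
    (hmp.integral_comp' G).trans (integral_prod _ hGi)
  rw [← e1]
  let e := (Fintype.equivFin R).symm
  have hmp2 := measurePreserving_pi_comp (rowLaw C B) e.symm.injective
  rw [← hmp2.map_eq, integral_map hmp2.measurable.aemeasurable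
    (by rw [hmp2.map_eq]; exact hFi.aestronglyMeasurable)]
  have e2 : ∀ θ : Fin (Fintype.card R) → (C → Fin B → ℝ) × ℝ, F (fun i => θ (e.symm i)) =
      h (updRows x (fun i => s (e i)) w (fun μ => (θ μ).1) fun μ => (θ μ).2) := by
    intro θ
    simp only [hF]
    congr 1
    funext σ
    simp only [updRows]
    rw [← e.prod_comp]
    simp
  simp only [e2]
  rw [integral_rows_fin hh _ hw]
  refine obsList_perm hh ?_ hw
  have h3 : (List.ofFn fun i => s (e i)) = (List.ofFn e).map s := by
    rw [List.map_ofFn]; rfl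
  rw [h3]
  refine List.Perm.map _ ((List.perm_ext_iff_of_nodup ?_ (Finset.nodup_toList _)).2 fun a => ?_)
  · exact List.nodup_ofFn.2 e.injective
  · simp [List.mem_ofFn, e.surjective a]

end Rows

/-! ### Shift of the noise -/

section Shift

variable {R : Type} [Fintype R]

lemma integrable_prod_lik (u : R → ℝ) :
    Integrable (fun y : R → ℝ => ∏ μ, lik (u μ) (y μ)) (Measure.pi fun _ => gaussianReal 0 1) :=
  Integrable.fintype_prod (f := fun μ y => lik (u μ) y) fun μ => integrable_lik (u μ)

lemma integral_prod_lik (u : R → ℝ) :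
    ∫ y : R → ℝ, ∏ μ, lik (u μ) (y μ) ∂(Measure.pi fun _ => gaussianReal 0 1) = 1 := by
  rw [integral_fintype_prod_eq_prod (fun μ y => lik (u μ) y)]
  simp [integral_lik]

/-- Change of variables for a shift of a standard Gaussian vector. -/
lemma integral_shift (u : R → ℝ) (F : (R → ℝ) → ℝ) :
    ∫ z, F (fun μ => u μ + z μ) ∂(Measure.pi fun _ => gaussianReal 0 1) =
      ∫ y, (∏ μ, lik (u μ) (y μ)) * F y ∂(Measure.pi fun _ => gaussianReal 0 1) := by
  have hl0 : ∀ y : R → ℝ, 0 ≤ ∏ μ, lik (u μ) (y μ) :=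
    fun y => Finset.prod_nonneg fun μ _ => (lik_pos _ _).le
  have hm : Measurable fun y : R → ℝ => ENNReal.ofReal (∏ μ, lik (u μ) (y μ)) := by
    unfold lik; fun_prop
  have h1 : (Measure.pi fun _ : R => gaussianReal 0 1).withDensity
      (fun y => ENNReal.ofReal (∏ μ, lik (u μ) (y μ))) = Measure.pi fun μ => gaussianReal (u μ) 1 := by
    refine (Measure.pi_eq fun s hs => ?_).symm
    rw [withDensity_apply _ (MeasurableSet.univ_pi hs), Measure.restrict_pi_pi]
    have hi : ∀ μ, Integrable (lik (u μ)) ((gaussianReal 0 1).restrict (s μ)) :=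
      fun μ => (integrable_lik (u μ)).restrict
    have hI : Integrable (fun y : R → ℝ => ∏ μ, lik (u μ) (y μ))
        (Measure.pi fun μ => (gaussianReal 0 1).restrict (s μ)) :=
      Integrable.fintype_prod (f := fun μ y => lik (u μ) y) hi
    rw [← ofReal_integral_eq_lintegral_ofReal hI (ae_of_all _ hl0),
      integral_fintype_prod_eq_prod (fun μ y => lik (u μ) y),
      ENNReal.ofReal_prod_of_nonneg fun μ _ => integral_nonneg fun y => (lik_pos _ _).le]
    refine Finset.prod_congr rfl fun μ _ => ?_
    rw [← withDensity_lik (u μ), withDensity_apply _ (hs μ),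
      ofReal_integral_eq_lintegral_ofReal (hi μ) (ae_of_all _ fun y => (lik_pos _ _).le)]
  have h2 : MeasurePreserving (fun (z : R → ℝ) μ => u μ + z μ) (Measure.pi fun _ => gaussianReal 0 1)
      (Measure.pi fun μ => gaussianReal (u μ) 1) :=
    measurePreserving_pi _ _ fun μ => ⟨by fun_prop, by
      rw [gaussianReal_map_const_add, zero_add]⟩
  have h3 : MeasurableEmbedding (fun (z : R → ℝ) μ => u μ + z μ) :=
    (MeasurableEquiv.addLeft u).measurableEmbedding
  rw [h2.integral_comp h3, ← h1, integral_withDensity_eq_integral_toReal_smul hm (by simp)]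
  simp [ENNReal.toReal_ofReal (hl0 _)]

end Shift

/-! ### The mutual information as a gain -/

section Channel

variable {Ω R : Type} [Fintype Ω] [Fintype R]

/-- The mutual information of a Gaussian channel with finitely many inputs is the average loss of
entropy under the reference law of the output. -/
lemma sum_integral_log_eq {w : Ω → ℝ} (hw : 0 ≤ w) (h1 : ∑ σ, w σ = 1) (u : Ω → R → ℝ) :
    ∑ τ, w τ * ∫ z, Real.log ((∏ μ, lik (u τ μ) (u τ μ + z μ)) /
        ∑ σ, w σ * ∏ μ, lik (u σ μ) (u τ μ + z μ)) ∂(Measure.pi fun _ => gaussianReal 0 1) =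
      eta w - ∫ y, eta (fun σ => w σ * ∏ μ, lik (u σ μ) (y μ))
        ∂(Measure.pi fun _ => gaussianReal 0 1) := by
  set L : Ω → (R → ℝ) → ℝ := fun σ y => ∏ μ, lik (u σ μ) (y μ) with hL
  have hL0 : ∀ σ y, 0 < L σ y := fun σ y => Finset.prod_pos fun μ _ => lik_pos _ _
  have hLm : ∀ σ, Measurable (L σ) := fun σ => by simp only [hL]; unfold lik; fun_prop
  have hLi : ∀ σ, Integrable (L σ) (Measure.pi fun _ => gaussianReal 0 1) :=
    fun σ => integrable_prod_lik (u σ)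
  set Z : (R → ℝ) → ℝ := fun y => ∑ σ, w σ * L σ y with hZ
  have hZm : Measurable Z := Finset.measurable_sum _ fun σ _ => (hLm σ).const_mul _
  have hZi : Integrable Z (Measure.pi fun _ => gaussianReal 0 1) :=
    integrable_finsetSum _ fun σ _ => (hLi σ).const_mul _
  have hZ0 : ∀ y, 0 < Z y := fun y => by
    obtain ⟨τ, hτ⟩ : ∃ τ, 0 < w τ := by
      by_contra hc
      push Not at hc
      have : ∑ σ, w σ ≤ 0 := Finset.sum_nonpos fun σ _ => hc σ
      linarith
    exact Finset.sum_pos' (fun σ _ => mul_nonneg (hw σ) (hL0 σ y).le)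
      ⟨τ, Finset.mem_univ _, mul_pos hτ (hL0 τ y)⟩
  have hshift : ∀ τ, ∫ z, Real.log ((∏ μ, lik (u τ μ) (u τ μ + z μ)) /
        ∑ σ, w σ * ∏ μ, lik (u σ μ) (u τ μ + z μ)) ∂(Measure.pi fun _ => gaussianReal 0 1) =
      ∫ y, L τ y * Real.log (L τ y / Z y) ∂(Measure.pi fun _ => gaussianReal 0 1) :=
    fun τ => integral_shift (u τ) fun y => Real.log (L τ y / Z y)
  have hterm : ∀ τ, Integrable (fun y => w τ * (L τ y * Real.log (L τ y / Z y)))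
      (Measure.pi fun _ => gaussianReal 0 1) := by
    intro τ
    -- the likelihood ratio `L τ / Z` is at most `1 / w τ`, and `t log t ≥ t - 1`
    refine (hZi.add ((hLi τ).mul_const |Real.negMulLog (w τ)|)).mono' ?_ (ae_of_all _ fun y => ?_)
    · exact (((hLm τ).mul (((hLm τ).div hZm).log)).const_mul _).aestronglyMeasurable
    · have hl := hL0 τ y
      have hz := hZ0 y
      have hw1 : w τ ≤ 1 := h1 ▸ Finset.single_le_sum (fun σ _ => hw σ) (Finset.mem_univ τ)
      simp only [Real.norm_eq_abs, Pi.add_apply]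
      rw [abs_le]
      constructor
      · have h2 := Real.one_sub_inv_le_log_of_pos (div_pos hl hz)
        have h3 := mul_le_mul_of_nonneg_left h2 hl.le
        have e : L τ y * (1 - (L τ y / Z y)⁻¹) = L τ y - Z y := by field_simp
        rw [e] at h3
        have h4 := mul_le_mul_of_nonneg_left h3 (hw τ)
        have h5 : w τ * Z y ≤ Z y := mul_le_of_le_one_left hz.le hw1
        have h6 := mul_nonneg (hw τ) hl.le
        have h7 : 0 ≤ L τ y * |Real.negMulLog (w τ)| := by positivity
        linarith
      · rcases (hw τ).eq_or_lt with h0 | h0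
        · simp only [← h0, Pi.zero_apply, zero_mul]; positivity
        · have h2 : L τ y / Z y ≤ (w τ)⁻¹ := by
            rw [div_le_iff₀ hz, ← div_eq_inv_mul, le_div_iff₀ h0, mul_comm]
            exact Finset.single_le_sum (f := fun σ => w σ * L σ y)
              (fun σ _ => mul_nonneg (hw σ) (hL0 σ y).le) (Finset.mem_univ τ)
          have h3 := Real.log_le_log (div_pos hl hz) h2
          rw [Real.log_inv] at h3
          have h4 := mul_le_mul_of_nonneg_left h3 (mul_pos h0 hl).le
          have h5 := mul_le_mul_of_nonneg_left (le_abs_self (Real.negMulLog (w τ))) hl.le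
          have e : w τ * L τ y * -Real.log (w τ) = L τ y * Real.negMulLog (w τ) := by
            rw [Real.negMulLog]; ring
          rw [e] at h4
          linarith
  -- pointwise, the information density is the prior entropy terms weighted by likelihoods minus
  -- the entropy of the updated weights
  have hpt : ∀ y, ∑ τ, w τ * (L τ y * Real.log (L τ y / Z y)) =
      ∑ τ, L τ y * Real.negMulLog (w τ) - eta (fun σ => w σ * L σ y) := by
    intro y
    have e : ∀ τ, w τ * (L τ y * Real.log (L τ y / Z y)) = L τ y * Real.negMulLog (w τ) -
        Real.negMulLog (w τ * L τ y) - w τ * L τ y * Real.log (Z y) := by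
      intro τ
      rw [Real.log_div (hL0 τ y).ne' (hZ0 y).ne', Real.negMulLog_mul]
      simp only [Real.negMulLog]; ring
    simp only [e]
    rw [Finset.sum_sub_distrib, Finset.sum_sub_distrib, ← Finset.sum_mul, eta]
    have : ∑ τ, w τ * L τ y = Z y := rfl
    rw [this, Real.negMulLog]; ring
  have heta : Integrable (fun y => eta fun σ => w σ * L σ y)
      (Measure.pi fun _ => gaussianReal 0 1) := by
    refine (hZi.const_mul (Real.log (Fintype.card Ω))).mono' ?_ (ae_of_all _ fun y => ?_)
    · exact (measurable_eta.comp (measurable_pi_lambda _ fun σ =>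
        (hLm σ).const_mul (w σ))).aestronglyMeasurable
    · have hn : 0 ≤ fun σ => w σ * L σ y := fun σ => mul_nonneg (hw σ) (hL0 σ y).le
      rw [Real.norm_of_nonneg (eta_nonneg hn)]
      exact eta_le hn
  simp only [hshift, ← integral_const_mul]
  rw [← integral_finsetSum _ fun τ _ => hterm τ]
  simp only [hpt]
  rw [integral_sub (integrable_finsetSum _ fun τ _ => (hLi τ).mul_const _) heta,
    integral_finsetSum _ fun τ _ => (hLi τ).mul_const _]
  simp only [integral_mul_const, hL, integral_prod_lik, one_mul]
  simp [eta, h1]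

end Channel

section Signal

variable {C : Type} [Fintype C] [DecidableEq C] {B : ℕ}

lemma signalLaw_eq_sum (P : DiscretePrior B) : signalLaw C P =
    ∑ τ : C → Fin P.K, ENNReal.ofReal (prior C (fun k => (P.p k : ℝ)) τ) •
      Measure.dirac (fun c => P.a (τ c)) := by
  refine Measure.pi_eq fun s hs => ?_
  simp only [DiscretePrior.measure, Measure.coe_finsetSum, Finset.sum_apply, Measure.smul_apply,
    smul_eq_mul]
  rw [Fintype.prod_sum]
  refine Finset.sum_congr rfl fun τ _ => ?_
  rw [Finset.prod_mul_distrib]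
  congr 1
  · rw [prior, ENNReal.ofReal_prod_of_nonneg fun c _ => NNReal.coe_nonneg _]
    simp
  · rw [Measure.dirac_apply' _ (MeasurableSet.univ_pi hs)]
    simp only [Measure.dirac_apply' _ (hs _)]
    by_cases h : ∀ c, P.a (τ c) ∈ s c
    · rw [Set.indicator_of_mem (by simpa using h)]
      simp [h]
    · rw [Set.indicator_of_notMem (by simpa using h)]
      push Not at h
      obtain ⟨c, hc⟩ := h
      exact (Finset.prod_eq_zero (Finset.mem_univ c) (by simp [hc])).symm

lemma integral_signalLaw (P : DiscretePrior B) (F : (C → Fin B → ℝ) → ℝ) :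
    ∫ s, F s ∂(signalLaw C P) =
      ∑ τ : C → Fin P.K, prior C (fun k => (P.p k : ℝ)) τ * F (fun c => P.a (τ c)) := by
  rw [signalLaw_eq_sum, integral_finsetSum_measure]
  · refine Finset.sum_congr rfl fun τ _ => ?_
    rw [integral_smul_measure, integral_dirac,
      ENNReal.toReal_ofReal (prior_nonneg (fun k => NNReal.coe_nonneg _) τ), smul_eq_mul]
  · intro τ _
    exact (integrable_dirac (by simp)).smul_measure ENNReal.ofReal_ne_top

end Signal

section Convert

variable {R C C₁ D : Type} [Fintype R] [Fintype C] [DecidableEq C] [Fintype C₁] [DecidableEq C₁]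
  [Fintype D] [DecidableEq D] {B : ℕ}

/-- The density of the measurements in terms of likelihoods relative to the standard Gaussian
law. -/
lemma channelDensity_eq {Δ : ℝ} (hΔ : 0 < Δ) (φ : R → C → Fin B → ℝ) (s x' : C → Fin B → ℝ)
    (z u v : R → ℝ) (h : ∀ μ, proj φ x' μ - proj φ s μ = √Δ * (u μ - v μ)) :
    channelDensity Δ φ x' (measurements Δ φ s z) =
      ((2 * Real.pi * Δ) ^ (-(Fintype.card R : ℝ) / 2) *
        Real.exp (-(∑ μ, (v μ + z μ) ^ 2 / 2))) * ∏ μ, lik (u μ) (v μ + z μ) := by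
  rw [channelDensity, mul_assoc ((2 * Real.pi * Δ) ^ (-(Fintype.card R : ℝ) / 2))]
  congr 1
  unfold lik
  rw [← Real.exp_sum, ← Real.exp_add, ← Finset.sum_neg_distrib, ← Finset.sum_add_distrib,
    Finset.mul_sum]
  congr 1
  refine Finset.sum_congr rfl fun μ _ => ?_
  have h1 : proj φ x' μ - measurements Δ φ s z μ = √Δ * (u μ - v μ - z μ) := by
    rw [measurements]; linarith [h μ]
  rw [h1, mul_pow, Real.sq_sqrt hΔ.le]
  field_simp
  ring

lemma log_density_ratio (P : DiscretePrior B) {Δ : ℝ} (hΔ : 0 < Δ) (known : C → Prop)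
    [DecidablePred known] (E : C₁ ⊕ D ≃ C) (hE₁ : ∀ c, ¬ known (E (.inl c)))
    (hE₂ : ∀ d, known (E (.inr d))) (φ : R → C → Fin B → ℝ) (τ : C → Fin P.K) (z : R → ℝ)
    (u : (C₁ → Fin P.K) → R → ℝ)
    (hu : ∀ σ μ, u σ μ = ∑ c, ∑ j, φ μ (E (.inl c)) j * (P.a (σ c) j / √Δ)) :
    Real.log (channelDensity Δ φ (fun c => P.a (τ c)) (measurements Δ φ (fun c => P.a (τ c)) z) /
      evidence P Δ known φ (fun c => P.a (τ c)) (measurements Δ φ (fun c => P.a (τ c)) z)) =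
    Real.log ((∏ μ, lik (u (fun c => τ (E (.inl c))) μ) (u (fun c => τ (E (.inl c))) μ + z μ)) /
      ∑ σ, prior C₁ (fun k => (P.p k : ℝ)) σ *
        ∏ μ, lik (u σ μ) (u (fun c => τ (E (.inl c))) μ + z μ)) := by
  have hsq : √Δ ≠ 0 := (Real.sqrt_pos.2 hΔ).ne'
  set τ₁ : C₁ → Fin P.K := fun c => τ (E (.inl c)) with hτ₁
  have hpE : ∀ (x' : C → Fin B → ℝ) μ, proj φ x' μ = ∑ c, ∑ j, φ μ (E (.inl c)) j * x' (E (.inl c)) j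
      + ∑ d, ∑ j, φ μ (E (.inr d)) j * x' (E (.inr d)) j := by
    intro x' μ
    rw [proj, ← E.sum_comp, Fintype.sum_sum_type]
  have hmix : ∀ (σ : C → Fin P.K) μ,
      proj φ (fun c => if known c then P.a (τ c) else P.a (σ c)) μ - proj φ (fun c => P.a (τ c)) μ =
        √Δ * (u (fun c => σ (E (.inl c))) μ - u τ₁ μ) := by
    intro σ μ
    rw [hpE, hpE, hu, hu]
    simp only [hE₁, hE₂, if_true, if_false, mul_sub, Finset.mul_sum, hτ₁]
    rw [add_sub_add_right_eq_sub]
    congr 1 <;>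
    · refine Finset.sum_congr rfl fun c _ => Finset.sum_congr rfl fun j _ => ?_
      field_simp
  have hnum := channelDensity_eq hΔ φ (fun c => P.a (τ c)) (fun c => P.a (τ c)) z (u τ₁) (u τ₁)
    (fun μ => by simp)
  have hden : evidence P Δ known φ (fun c => P.a (τ c)) (measurements Δ φ (fun c => P.a (τ c)) z) =
      ((2 * Real.pi * Δ) ^ (-(Fintype.card R : ℝ) / 2) *
        Real.exp (-(∑ μ, (u τ₁ μ + z μ) ^ 2 / 2))) *
      ∑ σ, prior C₁ (fun k => (P.p k : ℝ)) σ * ∏ μ, lik (u σ μ) (u τ₁ μ + z μ) := by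
    rw [evidence, integral_signalLaw]
    simp only [channelDensity_eq hΔ φ _ _ z _ _ (hmix _), prior_factor E]
    rw [sum_config E (fun σ ρ => prior C₁ (fun k => (P.p k : ℝ)) σ *
      prior D (fun k => (P.p k : ℝ)) ρ * (((2 * Real.pi * Δ) ^ (-(Fintype.card R : ℝ) / 2) *
        Real.exp (-(∑ μ, (u τ₁ μ + z μ) ^ 2 / 2))) * ∏ μ, lik (u σ μ) (u τ₁ μ + z μ))),
      Finset.mul_sum]
    refine Finset.sum_congr rfl fun σ _ => ?_
    rw [← Finset.sum_mul, ← Finset.mul_sum, sum_prior (by exact_mod_cast P.sum_p)]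
    ring
  rw [hnum, hden, mul_div_mul_left]
  have : (0 : ℝ) < 2 * Real.pi * Δ := by positivity
  positivity

lemma measurePreserving_scale (V : R → C → ℝ≥0) :
    MeasurePreserving (fun (g : R → C → Fin B → ℝ) μ c j => √(V μ c) * g μ c j)
      (Measure.pi fun _ => stdLaw C B) (matrixLaw B V) := by
  refine measurePreserving_pi _ _ fun μ => measurePreserving_pi
    (f := fun c (g : Fin B → ℝ) j => √(V μ c) * g j) _ _ fun c =>
    measurePreserving_pi (f := fun _ y => √(V μ c) * y) _ _ fun j => ⟨by fun_prop, ?_⟩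
  rw [gaussianReal_map_const_mul, mul_zero, mul_one]
  congr 1
  ext
  simp [Real.sq_sqrt]

/-- The mutual information is the gain of the rows restricted to the unknown sections. -/
theorem card_mul_mutualInfo (P : DiscretePrior B) {Δ : ℝ} (hΔ : 0 < Δ) (V : R → C → ℝ≥0)
    (known : C → Prop) [DecidablePred known] (E : C₁ ⊕ D ≃ C) (hE₁ : ∀ c, ¬ known (E (.inl c)))
    (hE₂ : ∀ d, known (E (.inr d))) [Nonempty C] :
    Fintype.card C * mutualInfo P Δ V known =
      gain (fun k j => P.a k j / √Δ)
        (Finset.univ.toList.map fun μ c => √(V μ (E (.inl c)))) (prior C₁ fun k => (P.p k : ℝ)) := by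
  classical
  set x : Fin P.K → Fin B → ℝ := fun k j => P.a k j / √Δ with hx
  set p : Fin P.K → ℝ := fun k => (P.p k : ℝ) with hp
  have hp0 : ∀ k, 0 ≤ p k := fun k => NNReal.coe_nonneg _
  have hp1 : ∑ k, p k = 1 := by simp only [hp]; exact_mod_cast P.sum_p
  have hn : (Fintype.card C : ℝ) ≠ 0 := by exact_mod_cast Fintype.card_ne_zero
  set u : (R → C → Fin B → ℝ) → (C₁ → Fin P.K) → R → ℝ := fun φ σ μ =>
    ∑ c, ∑ j, φ μ (E (.inl c)) j * (P.a (σ c) j / √Δ) with hu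
  set H : (R → C → Fin B → ℝ) → ℝ := fun φ => ∫ y, eta (fun σ => prior C₁ p σ *
    ∏ μ, lik (u φ σ μ) (y μ)) ∂(Measure.pi fun _ => gaussianReal 0 1) with hH
  have h1 : ∀ φ, (∫ s, ∫ z, Real.log (channelDensity Δ φ s (measurements Δ φ s z) /
        evidence P Δ known φ s (measurements Δ φ s z)) ∂(noiseLaw R) ∂(signalLaw C P)) =
      eta (prior C₁ p) - H φ := by
    intro φ
    rw [integral_signalLaw, ← sum_integral_log_eq (prior_nonneg hp0) (sum_prior hp1) (u φ)]
    simp only [log_density_ratio P hΔ known E hE₁ hE₂ φ _ _ (u φ) (fun _ _ => rfl),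
      prior_factor E, noiseLaw]
    rw [sum_config E (fun τ ρ => prior C₁ p τ * prior D p ρ * ∫ z, Real.log
      ((∏ μ, lik (u φ τ μ) (u φ τ μ + z μ)) / ∑ σ, prior C₁ p σ *
        ∏ μ, lik (u φ σ μ) (u φ τ μ + z μ)) ∂(Measure.pi fun _ => gaussianReal 0 1))]
    refine Finset.sum_congr rfl fun τ _ => ?_
    rw [← Finset.sum_mul, ← Finset.mul_sum, sum_prior hp1, mul_one]
  have hum : ∀ σ μ, Measurable fun φ => u φ σ μ := fun σ μ => by simp only [hu]; fun_prop
  have hHm : StronglyMeasurable H := by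
    have : StronglyMeasurable fun q : (R → C → Fin B → ℝ) × (R → ℝ) =>
        eta (fun σ => prior C₁ p σ * ∏ μ, lik (u q.1 σ μ) (q.2 μ)) := by
      refine (measurable_eta.comp (measurable_pi_lambda _ fun σ => ?_)).stronglyMeasurable
      refine (Finset.measurable_prod _ fun μ _ => ?_).const_mul _
      exact measurable_lik.comp (((hum σ μ).comp measurable_fst).prodMk
        ((measurable_pi_apply μ).comp measurable_snd))
    exact this.integral_prod_right
  -- the matrix restricted to the unknown sections, in terms of standardized entries
  set s : R → C₁ → ℝ := fun μ c => √(V μ (E (.inl c))) with hs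
  set H₁ : (R → C₁ → Fin B → ℝ) → ℝ := fun g => ∫ y, eta (updRows x s (prior C₁ p) g y)
    ∂(Measure.pi fun _ => gaussianReal 0 1) with hH₁
  have hH₁m : StronglyMeasurable H₁ := by
    have : StronglyMeasurable fun q : (R → C₁ → Fin B → ℝ) × (R → ℝ) =>
        eta (updRows x s (prior C₁ p) q.1 q.2) :=
      (measurable_eta.comp (measurable_updRows x s (prior C₁ p))).stronglyMeasurable
    exact this.integral_prod_right
  have hinj : Function.Injective fun c => E (.inl c) := E.injective.comp Sum.inl_injective
  have hres : MeasurePreserving (fun (g : R → C → Fin B → ℝ) μ c => g μ (E (.inl c)))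
      (Measure.pi fun _ => stdLaw C B) (Measure.pi fun _ => stdLaw C₁ B) :=
    measurePreserving_pi _ _ fun μ =>
      measurePreserving_pi_comp (Measure.pi fun _ : Fin B => gaussianReal 0 1) hinj
  have hHH : ∀ g : R → C → Fin B → ℝ, H (fun μ c j => √(V μ c) * g μ c j) =
      H₁ (fun μ c => g μ (E (.inl c))) := by
    intro g
    simp only [hH, hH₁]
    refine integral_congr_ae (ae_of_all _ fun y => ?_)
    refine congrArg eta (funext fun σ => congrArg (prior C₁ p σ * ·) ?_)
    refine Finset.prod_congr rfl fun μ _ => ?_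
    congr 1
    simp only [hu, coup, pair, hs, hx]
    exact Finset.sum_congr rfl fun c _ => Finset.sum_congr rfl fun j _ => by ring
  have h2 : ∫ φ, H φ ∂(matrixLaw B V) = obsList x (Finset.univ.toList.map s) eta (prior C₁ p) := by
    have hsc := measurePreserving_scale (B := B) V
    rw [← hsc.map_eq, integral_map hsc.measurable.aemeasurable hHm.aestronglyMeasurable]
    simp only [hHH]
    rw [← integral_rows adm_eta s (prior_nonneg hp0), ← hres.map_eq,
      integral_map hres.measurable.aemeasurable hH₁m.aestronglyMeasurable]
  have : IsProbabilityMeasure (matrixLaw B V) := by unfold matrixLaw; infer_instance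
  have hHi : Integrable H (matrixLaw B V) := by
    refine Integrable.of_bound hHm.aestronglyMeasurable (Real.log (Fintype.card (C₁ → Fin P.K)))
      (ae_of_all _ fun φ => ?_)
    have hL := fun σ (_ : σ ∈ (Finset.univ : Finset (C₁ → Fin P.K))) =>
      (integrable_prod_lik (u φ σ)).const_mul (prior C₁ p σ)
    have e : ∫ y, Real.log (Fintype.card (C₁ → Fin P.K)) * ∑ σ, prior C₁ p σ *
        ∏ μ, lik (u φ σ μ) (y μ) ∂(Measure.pi fun _ => gaussianReal 0 1) =
        Real.log (Fintype.card (C₁ → Fin P.K)) := by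
      rw [integral_const_mul, integral_finsetSum _ hL]
      simp only [integral_const_mul, integral_prod_lik, mul_one, sum_prior hp1]
    rw [← e]
    refine norm_integral_le_of_norm_le ((integrable_finsetSum _ hL).const_mul _)
      (ae_of_all _ fun y => ?_)
    have hn : 0 ≤ fun σ => prior C₁ p σ * ∏ μ, lik (u φ σ μ) (y μ) := fun σ =>
      mul_nonneg (prior_nonneg hp0 σ) (Finset.prod_nonneg fun μ _ => (lik_pos _ _).le)
    rw [Real.norm_of_nonneg (eta_nonneg hn)]
    exact eta_le hn
  rw [mutualInfo, ← mul_assoc, mul_one_div_cancel hn, one_mul]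
  simp only [h1]
  rw [integral_sub (integrable_const _) hHi, h2, gain]
  simp

end Convert

/-! ### Block designs -/

section Lists

variable {T β ι : Type} [Fintype T] [Fintype β] [DecidableEq β] [DecidableEq ι]

lemma typeCount_map_toList (f : T → ι) (i : ι) :
    (typeCount (Finset.univ.toList.map f) i : ℝ) = ∑ t, if f t = i then 1 else 0 := by
  rw [typeCount, ← Multiset.coe_count, ← Multiset.map_coe, Finset.coe_toList, Multiset.count_map,
    Finset.sum_boole]
  congr 2
  rw [← Finset.filter_val]
  exact congrArg (fun s : Finset T => s.1) (Finset.filter_congr fun t _ => eq_comm)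

lemma meanCount_toList [Fintype ι] (q : T → ι → ℝ) (i : ι) :
    meanCount q Finset.univ.toList i = ∑ t, q t i := Finset.sum_map_toList _ _

lemma filter_map_toList_perm (b : β) :
    ((((Finset.univ : Finset (T × β)).toList.filter fun t => t.2 = b).map Prod.fst)).Perm
      (Finset.univ : Finset T).toList := by
  classical
  refine (List.perm_ext_iff_of_nodup ?_ (Finset.nodup_toList _)).2 fun a => by simp
  refine List.Nodup.map_on ?_ ((Finset.nodup_toList _).filter _)
  rintro ⟨t, b₁⟩ h₁ ⟨t', b₂⟩ h₂ h
  simp only [List.mem_filter, Finset.mem_toList, Finset.mem_univ, true_and,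
    decide_eq_true_eq] at h₁ h₂ h
  rw [h, h₁, h₂]

end Lists

section Blocks

variable {A ρ D : Type} [Fintype A] [DecidableEq A] [Fintype ρ] [DecidableEq ρ] [Fintype D]
  [DecidableEq D] {B : ℕ} {x : A → Fin B → ℝ} {p : A → ℝ}

/-- Standard deviations of the rows of type `r` of a block design. -/
def blockRow (J : ρ → D → ℝ) (ℓ : ℕ) (r : ρ) (c : D × Fin ℓ) : ℝ := √(J r c.1 / ℓ)

/-- The gain of a block design: the sections are divided into blocks of size `ℓ` indexed by `D`,
there are `m` rows of each type `r : ρ`, and the entries of a row of type `r` have variance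
`J r d / ℓ` in block `d`. -/
def blockGain (x : A → Fin B → ℝ) (p : A → ℝ) (J : ρ → D → ℝ) (ℓ m : ℕ) : ℝ :=
  gain x ((Finset.univ : Finset (ρ × Fin m)).toList.map fun μ => blockRow J ℓ μ.1)
    (prior (D × Fin ℓ) p)

lemma blockRow_sq {J : ρ → D → ℝ} (hJ : ∀ r d, 0 ≤ J r d) (ℓ : ℕ) (r : ρ) (c : D × Fin ℓ) :
    blockRow J ℓ r c ^ 2 = J r c.1 / ℓ := Real.sq_sqrt (by have := hJ r c.1; positivity)

lemma sum_blockRow_sq {J : ρ → D → ℝ} (hJ : ∀ r d, 0 ≤ J r d) {ℓ : ℕ} (hℓ : 0 < ℓ) (r : ρ) :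
    ∑ c, blockRow J ℓ r c ^ 2 = ∑ d, J r d := by
  have : (ℓ : ℝ) ≠ 0 := by positivity
  simp only [blockRow_sq hJ, Fintype.sum_prod_type, Finset.sum_const, Finset.card_univ,
    Fintype.card_fin, nsmul_eq_mul]
  exact Finset.sum_congr rfl fun d _ => by field_simp

lemma blockGain_nonneg (hp : ∀ a, 0 ≤ p a) (J : ρ → D → ℝ) (ℓ m : ℕ) :
    0 ≤ blockGain x p J ℓ m := gain_nonneg _ (prior_nonneg hp)

lemma blockGain_le (hp : ∀ a, 0 ≤ p a) (hp1 : ∑ a, p a = 1) (J : ρ → D → ℝ) (ℓ m : ℕ) :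
    blockGain x p J ℓ m ≤ ℓ * (Fintype.card D * Real.log (Fintype.card A)) := by
  refine (gain_le _ (prior_nonneg hp) (sum_prior hp1)).trans_eq ?_
  rw [Fintype.card_prod, Fintype.card_fin]; push_cast; ring

lemma le_sum_sum {J : ρ → D → ℝ} (hJ : ∀ r d, 0 ≤ J r d) (r : ρ) :
    ∑ d, J r d ≤ ∑ r, ∑ d, J r d :=
  Finset.single_le_sum (f := fun r => ∑ d, J r d)
    (fun _ _ => Finset.sum_nonneg fun _ _ => hJ _ _) (Finset.mem_univ r)

lemma sum_le_card_mul [Nonempty D] {J : ρ → D → ℝ} (hJ : ∀ r d, 0 ≤ J r d) (r : ρ) :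
    ∑ d, J r d ≤ Fintype.card D * ∑ r, ∑ d, J r d := by
  have h1 : (1 : ℝ) ≤ Fintype.card D := by exact_mod_cast Fintype.card_pos
  have h0 : 0 ≤ ∑ r, ∑ d, J r d := Finset.sum_nonneg fun _ _ => Finset.sum_nonneg fun _ _ => hJ _ _
  exact (le_sum_sum hJ r).trans (le_mul_of_one_le_left h0 h1)

lemma blockRow_sq_le [Nonempty D] {J : ρ → D → ℝ} (hJ : ∀ r d, 0 ≤ J r d) (ℓ : ℕ) (r : ρ)
    (c : D × Fin ℓ) : blockRow J ℓ r c ^ 2 ≤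
      (Fintype.card D * ∑ r, ∑ d, J r d) / Fintype.card (D × Fin ℓ) := by
  have h1 : (0 : ℝ) < Fintype.card D := by exact_mod_cast Fintype.card_pos
  rw [blockRow_sq hJ, Fintype.card_prod, Fintype.card_fin, Nat.cast_mul,
    mul_div_mul_left _ _ h1.ne']
  refine div_le_div_of_nonneg_right ?_ (Nat.cast_nonneg _)
  exact (Finset.single_le_sum (f := fun d => J r d) (fun _ _ => hJ _ _)
    (Finset.mem_univ c.1)).trans (le_sum_sum hJ r)

/-- A block design dominates a second one if each row of its variance profile dominates an average
of rows of that of the second one, every row of which is used equally often. The error is small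
compared to the number of rows. -/
theorem exists_blockGain_le [Nonempty D] (hp : ∀ a, 0 ≤ p a) (hp1 : ∑ a, p a = 1)
    (x : A → Fin B → ℝ) {ι : Type} [Fintype ι] [DecidableEq ι] {J : ρ → D → ℝ} {J' : ι → D → ℝ}
    (hJ : ∀ r d, 0 ≤ J r d) (hJ' : ∀ i d, 0 ≤ J' i d) {Q : ρ → ι → ℝ} (hQ : ∀ r i, 0 ≤ Q r i)
    (hQ1 : ∀ r, ∑ i, Q r i = 1) (hQ2 : ∀ i, ∑ r, Q r i = 1)
    (hle : ∀ r d, ∑ i, Q r i * J' i d ≤ J r d) {ε : ℝ} (hε : 0 < ε) :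
    ∃ K : ℝ, ∀ ℓ m : ℕ, 0 < ℓ →
      blockGain x p J' ℓ m ≤ blockGain x p J ℓ m + ε * (Fintype.card ρ * m) + K := by
  have hS : ∀ {τ : Type} [Fintype τ] {J : τ → D → ℝ}, (∀ r d, 0 ≤ J r d) →
      0 ≤ ∑ r, ∑ d, J r d := fun hJ =>
    Finset.sum_nonneg fun _ _ => Finset.sum_nonneg fun _ _ => hJ _ _
  have hS1 := hS hJ
  have hS2 := hS hJ'
  have hcD : (0 : ℝ) ≤ Fintype.card D := Nat.cast_nonneg _
  -- a bound for the total variance of a row and for `card D * ℓ` times the variance of an entry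
  set κ := Fintype.card D * ∑ r, ∑ d, J r d + Fintype.card D * ∑ r, ∑ d, J' r d with hκ
  obtain ⟨K, hK0, hK⟩ := exists_gain_comparison A x (κ := κ) (by positivity) hε
  refine ⟨K * (1 + Fintype.card ι), fun ℓ m hℓ => ?_⟩
  have : Nonempty (Fin ℓ) := ⟨⟨0, hℓ⟩⟩
  have h := hK (D × Fin ℓ) (ρ × Fin m) ι (prior (D × Fin ℓ) p) (fun μ => blockRow J ℓ μ.1)
    (fun μ => Q μ.1) (fun i => blockRow J' ℓ i) Finset.univ.toList
    ((Finset.univ : Finset (ι × Fin m)).toList.map Prod.fst) (prior_nonneg hp) (sum_prior hp1)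
    (fun μ c => (blockRow_sq_le hJ ℓ μ.1 c).trans (by gcongr; rw [hκ]; nlinarith))
    (fun μ i => hQ _ _) (fun μ => hQ1 _)
    (fun μ c => by
      simp only [blockRow_sq hJ, blockRow_sq hJ', ← mul_div_assoc]
      rw [← Finset.sum_div]
      exact div_le_div_of_nonneg_right (hle _ _) (Nat.cast_nonneg _))
    (fun i => by
      rw [sum_blockRow_sq hJ' hℓ]
      refine (sum_le_card_mul hJ' i).trans ?_
      rw [hκ]; nlinarith)
  -- as the columns of `Q` sum to one, each type of row is drawn `m` times on average
  have hbias : ∀ i, |(typeCount ((Finset.univ : Finset (ι × Fin m)).toList.map Prod.fst) i : ℝ) -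
      meanCount (fun μ : ρ × Fin m => Q μ.1) Finset.univ.toList i| = 0 := by
    intro i
    rw [typeCount_map_toList, meanCount_toList, Fintype.sum_prod_type_right,
      Fintype.sum_prod_type_right]
    simp [hQ2]
  simp only [hbias, Finset.sum_const_zero, mul_zero, add_zero, List.map_map, Finset.length_toList,
    Finset.card_univ, Fintype.card_prod, Fintype.card_fin, Nat.cast_mul] at h
  exact h

lemma exists_blocks_equiv {q ℓ e L : ℕ} (h : q * ℓ + e = L) :
    ∃ E : (Fin q × (D × Fin ℓ)) ⊕ (D × Fin e) ≃ D × Fin L,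
      (∀ b c, (E (.inl (b, c))).1 = c.1) ∧ ∀ c, (E (.inr c)).1 = c.1 := by
  let e₀ : (Fin q × Fin ℓ) ⊕ Fin e ≃ Fin L :=
    (Equiv.sumCongr finProdFinEquiv (Equiv.refl _)).trans (finSumFinEquiv.trans (finCongr h))
  let e₁ : Fin q × (D × Fin ℓ) ≃ D × (Fin q × Fin ℓ) :=
    ⟨fun t => (t.2.1, (t.1, t.2.2)), fun t => (t.2.1, (t.1, t.2.2)), fun _ => rfl, fun _ => rfl⟩
  exact ⟨(Equiv.sumCongr e₁ (Equiv.refl _)).trans ((Equiv.prodSumDistrib D _ _).symm.trans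
    (Equiv.prodCongr (Equiv.refl D) e₀)), fun b c => rfl, fun c => rfl⟩

/-- Approximate superadditivity: a block design of size `L` dominates `L / ℓ` decoupled copies of
the block design of size `ℓ`. A row of the former is replaced by the row of the same type of a
copy chosen at random. -/
theorem exists_mul_blockGain_le [Nonempty D] (hp : ∀ a, 0 ≤ p a) (hp1 : ∑ a, p a = 1)
    (x : A → Fin B → ℝ) {J : ρ → D → ℝ} (hJ : ∀ r d, 0 ≤ J r d) {ε : ℝ} (hε : 0 < ε) :
    ∃ K : ℝ, 0 ≤ K ∧ ∀ ℓ m L M : ℕ, 0 < ℓ → 0 < L →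
      (L / ℓ : ℕ) * blockGain x p J ℓ m ≤ blockGain x p J L M + ε * (Fintype.card ρ * M) +
        K * (2 + Fintype.card ρ * (L / ℓ : ℕ)) +
        K * (Fintype.card ρ * M * (ℓ / L) +
          Fintype.card ρ * (L / ℓ : ℕ) * |m - M * (ℓ / L : ℝ)|) := by
  have hS1 : 0 ≤ ∑ r, ∑ d, J r d := Finset.sum_nonneg fun _ _ => Finset.sum_nonneg fun _ _ => hJ _ _
  set κ := Fintype.card D * ∑ r, ∑ d, J r d with hκ
  have hκ0 : 0 ≤ κ := by positivity
  obtain ⟨K, hK0, hK⟩ := exists_gain_comparison A x hκ0 hε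
  refine ⟨K, hK0, fun ℓ m L M hℓ hL => ?_⟩
  have : Nonempty (Fin L) := ⟨⟨0, hL⟩⟩
  have hℓ' : (0 : ℝ) < ℓ := by exact_mod_cast hℓ
  have hL' : (0 : ℝ) < L := by exact_mod_cast hL
  set q := L / ℓ with hq
  obtain ⟨E, hE1, hE2⟩ := exists_blocks_equiv (D := D) (q := q) (ℓ := ℓ) (e := L % ℓ) (L := L)
    (by rw [hq, mul_comm]; exact Nat.div_add_mod L ℓ)
  have hqL : (q : ℝ) * (ℓ / L) ≤ 1 := by
    rw [← mul_div_assoc, div_le_one hL']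
    exact_mod_cast Nat.div_mul_le_self L ℓ
  have hinj : Function.Injective fun c => E (.inl c) := E.injective.comp Sum.inl_injective
  have hinj2 : ∀ b : Fin q, Function.Injective fun c : D × Fin ℓ => (b, c) :=
    fun b c c' h => (Prod.mk.inj h).2
  -- `loc r b` is the row of type `r` of copy `b`, among `q` copies; the sections left over by the
  -- division of `L` by `ℓ` are not measured
  set loc : ρ → Fin q → Fin q × (D × Fin ℓ) → ℝ := fun r b =>
    Function.extend (fun c => (b, c)) (blockRow J ℓ r) 0 with hloc
  have hloc' : ∀ r b b' c, loc r b (b', c) = if b = b' then blockRow J ℓ r c else 0 := by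
    intro r b b' c
    split_ifs with h
    · subst h; exact (hinj2 b).extend_apply _ _ _
    · refine Function.extend_apply' _ _ _ ?_
      rintro ⟨c', hc'⟩
      exact h (Prod.mk.inj hc').1
  set amp : Option (ρ × Fin q) → D × Fin L → ℝ := fun i => i.elim 0 fun i =>
    Function.extend (fun c => E (.inl c)) (loc i.1 i.2) 0 with hamp
  have hamp1 : ∀ i y, amp (some i) (E (.inl y)) = loc i.1 i.2 y := fun i y => hinj.extend_apply _ _ _
  have hamp2 : ∀ i y, amp (some i) (E (.inr y)) = 0 := fun i y => by
    refine Function.extend_apply' _ _ _ ?_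
    rintro ⟨c', hc'⟩
    exact Sum.inl_ne_inr (E.injective hc')
  -- a row is sent to each of the copies with probability `ℓ / L`, and else to the zero row `none`
  set Q : ρ × Fin M → Option (ρ × Fin q) → ℝ := fun μ i =>
    i.elim (1 - q * (ℓ / L)) fun i => if i.1 = μ.1 then (ℓ / L : ℝ) else 0 with hQ
  have hQ1 : ∀ μ, ∑ i, Q μ i = 1 := by
    intro μ
    rw [Fintype.sum_option, Fintype.sum_prod_type_right]
    simp [hQ]
  have h := hK (D × Fin L) (ρ × Fin M) (Option (ρ × Fin q)) (prior (D × Fin L) p)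
    (fun μ => blockRow J L μ.1) Q amp Finset.univ.toList
    ((Finset.univ : Finset ((ρ × Fin m) × Fin q)).toList.map fun t => some (t.1.1, t.2))
    (prior_nonneg hp) (sum_prior hp1) (fun μ c => blockRow_sq_le hJ L μ.1 c)
    (fun μ i => by
      rcases i with _ | i
      · exact sub_nonneg.2 hqL
      · simp only [hQ, Option.elim]
        split_ifs <;> positivity)
    hQ1
    (fun μ c => by
      obtain ⟨y, rfl⟩ := E.surjective c
      rw [Fintype.sum_option, Fintype.sum_prod_type, blockRow_sq hJ]
      have h0 : amp none (E y) = 0 := rfl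
      rw [h0]
      rcases y with ⟨b, c⟩ | c
      · simp only [hamp1, hloc', hE1, hQ, Option.elim, ite_pow, blockRow_sq hJ]
        simp
        field_simp
        exact le_rfl
      · simp only [hamp2]
        have := hJ μ.1 (E (.inr c)).1
        simp; positivity)
    (fun i => by
      rcases i with _ | i
      · simpa [hamp] using hκ0
      · rw [← E.sum_comp, Fintype.sum_sum_type, Fintype.sum_prod_type]
        simp only [hamp1, hamp2, hloc', ite_pow]
        simp only [ne_eq, OfNat.ofNat_ne_zero, not_false_eq_true, zero_pow, Finset.sum_const_zero,
          add_zero]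
        rw [Finset.sum_eq_single i.2 (fun b _ hb => by simp [hb.symm]) (by simp)]
        simp only [if_true]
        rw [sum_blockRow_sq hJ hℓ]
        exact sum_le_card_mul hJ i.1)
  have hgain : gain x (((Finset.univ : Finset ((ρ × Fin m) × Fin q)).toList.map
      fun t => some (t.1.1, t.2)).map amp) (prior (D × Fin L) p) = q * blockGain x p J ℓ m := by
    have e1 : ((Finset.univ : Finset ((ρ × Fin m) × Fin q)).toList.map
        fun t => some (t.1.1, t.2)).map amp =
        ((Finset.univ : Finset ((ρ × Fin m) × Fin q)).toList.map fun t =>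
          Function.extend (fun c => (t.2, c)) (blockRow J ℓ t.1.1) 0).map fun s =>
          Function.extend (fun c => E (.inl c)) s 0 := by
      rw [List.map_map, List.map_map]; rfl
    rw [e1, gain_extend E hp hp1, gain_tensor hp hp1 (fun t : (ρ × Fin m) × Fin q => t.2)
      (fun t => blockRow J ℓ t.1.1)]
    have e2 : ∀ b : Fin q, gain x (((Finset.univ : Finset ((ρ × Fin m) × Fin q)).toList.filter
        fun t => t.2 = b).map fun t => blockRow J ℓ t.1.1) (prior (D × Fin ℓ) p) =
        blockGain x p J ℓ m := by
      intro b
      have := (filter_map_toList_perm (T := ρ × Fin m) b).map fun t => blockRow J ℓ t.1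
      rw [List.map_map] at this
      exact gain_perm this (prior_nonneg hp)
    simp only [e2, Finset.sum_const, Finset.card_univ, Fintype.card_fin, nsmul_eq_mul]
  rw [hgain, Fintype.sum_option, Fintype.sum_prod_type] at h
  -- the bias of the counts: the zero row is not used in the decoupled system, and the other rows
  -- should be drawn `m` times
  have hnone : |(typeCount ((Finset.univ : Finset ((ρ × Fin m) × Fin q)).toList.map
      fun t => some (t.1.1, t.2)) none : ℝ) - meanCount Q Finset.univ.toList none| ≤
      Fintype.card ρ * M * (ℓ / L) := by
    rw [typeCount_map_toList, meanCount_toList, Fintype.sum_prod_type]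
    simp only [reduceCtorEq, if_false, Finset.sum_const_zero, zero_sub, abs_neg, hQ, Option.elim,
      Finset.sum_const, Finset.card_univ, Fintype.card_fin, Fintype.card_prod, nsmul_eq_mul]
    rw [abs_of_nonneg (mul_nonneg (Nat.cast_nonneg _) (sub_nonneg.2 hqL)), Nat.cast_mul]
    refine mul_le_mul_of_nonneg_left ?_ (by positivity)
    have h1 : (L : ℝ) < (q + 1) * ℓ := by
      have h2 : L < (q + 1) * ℓ := by rw [hq, mul_comm]; exact Nat.lt_mul_div_succ L hℓ
      exact_mod_cast h2
    rw [sub_le_iff_le_add, ← one_add_mul, ← mul_div_assoc, le_div_iff₀ hL']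
    linarith
  have hsome : ∀ r b, |(typeCount ((Finset.univ : Finset ((ρ × Fin m) × Fin q)).toList.map
      fun t => some (t.1.1, t.2)) (some (r, b)) : ℝ) -
      meanCount Q Finset.univ.toList (some (r, b))| = |m - M * (ℓ / L : ℝ)| := by
    intro r b
    rw [typeCount_map_toList, meanCount_toList, Fintype.sum_prod_type, Fintype.sum_prod_type_right,
      Fintype.sum_prod_type_right]
    congr 1
    simp [hQ, ite_and, eq_comm]
  simp only [hsome, Finset.sum_const, Finset.card_univ, Fintype.card_fin, Fintype.card_option,
    Fintype.card_prod, nsmul_eq_mul, Finset.length_toList, Nat.cast_mul, Nat.cast_add,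
    Nat.cast_one] at h
  have hn := mul_le_mul_of_nonneg_left hnone hK0
  have hb : blockGain x p J L M = gain x ((Finset.univ : Finset (ρ × Fin M)).toList.map
    fun μ => blockRow J L μ.1) (prior (D × Fin L) p) := rfl
  rw [hb]
  linarith

end Blocks

/-! ### Known sections -/

section Known

variable {A C : Type} [Fintype A] [DecidableEq A] [Fintype C] [DecidableEq C] {B : ℕ}
  {x : A → Fin B → ℝ} {w : (C → A) → ℝ} {h : ((C → A) → ℝ) → ℝ} {k : C → Prop} [DecidablePred k]

/-- Restriction of weights to the configurations with prescribed types of the sections satisfying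
`k`. -/
def restrSet (k : C → Prop) [DecidablePred k] (ρ : {c // k c} → A) (w : (C → A) → ℝ)
    (σ : C → A) : ℝ :=
  if (fun c : {c // k c} => σ c) = ρ then w σ else 0

/-- The row whose entries in the sections satisfying `k` vanish. -/
def mask (k : C → Prop) [DecidablePred k] (s : C → ℝ) (c : C) : ℝ := if k c then 0 else s c

lemma restrSet_nonneg (hw : 0 ≤ w) (ρ : {c // k c} → A) : 0 ≤ restrSet k ρ w := fun σ => by
  unfold restrSet; split_ifs
  · exact hw σ
  · exact le_rfl

lemma sum_restrSet (w : (C → A) → ℝ) : ∑ ρ, ∑ σ, restrSet k ρ w σ = ∑ σ, w σ := by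
  rw [Finset.sum_comm]
  simp [restrSet]

/-- Disclosing the sections satisfying `k` lowers the entropy by the entropy of these sections. -/
lemma eta_eq_sum_restrSet (w : (C → A) → ℝ) : eta w = ∑ ρ, eta (restrSet k ρ w) +
    eta (fun ρ => ∑ σ, restrSet k ρ w σ) := by
  have e : ∑ ρ, ∑ σ, Real.negMulLog (restrSet k ρ w σ) = ∑ σ, Real.negMulLog (w σ) := by
    rw [Finset.sum_comm]
    refine Finset.sum_congr rfl fun σ _ => ?_
    rw [Finset.sum_eq_single (fun c : {c // k c} => σ c)]
    · simp [restrSet]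
    · intro ρ _ hρ; simp [restrSet, hρ.symm]
    · simp
  simp only [eta, Finset.sum_sub_distrib, e, sum_restrSet]
  ring

lemma sum_restrSet_eta_le (hw : 0 ≤ w) : ∑ ρ, eta (restrSet k ρ w) ≤ eta w := by
  have := eta_nonneg (w := fun ρ => ∑ σ, restrSet k ρ w σ)
    fun ρ => Finset.sum_nonneg fun σ _ => restrSet_nonneg hw ρ σ
  rw [eta_eq_sum_restrSet (k := k) w]
  linarith

lemma eta_le_sum_restrSet (hw : 0 ≤ w) : eta w ≤ ∑ ρ, eta (restrSet k ρ w) +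
    Fintype.card {c // k c} * Real.log (Fintype.card A) * ∑ σ, w σ := by
  have := eta_le (w := fun ρ => ∑ σ, restrSet k ρ w σ)
    fun ρ => Finset.sum_nonneg fun σ _ => restrSet_nonneg hw ρ σ
  rw [sum_restrSet, Fintype.card_fun, Nat.cast_pow, Real.log_pow] at this
  rw [eta_eq_sum_restrSet (k := k) w]
  linarith

lemma Adm.sum_restrSet (hh : Adm h) : Adm fun w => ∑ ρ, h (restrSet k ρ w) := by
  refine adm_sum _ fun ρ _ => ?_
  obtain ⟨m, K, hK⟩ := hh
  refine ⟨m.comp (measurable_pi_lambda _ fun σ => ?_), |K|, fun w hw => ?_⟩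
  · unfold restrSet; split_ifs <;> fun_prop
  · refine (hK _ (restrSet_nonneg hw ρ)).trans ?_
    refine mul_le_mul (le_abs_self K) (Finset.sum_le_sum fun σ _ => ?_)
      (Finset.sum_nonneg fun σ _ => restrSet_nonneg hw ρ σ) (abs_nonneg K)
    unfold restrSet; split_ifs
    · exact le_rfl
    · exact hw σ

lemma obsList_sum_restrSet (hh : Adm h) (l : List (C → ℝ)) (hw : 0 ≤ w) :
    obsList x l (fun w => ∑ ρ, h (restrSet k ρ w)) w = ∑ ρ, obsList x l h (restrSet k ρ w) := by
  induction l generalizing w with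
  | nil => rfl
  | cons s l ih =>
    have e : ∀ ρ θ, restrSet k ρ (upd x s w θ) = upd x s (restrSet k ρ w) θ := by
      intro ρ θ; funext σ; simp only [restrSet, upd]; split_ifs <;> simp
    rw [obsList_cons, obs_congr (fun w hw => ih hw) s hw]
    unfold obs
    simp only [e]
    exact integral_finsetSum _ fun ρ _ =>
      (hh.obsList x l).integrable_upd (restrSet_nonneg hw ρ) x s

lemma obsList_eta_smul (l : List (C → ℝ)) (r : ℝ) (w : (C → A) → ℝ) :
    obsList x l eta (fun σ => r * w σ) = r * obsList x l eta w := by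
  induction l generalizing w with
  | nil => exact eta_smul r w
  | cons s l ih =>
    have e : ∀ θ, upd x s (fun σ => r * w σ) θ = fun σ => r * upd x s w θ σ := by
      intro θ; funext σ; simp only [upd]; ring
    rw [obsList_cons]
    simp only [obs, e, ih, integral_const_mul]

lemma integral_lik_mul_sub (G : ℝ → ℝ) (u : ℝ) :
    ∫ y, lik u y * G (y - u) ∂(gaussianReal 0 1) = ∫ y, G y ∂(gaussianReal 0 1) := by
  have h1 := integral_mul_lik (fun y => G (y - u)) u
  simp only [mul_comm (lik u _)]
  have h2 : gaussianReal u 1 = (gaussianReal 0 1).map (MeasurableEquiv.addRight u) := by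
    rw [MeasurableEquiv.coe_addRight, gaussianReal_map_add_const, zero_add]
  rw [h1, h2, (MeasurableEquiv.addRight u).measurableEmbedding.integral_map]
  simp

/-- When the types of some sections are fixed, the entries of a row in these sections only shift
the observation by a known amount, and can be removed. -/
lemma obs_mask (hh : Adm h) (hhom : ∀ (r : ℝ) w, h (fun σ => r * w σ) = r * h w)
    (s : C → ℝ) (hw : 0 ≤ w) (ρ : {c // k c} → A) :
    obs x s h (restrSet k ρ w) = obs x (mask k s) h (restrSet k ρ w) := by
  have hn := restrSet_nonneg (k := k) hw ρ
  have i1 := hh.integrable_upd hn x s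
  have i2 := hh.integrable_upd hn x (mask k s)
  unfold obs rowLaw
  unfold rowLaw at i1 i2
  rw [integral_prod _ i1, integral_prod _ i2]
  refine integral_congr_ae (ae_of_all _ fun g => ?_)
  simp only []
  set K := ∑ c : {c // k c}, ∑ j, g c j * (s c * x (ρ c) j) with hK
  rw [← integral_lik_mul_sub (fun y => h (upd x (mask k s) (restrSet k ρ w) (g, y))) K]
  refine integral_congr_ae (ae_of_all _ fun y => ?_)
  simp only []
  rw [← hhom]
  congr 1
  funext σ
  simp only [upd, restrSet]
  split_ifs with hσ
  · have e : coup x s g σ = coup x (mask k s) g σ + K := by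
      have h1 : K = ∑ c, if k c then ∑ j, g c j * (s c * x (σ c) j) else 0 := by
        rw [← Finset.sum_filter, hK, ← hσ]
        exact (Finset.sum_subtype _ (by simp) fun c => ∑ j, g c j * (s c * x (σ c) j)).symm
      rw [h1, coup, coup, pair, pair, ← Finset.sum_add_distrib]
      refine Finset.sum_congr rfl fun c _ => ?_
      simp only [mask]
      split_ifs <;> simp
    rw [e]
    have e2 : ∀ a, lik (a + K) y = lik K y * lik a (y - K) := fun a => by
      simp only [lik, ← Real.exp_add]; congr 1; ring
    rw [e2]; ring
  · simp

lemma obsList_mask (l : List (C → ℝ)) (hw : 0 ≤ w) (ρ : {c // k c} → A) :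
    obsList x l eta (restrSet k ρ w) = obsList x (l.map (mask k)) eta (restrSet k ρ w) := by
  induction l generalizing w with
  | nil => rfl
  | cons s l ih =>
    have e : ∀ s θ, upd x s (restrSet k ρ w) θ = restrSet k ρ (upd x s w θ) := by
      intro s θ; funext σ; simp only [restrSet, upd]; split_ifs <;> simp
    rw [List.map_cons, obsList_cons, obsList_cons,
      obs_mask (adm_eta.obsList x l) (obsList_eta_smul l) s hw]
    unfold obs
    refine integral_congr_ae (ae_of_all _ fun θ => ?_)
    simp only [e]
    exact ih (upd_nonneg hw x _ θ)

/-- Deleting the entries of the rows in some sections loses at most twice the maximal entropy of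
these sections. -/
theorem gain_le_gain_mask (k : C → Prop) [DecidablePred k] (l : List (C → ℝ)) (hw : 0 ≤ w)
    (h1 : ∑ σ, w σ = 1) :
    gain x l w ≤ gain x (l.map (mask k)) w +
      2 * (Fintype.card {c // k c} * Real.log (Fintype.card A)) := by
  have hA : Adm fun w : (C → A) → ℝ => ∑ ρ, eta (restrSet k ρ w) := adm_eta.sum_restrSet
  have a1 := obsList_mono (x := x) hA adm_eta (fun w hw => sum_restrSet_eta_le hw) l hw
  have a2 := obsList_mono (x := x) adm_eta (hA.add (adm_mass.const_mul _))
    (fun w hw => eta_le_sum_restrSet (k := k) hw) (l.map (mask k)) hw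
  rw [obsList_add hA (adm_mass.const_mul _) _ hw, obsList_mass _ hw, h1, mul_one] at a2
  rw [obsList_sum_restrSet adm_eta _ hw] at a1 a2
  simp only [obsList_mask l hw] at a1
  have hlog : 0 ≤ Fintype.card {c // k c} * Real.log (Fintype.card A) :=
    mul_nonneg (Nat.cast_nonneg _) (Real.log_natCast_nonneg _)
  unfold gain
  linarith

variable {R : Type} [Fintype R]

/-- The mutual information is the gain of the rows deprived of their entries in the known
sections. -/
theorem card_mul_mutualInfo_eq_gain_mask [Nonempty C] (P : DiscretePrior B) {Δ : ℝ} (hΔ : 0 < Δ)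
    (V : R → C → ℝ≥0) (known : C → Prop) [DecidablePred known] :
    Fintype.card C * mutualInfo P Δ V known =
      gain (fun j i => P.a j i / √Δ)
        (Finset.univ.toList.map fun μ => mask known fun c => √(V μ c))
        (prior C fun j => (P.p j : ℝ)) := by
  let E : {c // ¬ known c} ⊕ {c // known c} ≃ C := (Equiv.sumComm _ _).trans (Equiv.sumCompl known)
  have hE1 : ∀ c, E (.inl c) = c.1 := fun c => rfl
  have hE2 : ∀ c, E (.inr c) = c.1 := fun c => rfl
  rw [card_mul_mutualInfo P hΔ V known E (fun c => c.2) (fun c => c.2),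
    ← gain_extend E (fun _ => NNReal.coe_nonneg _) (by exact_mod_cast P.sum_p), List.map_map]
  congr 2
  funext μ c
  have hinj : Function.Injective fun c => E (.inl c) := E.injective.comp Sum.inl_injective
  simp only [Function.comp, mask]
  split_ifs with hc
  · refine Function.extend_apply' _ _ _ ?_
    rintro ⟨a, ha⟩
    exact a.2 (by rw [← hE1 a]; exact ha ▸ hc)
  · exact hinj.extend_apply (fun c => √(V μ (E (.inl c)))) 0 ⟨c, hc⟩

end Known

/-! ### Variance profiles of the coupled models -/

section Profiles

variable {Γ w : ℕ}

lemma blockDist_comm (r c : Fin Γ) : blockDist r c = blockDist c r := by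
  unfold blockDist; omega

lemma card_window (h : 2 * w + 1 ≤ Γ) (r : Fin Γ) :
    (Finset.univ.filter fun c : Fin Γ => blockDist r c ≤ w ∨ Γ - blockDist r c ≤ w).card =
      2 * w + 1 := by
  rw [← Finset.card_range (2 * w + 1)]
  have hr := r.2
  -- the window around `r` is enumerated from its leftmost element, cyclically
  refine Finset.card_bij
    (fun c _ => if (c : ℕ) + w < r then c + w + Γ - r else if (c : ℕ) + w - r ≤ 2 * w then
      c + w - r else c + w - r - Γ) ?_ ?_ ?_
  · intro c hc
    have hc2 := c.2
    have hc3 := (Finset.mem_filter.1 hc).2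
    unfold blockDist at hc3
    rw [Finset.mem_range]
    split_ifs <;> omega
  · intro c hc c' hc' hcc
    have hc2 := c.2
    have hc2' := c'.2
    have hc3 := (Finset.mem_filter.1 hc).2
    have hc3' := (Finset.mem_filter.1 hc').2
    unfold blockDist at hc3 hc3'
    apply Fin.ext
    split_ifs at hcc <;> omega
  · intro j hj
    rw [Finset.mem_range] at hj
    obtain ⟨i, hi, hij⟩ : ∃ i, i < Γ ∧ (i + w = r + j + Γ ∨ i + w = r + j ∨ i + w + Γ = r + j) := by
      by_cases h1 : (r : ℕ) + j < w
      · exact ⟨r + j + Γ - w, by omega, by omega⟩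
      by_cases h2 : (r : ℕ) + j - w < Γ
      · exact ⟨r + j - w, by omega, by omega⟩
      · exact ⟨r + j - w - Γ, by omega, by omega⟩
    refine ⟨⟨i, hi⟩, Finset.mem_filter.2 ⟨Finset.mem_univ _, ?_⟩, ?_⟩
    · unfold blockDist
      dsimp only
      omega
    · dsimp only
      split_ifs <;> omega

lemma Jper_comm (r c : Fin Γ) : Jper Γ w r c = Jper Γ w c r := by
  unfold Jper; rw [blockDist_comm]

lemma sum_Jper (h : 2 * w + 1 ≤ Γ) (r : Fin Γ) : ∑ c, (Jper Γ w r c : ℝ) / Γ = 1 := by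
  have hΓ : (Γ : ℝ) ≠ 0 := by
    have : Γ ≠ 0 := by omega
    exact_mod_cast this
  have e : ∀ c, (Jper Γ w r c : ℝ) / Γ =
      if blockDist r c ≤ w ∨ Γ - blockDist r c ≤ w then ((2 * w + 1 : ℕ) : ℝ)⁻¹ else 0 := by
    intro c
    unfold Jper
    split_ifs
    · push_cast; field_simp
    · simp
  simp only [e]
  rw [← Finset.sum_filter, Finset.sum_const, card_window h, nsmul_eq_mul,
    mul_inv_cancel₀ (by positivity)]

/-- On the columns of the unknown blocks the open and periodic profiles agree: the windows which
meet them are cut neither by the boundaries nor by the periodicity. -/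
lemma Jopen_eq_Jper (h : 2 * w + 1 ≤ Γ) (r c : Fin Γ) (hc : ¬ IsBoundary w c) :
    Jopen Γ w r c = Jper Γ w r c := by
  have hr := r.2
  have hc2 := c.2
  unfold IsBoundary at hc
  unfold Jopen Jper
  by_cases hd : blockDist r c ≤ w
  · rw [if_pos hd, if_pos (Or.inl hd)]
    have e : (Finset.univ.filter fun c' : Fin Γ => blockDist r c' ≤ w) =
        Finset.univ.filter fun c' : Fin Γ => blockDist r c' ≤ w ∨ Γ - blockDist r c' ≤ w := by
      refine Finset.filter_congr fun c' _ => ?_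
      have := c'.2
      unfold blockDist at hd ⊢
      omega
    rw [e, card_window h]
    push_cast
    rfl
  · rw [if_neg hd, if_neg]
    unfold blockDist at hd ⊢
    omega

lemma card_boundary_le : Fintype.card {c : Fin Γ // IsBoundary w c} ≤ 8 * w := by
  rw [Fintype.card_subtype, ← Finset.card_range (8 * w)]
  refine Finset.card_le_card_of_injOn
    (fun c => if (c : ℕ) < 4 * w then c else c + 8 * w - Γ) ?_ ?_
  · intro c hc
    have := c.2
    have hc2 := (Finset.mem_filter.1 (Finset.mem_coe.1 hc)).2
    unfold IsBoundary at hc2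
    refine Finset.mem_coe.2 (Finset.mem_range.2 ?_)
    dsimp only
    split_ifs <;> omega
  · intro c hc c' hc' hcc
    have := c.2
    have := c'.2
    have hc2 := (Finset.mem_filter.1 (Finset.mem_coe.1 hc)).2
    have hc2' := (Finset.mem_filter.1 (Finset.mem_coe.1 hc')).2
    unfold IsBoundary at hc2 hc2'
    apply Fin.ext
    dsimp only at hcc
    split_ifs at hcc <;> omega

lemma card_boundary_sections_le (ℓ : ℕ) :
    Fintype.card {c : Fin Γ × Fin ℓ // IsBoundary w c.1} ≤ 8 * w * ℓ := by
  have e : {c : Fin Γ × Fin ℓ // IsBoundary w c.1} ≃ {c : Fin Γ // IsBoundary w c} × Fin ℓ :=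
    ⟨fun c => (⟨c.1.1, c.2⟩, c.1.2), fun c => ⟨(c.1.1, c.2), c.1.2⟩, fun _ => rfl, fun _ => rfl⟩
  rw [Fintype.card_congr e, Fintype.card_prod, Fintype.card_fin]
  exact Nat.mul_le_mul_right _ card_boundary_le

end Profiles

/-! ### The three models as block designs -/

section Models

variable {B : ℕ} (P : DiscretePrior B) {Δ : ℝ}

lemma mul_miCS (hΔ : 0 < Δ) {L : ℕ} (hL : 0 < L) (M : ℕ) {C : Type} [Fintype C] [DecidableEq C]
    (e : C ≃ Fin L) : L * miCS P Δ L M = gain (fun k j => P.a k j / √Δ)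
      (List.replicate M fun _ => √(1 / L)) (prior C fun k => (P.p k : ℝ)) := by
  have : Nonempty (Fin L) := ⟨⟨0, hL⟩⟩
  have h := card_mul_mutualInfo P hΔ (R := Fin M) (C := Fin L) (D := Empty)
    (fun _ _ => 1 / (L : ℝ≥0)) (fun _ => False) ((Equiv.sumEmpty C Empty).trans e) (fun _ => id)
    (fun d => d.elim)
  rw [Fintype.card_fin] at h
  rw [miCS, h, List.map_const', Finset.length_toList, Finset.card_univ, Fintype.card_fin]
  simp

lemma mul_miPer (hΔ : 0 < Δ) {Γ : ℕ} (hΓ : 0 < Γ) (w : ℕ) {ℓ : ℕ} (hℓ : 0 < ℓ) (m : ℕ) :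
    (Γ * ℓ : ℝ) * miPer P Δ Γ w ℓ m = blockGain (fun k j => P.a k j / √Δ) (fun k => (P.p k : ℝ))
      (fun r c => (Jper Γ w r c : ℝ) / Γ) ℓ m := by
  have : Nonempty (Fin Γ) := ⟨⟨0, hΓ⟩⟩
  have : Nonempty (Fin ℓ) := ⟨⟨0, hℓ⟩⟩
  have h := card_mul_mutualInfo_eq_gain_mask P hΔ (blockVariance (Jper Γ w) ℓ m) (fun _ => False)
  rw [Fintype.card_prod, Fintype.card_fin, Fintype.card_fin, Nat.cast_mul] at h
  rw [miPer, h, blockGain]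
  congr 2
  funext μ c
  simp [mask, blockRow, blockVariance, div_div]

lemma mul_miSeed (hΔ : 0 < Δ) {Γ w : ℕ} (hw : 2 * w + 1 ≤ Γ) {ℓ : ℕ} (hℓ : 0 < ℓ) (m : ℕ) :
    (Γ * ℓ : ℝ) * miSeed P Δ Γ w ℓ m = gain (fun k j => P.a k j / √Δ)
      ((Finset.univ : Finset (Fin Γ × Fin m)).toList.map fun μ => mask (fun c => IsBoundary w c.1)
        (blockRow (fun r c => (Jper Γ w r c : ℝ) / Γ) ℓ μ.1))
      (prior (Fin Γ × Fin ℓ) fun k => (P.p k : ℝ)) := by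
  have : Nonempty (Fin Γ) := ⟨⟨0, by omega⟩⟩
  have : Nonempty (Fin ℓ) := ⟨⟨0, hℓ⟩⟩
  have h := card_mul_mutualInfo_eq_gain_mask P hΔ (blockVariance (Jopen Γ w) ℓ m)
    (fun c => IsBoundary w c.1)
  rw [Fintype.card_prod, Fintype.card_fin, Fintype.card_fin, Nat.cast_mul] at h
  rw [miSeed, h]
  congr 2
  funext μ c
  simp only [mask]
  split_ifs with hc
  · rfl
  · simp [blockRow, blockVariance, div_div, Jopen_eq_Jper hw _ _ hc]

variable {A ρ D : Type} [Fintype A] [DecidableEq A] [Fintype ρ] [DecidableEq ρ] [Fintype D]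
  [DecidableEq D] {x : A → Fin B → ℝ} {p : A → ℝ}

lemma blockGain_const (v : ℝ) (ℓ m : ℕ) : blockGain x p (fun (_ : ρ) (_ : D) => v) ℓ m =
    gain x (List.replicate (Fintype.card ρ * m) fun _ => √(v / ℓ)) (prior (D × Fin ℓ) p) := by
  unfold blockGain blockRow
  rw [List.map_const', Finset.length_toList, Finset.card_univ, Fintype.card_prod, Fintype.card_fin]

lemma gain_map_mask_blockRow (J : ρ → D → ℝ) (k : D → Prop) [DecidablePred k] (ℓ m : ℕ) :
    gain x ((Finset.univ : Finset (ρ × Fin m)).toList.map fun μ => mask (fun c => k c.1)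
      (blockRow J ℓ μ.1)) (prior (D × Fin ℓ) p) =
      blockGain x p (fun r d => if k d then 0 else J r d) ℓ m := by
  unfold blockGain
  congr 2
  funext μ c
  simp only [mask, blockRow]
  split_ifs <;> simp

/-- The block design with diagonal profile consists of independent copies of an uncoupled one. -/
lemma blockGain_diagonal (hp : ∀ a, 0 ≤ p a) (hp1 : ∑ a, p a = 1) (ℓ m : ℕ) :
    blockGain x p (fun d d' : D => if d = d' then 1 else 0) ℓ m = Fintype.card D *
      gain x (List.replicate m fun _ => √(1 / ℓ)) (prior (Fin ℓ) p) := by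
  have e : ∀ d : D, blockRow (fun d d' : D => if d = d' then 1 else 0) ℓ d =
      Function.extend (fun i => (d, i)) (fun _ : Fin ℓ => √(1 / ℓ)) 0 := by
    intro d
    have hinj : Function.Injective fun i : Fin ℓ => (d, i) := fun i i' h => (Prod.mk.inj h).2
    funext c
    obtain ⟨d', i⟩ := c
    unfold blockRow
    by_cases h : d = d'
    · subst h
      rw [hinj.extend_apply (fun _ : Fin ℓ => √(1 / ℓ)) 0 i]
      simp
    · rw [Function.extend_apply']
      · simp [h]
      · rintro ⟨i', hi'⟩
        exact h (Prod.mk.inj hi').1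
  unfold blockGain
  simp only [e]
  rw [gain_tensor hp hp1 (fun μ : D × Fin m => μ.1) (fun _ _ => √(1 / ℓ))]
  have hlen : ∀ d : D, ((Finset.univ : Finset (D × Fin m)).toList.filter fun μ => μ.1 = d).length
      = m := by
    intro d
    have h1 := typeCount_map_toList (fun μ : D × Fin m => μ.1) d
    rw [Fintype.sum_prod_type_right] at h1
    simp only [Finset.sum_ite_eq', Finset.mem_univ, if_true, Finset.sum_const, Finset.card_univ,
      Fintype.card_fin, nsmul_eq_mul, mul_one, Nat.cast_inj] at h1
    rw [typeCount, List.count, List.countP_map, List.countP_eq_length_filter] at h1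
    refine Eq.trans ?_ h1
    congr 2
  simp only [List.map_const', hlen, Finset.sum_const, Finset.card_univ, nsmul_eq_mul]

end Models

/-! ### The thermodynamic limit -/

section Limit

variable {B : ℕ} {α : ℝ}

lemma tendsto_ratio (hB : 0 < B) : Tendsto (fun q : ℕ × ℕ => (q.2 : ℝ) / q.1)
    (thermodynamicLimit B α) (𝓝 (α * B)) := by
  have h : Tendsto (fun q : ℕ × ℕ => (q.2 : ℝ) / (q.1 * B)) (thermodynamicLimit B α) (𝓝 α) :=
    tendsto_comap.mono_left inf_le_right
  refine (h.mul_const (B : ℝ)).congr fun q => ?_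
  have : (B : ℝ) ≠ 0 := by positivity
  field_simp

lemma tendsto_size : Tendsto (fun q : ℕ × ℕ => q.1) (thermodynamicLimit B α) atTop :=
  tendsto_comap.mono_left inf_le_left

lemma tendsto_inv_size (K : ℝ) : Tendsto (fun q : ℕ × ℕ => K / (q.1 : ℝ))
    (thermodynamicLimit B α) (𝓝 0) :=
  (tendsto_const_div_atTop_nhds_zero_nat K).comp tendsto_size

lemma eventually_size_pos : ∀ᶠ q : ℕ × ℕ in thermodynamicLimit B α, 0 < q.1 :=
  tendsto_size.eventually (eventually_gt_atTop 0)

lemma tendsto_scale {Γ : ℕ} (hΓ : 0 < Γ) : Tendsto (fun q : ℕ × ℕ => (Γ * q.1, Γ * q.2))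
    (thermodynamicLimit B α) (thermodynamicLimit B α) := by
  refine tendsto_inf.2 ⟨tendsto_comap_iff.2 ?_, tendsto_comap_iff.2 ?_⟩
  · exact tendsto_size.const_mul_atTop' hΓ
  · have h : Tendsto (fun q : ℕ × ℕ => (q.2 : ℝ) / (q.1 * B)) (thermodynamicLimit B α) (𝓝 α) :=
      tendsto_comap.mono_left inf_le_right
    refine h.congr fun q => ?_
    have : (Γ : ℝ) ≠ 0 := by positivity
    simp only [Function.comp, Nat.cast_mul, mul_assoc]
    rw [mul_div_mul_left _ _ this]

lemma thermodynamicLimit_neBot (hB : 0 < B) (hα : 0 < α) : (thermodynamicLimit B α).NeBot := by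
  have hB' : (B : ℝ) ≠ 0 := by positivity
  have h : Tendsto (fun n : ℕ => (n, ⌊α * B * n⌋₊)) atTop (thermodynamicLimit B α) := by
    refine tendsto_inf.2 ⟨tendsto_comap_iff.2 tendsto_id, tendsto_comap_iff.2 ?_⟩
    have h1 := ((tendsto_nat_floor_mul_div_atTop (R := ℝ) (a := α * B) (by positivity)).comp
      tendsto_natCast_atTop_atTop).div_const (B : ℝ)
    rw [mul_div_cancel_right₀ _ hB'] at h1
    refine h1.congr fun n => ?_
    simp only [Function.comp, div_div]
  exact h.neBot

/-- A bounded function which is almost nondecreasing along a filter converges. -/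
lemma exists_tendsto_of_almost_mono {T : Type*} {F : Filter T} [F.NeBot] {f : T → ℝ} {b : ℝ}
    (h0 : ∀ᶠ q in F, 0 ≤ f q) (hb : ∀ᶠ q in F, f q ≤ b)
    (h : ∀ η > 0, ∀ᶠ q in F, ∀ᶠ q' in F, f q ≤ f q' + η) : ∃ i, Tendsto f F (𝓝 i) := by
  have hbl : F.IsBoundedUnder (· ≥ ·) f := ⟨0, by simpa using h0⟩
  have hbu : F.IsBoundedUnder (· ≤ ·) f := ⟨b, by simpa using hb⟩
  have hle : limsup f F ≤ liminf f F := by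
    refine le_of_forall_pos_le_add fun η hη => ?_
    refine limsup_le_of_le hbl.isCoboundedUnder_le ((h η hη).mono fun q hq => ?_)
    have : f q - η ≤ liminf f F :=
      le_liminf_of_le hbu.isCoboundedUnder_ge (hq.mono fun q' hq' => by linarith)
    linarith
  exact ⟨liminf f F, tendsto_of_le_liminf_of_limsup_le le_rfl hle hbu hbl⟩

/-- If `f` dominates `g` up to an error which is small compared to the number of rows, then its
limit dominates that of `g`. -/
lemma le_of_tendsto_of_le [(thermodynamicLimit B α).NeBot] (hB : 0 < B) {f g : ℕ × ℕ → ℝ}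
    {i j : ℝ} (hf : Tendsto f (thermodynamicLimit B α) (𝓝 i))
    (hg : Tendsto g (thermodynamicLimit B α) (𝓝 j))
    (h : ∀ ε > 0, ∃ K : ℝ, ∀ᶠ q : ℕ × ℕ in thermodynamicLimit B α,
      g q ≤ f q + ε * ((q.2 : ℝ) / q.1) + K / q.1) : j ≤ i := by
  have key : ∀ ε > 0, j ≤ i + ε * (α * B) := by
    intro ε hε
    obtain ⟨K, hK⟩ := h ε hε
    have := (hf.add ((tendsto_ratio hB).const_mul ε)).add (tendsto_inv_size (B := B) (α := α) K)
    rw [add_zero] at this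
    exact le_of_tendsto_of_tendsto hg this hK
  have h1 : Tendsto (fun ε : ℝ => i + ε * (α * B)) (𝓝[>] 0) (𝓝 (i + 0 * (α * B))) :=
    tendsto_nhdsWithin_of_tendsto_nhds (Continuous.tendsto (by fun_prop) 0)
  rw [zero_mul, add_zero] at h1
  exact ge_of_tendsto h1 (eventually_nhdsWithin_of_forall fun ε hε => key ε hε)

lemma tendsto_of_le_of_le [(thermodynamicLimit B α).NeBot] (hB : 0 < B) {f g g' : ℕ × ℕ → ℝ}
    {i : ℝ} (hg : Tendsto g (thermodynamicLimit B α) (𝓝 i))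
    (hg' : Tendsto g' (thermodynamicLimit B α) (𝓝 i))
    (h : ∀ ε > 0, ∃ K : ℝ, ∀ᶠ q : ℕ × ℕ in thermodynamicLimit B α,
      g q ≤ f q + ε * ((q.2 : ℝ) / q.1) + K / q.1)
    (h' : ∀ ε > 0, ∃ K : ℝ, ∀ᶠ q : ℕ × ℕ in thermodynamicLimit B α,
      f q ≤ g' q + ε * ((q.2 : ℝ) / q.1) + K / q.1) :
    Tendsto f (thermodynamicLimit B α) (𝓝 i) := by
  have hsmall : ∀ η > 0, ∃ ε > 0, ∀ K : ℝ, ∀ᶠ q : ℕ × ℕ in thermodynamicLimit B α,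
      ε * ((q.2 : ℝ) / q.1) + K / q.1 < η := by
    intro η hη
    have hpos : 0 < |α * B| + 1 := by positivity
    refine ⟨η / (|α * B| + 1), by positivity, fun K => ?_⟩
    have h1 := ((tendsto_ratio (α := α) hB).const_mul (η / (|α * B| + 1))).add
      (tendsto_inv_size (B := B) (α := α) K)
    refine h1.eventually_lt_const ?_
    rw [add_zero, div_mul_eq_mul_div, div_lt_iff₀ hpos]
    nlinarith [le_abs_self (α * B)]
  refine tendsto_order.2 ⟨fun a ha => ?_, fun a ha => ?_⟩
  · obtain ⟨ε, hε, hs⟩ := hsmall ((i - a) / 2) (by linarith)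
    obtain ⟨K, hK⟩ := h ε hε
    filter_upwards [hK, hs K, (tendsto_order.1 hg).1 ((i + a) / 2) (by linarith)] with q h1 h2 h3
    linarith
  · obtain ⟨ε, hε, hs⟩ := hsmall ((a - i) / 2) (by linarith)
    obtain ⟨K, hK⟩ := h' ε hε
    filter_upwards [hK, hs K, (tendsto_order.1 hg').2 ((i + a) / 2) (by linarith)] with q h1 h2 h3
    linarith

variable {A ρ D : Type} [Fintype A] [DecidableEq A] [Fintype ρ] [DecidableEq ρ] [Fintype D]
  [DecidableEq D] {x : A → Fin B → ℝ} {p : A → ℝ}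

/-- The gain per section of a block design converges, by approximate superadditivity. -/
theorem exists_tendsto_blockGain [Nonempty D] [(thermodynamicLimit B α).NeBot] (hB : 0 < B)
    (hα : 0 < α) (hp : ∀ a, 0 ≤ p a) (hp1 : ∑ a, p a = 1) {J : ρ → D → ℝ}
    (hJ : ∀ r d, 0 ≤ J r d) :
    ∃ i, Tendsto (fun q : ℕ × ℕ => blockGain x p J q.1 q.2 / q.1) (thermodynamicLimit B α)
      (𝓝 i) := by
  set b := Fintype.card D * Real.log (Fintype.card A) with hb
  have hb0 : 0 ≤ b := mul_nonneg (Nat.cast_nonneg _) (Real.log_natCast_nonneg _)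
  refine exists_tendsto_of_almost_mono (b := b)
    (Eventually.of_forall fun q => div_nonneg (blockGain_nonneg hp J _ _) (Nat.cast_nonneg _))
    (Eventually.of_forall fun q => div_le_of_le_mul₀ (Nat.cast_nonneg _) hb0
      ((blockGain_le hp hp1 J _ _).trans_eq (mul_comm _ _))) fun η hη => ?_
  set n := (Fintype.card ρ : ℝ) with hn
  have hn0 : 0 ≤ n := Nat.cast_nonneg _
  set a := α * B with ha
  have ha0 : 0 < a := by positivity
  obtain ⟨ε, hε, hεη⟩ : ∃ ε > 0, ε * n * a < η := by
    refine ⟨η / (n * a + 1), by positivity, ?_⟩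
    rw [mul_assoc, div_mul_eq_mul_div, div_lt_iff₀ (by positivity)]
    nlinarith
  obtain ⟨K, hK0, hK⟩ := exists_mul_blockGain_le hp hp1 x hJ hε
  have hr : Tendsto (fun q : ℕ × ℕ => (q.2 : ℝ) / q.1) (thermodynamicLimit B α) (𝓝 a) :=
    tendsto_ratio hB
  -- the limit of the error term as the larger size tends to infinity
  have hlim : Tendsto (fun q : ℕ × ℕ => ε * n * a + K * n / q.1 + K * n * |(q.2 : ℝ) / q.1 - a|)
      (thermodynamicLimit B α) (𝓝 (ε * n * a + 0 + K * n * |a - a|)) :=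
    (tendsto_const_nhds.add (tendsto_inv_size _)).add ((hr.sub_const a).abs.const_mul _)
  rw [sub_self, abs_zero, mul_zero, add_zero, add_zero] at hlim
  filter_upwards [hlim.eventually_lt_const hεη, eventually_size_pos] with q hq hq0
  obtain ⟨ℓ, m⟩ := q
  simp only at hq hq0 ⊢
  have hℓ : (0 : ℝ) < ℓ := by exact_mod_cast hq0
  have hlim2 : Tendsto (fun q : ℕ × ℕ => ε * n * ((q.2 : ℝ) / q.1) + 2 * K / q.1 + K * n / ℓ +
      K * n * ((q.2 : ℝ) / q.1) * (ℓ / q.1) + K * n * |(m : ℝ) / ℓ - q.2 / q.1| + ℓ * b / q.1)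
      (thermodynamicLimit B α) (𝓝 (ε * n * a + 0 + K * n / ℓ + K * n * a * 0 +
        K * n * |(m : ℝ) / ℓ - a| + 0)) :=
    (((((hr.const_mul _).add (tendsto_inv_size _)).add_const _).add
      ((hr.const_mul _).mul (tendsto_inv_size _))).add
      ((hr.const_sub _).abs.const_mul _)).add (tendsto_inv_size _)
  have hlt : ε * n * a + 0 + K * n / ℓ + K * n * a * 0 + K * n * |(m : ℝ) / ℓ - a| + 0 < η := by
    simpa using hq
  filter_upwards [hlim2.eventually_lt_const hlt, eventually_size_pos] with q hq hL0
  obtain ⟨L, M⟩ := q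
  simp only at hq hL0 ⊢
  have hL : (0 : ℝ) < L := by exact_mod_cast hL0
  have h1 := hK ℓ m L M hq0 hL0
  set Q := ((L / ℓ : ℕ) : ℝ) with hQ
  have hQ0 : 0 ≤ Q := Nat.cast_nonneg _
  have hQ1 : Q * ℓ ≤ L := by rw [hQ]; exact_mod_cast Nat.div_mul_le_self L ℓ
  have hQ2 : (L : ℝ) ≤ (Q + 1) * ℓ := by
    have : L < (L / ℓ + 1) * ℓ := by rw [mul_comm]; exact Nat.lt_mul_div_succ L hq0
    rw [hQ]
    exact_mod_cast this.le
  set G := blockGain x p J ℓ m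
  set G' := blockGain x p J L M
  have hG0 : 0 ≤ G := blockGain_nonneg hp J _ _
  have hGb : G ≤ ℓ * b := blockGain_le hp hp1 J _ _
  have h2 : G / ℓ ≤ (Q * G + ℓ * b) / L := by
    rw [div_le_div_iff₀ hℓ hL]
    nlinarith
  have h3 : n * Q * |(m : ℝ) - M * (ℓ / L)| ≤ L * (n * |(m : ℝ) / ℓ - M / L|) := by
    have e : (m : ℝ) - M * (ℓ / L) = ℓ * ((m : ℝ) / ℓ - M / L) := by field_simp
    rw [e, abs_mul, abs_of_pos hℓ]
    have := mul_le_mul_of_nonneg_right hQ1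
      (mul_nonneg hn0 (abs_nonneg ((m : ℝ) / ℓ - M / L)))
    linarith
  have h4 : n * Q ≤ L * (n / ℓ) := by
    rw [← mul_div_assoc, le_div_iff₀ hℓ]
    nlinarith
  have h5 : (Q * G + ℓ * b) / L ≤ G' / L + (ε * n * ((M : ℝ) / L) + 2 * K / L + K * n / ℓ +
      K * n * ((M : ℝ) / L) * (ℓ / L) + K * n * |(m : ℝ) / ℓ - M / L| + ℓ * b / L) := by
    rw [div_le_iff₀ hL]
    have e : (G' / L + (ε * n * ((M : ℝ) / L) + 2 * K / L + K * n / ℓ +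
      K * n * ((M : ℝ) / L) * (ℓ / L) + K * n * |(m : ℝ) / ℓ - M / L| + ℓ * b / L)) * L =
      G' + ε * (n * M) + K * (2 + L * (n / ℓ)) + K * (n * M * (ℓ / L) +
        L * (n * |(m : ℝ) / ℓ - M / L|)) + ℓ * b := by
      generalize |(m : ℝ) / ℓ - M / L| = δ
      field_simp
      ring
    rw [e]
    have h6 := mul_le_mul_of_nonneg_left h3 hK0
    have h7 := mul_le_mul_of_nonneg_left h4 hK0
    linarith
  linarith

end Limit

/-! ### Comparison of the models -/

section Comparison

variable {B : ℕ} (P : DiscretePrior B) {Δ α : ℝ}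

lemma two_mul_add_one_le {Γ w : ℕ} (hΓ : Odd Γ) (hw : w ≤ (Γ - 1) / 2) : 2 * w + 1 ≤ Γ := by
  have := hΓ.pos
  omega

lemma sum_weights_eq_one : ∑ k, (P.p k : ℝ) = 1 := by exact_mod_cast P.sum_p

lemma sum_Jper_column {Γ w : ℕ} (h : 2 * w + 1 ≤ Γ) (c : Fin Γ) :
    ∑ r, (Jper Γ w r c : ℝ) / Γ = 1 := by
  simp_rw [Jper_comm _ c]
  exact sum_Jper h c

/-- Division of a comparison of gains of systems with `Γ * ℓ` sections by the number of
sections. -/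
lemma le_of_mul_size_le {Γ ℓ m : ℕ} (hΓ : 0 < Γ) (hℓ : 0 < ℓ) {a b ε K : ℝ}
    (h : (Γ * ℓ : ℝ) * a ≤ (Γ * ℓ : ℝ) * b + ε * (Γ * m) + K) :
    a ≤ b + ε * ((m : ℝ) / ℓ) + (K / Γ) / ℓ := by
  have h1 : (0 : ℝ) < Γ := by exact_mod_cast hΓ
  have h2 : (0 : ℝ) < ℓ := by exact_mod_cast hℓ
  refine le_of_mul_le_mul_left (h.trans_eq ?_) (mul_pos h1 h2)
  field_simp

lemma exists_tendsto_miCS [(thermodynamicLimit B α).NeBot] (hB : 0 < B) (hα : 0 < α)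
    (hΔ : 0 < Δ) : ∃ i, Tendsto (fun q : ℕ × ℕ => miCS P Δ q.1 q.2) (thermodynamicLimit B α)
      (𝓝 i) := by
  obtain ⟨i, hi⟩ := exists_tendsto_blockGain (α := α) (x := fun k j => P.a k j / √Δ)
    (p := fun k => (P.p k : ℝ)) (J := fun (_ _ : Fin 1) => 1) hB hα (fun k => (P.p k).2)
    (sum_weights_eq_one P) (fun _ _ => zero_le_one)
  refine ⟨i, hi.congr' ?_⟩
  filter_upwards [eventually_size_pos] with q hq
  have hq' : (q.1 : ℝ) ≠ 0 := by exact_mod_cast hq.ne'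
  rw [blockGain_const, Fintype.card_fin, one_mul,
    ← mul_miCS P hΔ hq q.2 (Equiv.uniqueProd (Fin q.1) (Fin 1)), mul_div_cancel_left₀ _ hq']

/-- Each row of the uncoupled system is replaced by a row of the periodic system with a uniformly
random block-index. This preserves the average variances, since the columns of the periodic
variance profile all have the same sum. -/
lemma exists_miPer_le (hΔ : 0 < Δ) {Γ w : ℕ} (hw : 2 * w + 1 ≤ Γ) {ε : ℝ} (hε : 0 < ε) :
    ∃ K : ℝ, ∀ ℓ m : ℕ, 0 < ℓ →
      miPer P Δ Γ w ℓ m ≤ miCS P Δ (Γ * ℓ) (Γ * m) + ε * ((m : ℝ) / ℓ) + K / ℓ := by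
  have hΓ : 0 < Γ := by omega
  have hΓ' : (Γ : ℝ) ≠ 0 := by exact_mod_cast hΓ.ne'
  have : Nonempty (Fin Γ) := ⟨⟨0, hΓ⟩⟩
  obtain ⟨K, hK⟩ := exists_blockGain_le (p := fun k => (P.p k : ℝ)) (fun k => (P.p k).2)
    (sum_weights_eq_one P) (fun k j => P.a k j / √Δ)
    (J := fun (_ _ : Fin Γ) => 1 / (Γ : ℝ)) (J' := fun r c => (Jper Γ w r c : ℝ) / Γ)
    (Q := fun _ _ => 1 / (Γ : ℝ)) (fun _ _ => by positivity) (fun _ _ => by positivity)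
    (fun _ _ => by positivity) (fun _ => by simp [hΓ']) (fun _ => by simp [hΓ'])
    (fun _ c => by rw [← Finset.mul_sum, sum_Jper_column hw, mul_one]) hε
  refine ⟨K / Γ, fun ℓ m hℓ => le_of_mul_size_le hΓ hℓ ?_⟩
  have h := hK ℓ m hℓ
  rw [← mul_miPer P hΔ hΓ w hℓ, blockGain_const, Fintype.card_fin, div_div, ← Nat.cast_mul,
    ← mul_miCS P hΔ (Nat.mul_pos hΓ hℓ) (Γ * m) finProdFinEquiv, Nat.cast_mul] at h
  exact h

/-- Each row of the periodic system is replaced by a row of one of `Γ` independent uncoupled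
systems, chosen with probabilities given by the normalized variance profile. -/
lemma exists_miCS_le (hΔ : 0 < Δ) {Γ w : ℕ} (hw : 2 * w + 1 ≤ Γ) {ε : ℝ} (hε : 0 < ε) :
    ∃ K : ℝ, ∀ ℓ m : ℕ, 0 < ℓ →
      miCS P Δ ℓ m ≤ miPer P Δ Γ w ℓ m + ε * ((m : ℝ) / ℓ) + K / ℓ := by
  have hΓ : 0 < Γ := by omega
  have : Nonempty (Fin Γ) := ⟨⟨0, hΓ⟩⟩
  obtain ⟨K, hK⟩ := exists_blockGain_le (p := fun k => (P.p k : ℝ)) (fun k => (P.p k).2)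
    (sum_weights_eq_one P) (fun k j => P.a k j / √Δ)
    (J := fun r c => (Jper Γ w r c : ℝ) / Γ) (J' := fun d d' : Fin Γ => if d = d' then 1 else 0)
    (Q := fun r c => (Jper Γ w r c : ℝ) / Γ) (fun _ _ => by positivity)
    (fun _ _ => by split_ifs <;> norm_num) (fun _ _ => by positivity) (sum_Jper hw)
    (sum_Jper_column hw) (fun r c => by simp) hε
  refine ⟨K / Γ, fun ℓ m hℓ => le_of_mul_size_le hΓ hℓ ?_⟩
  have h := hK ℓ m hℓ
  rw [← mul_miPer P hΔ hΓ w hℓ, blockGain_diagonal (p := fun k => (P.p k : ℝ)) (fun k => (P.p k).2)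
      (sum_weights_eq_one P),
    Fintype.card_fin, ← mul_miCS P hΔ hℓ m (Equiv.refl (Fin ℓ)), ← mul_assoc] at h
  exact h

lemma tendsto_miPer [(thermodynamicLimit B α).NeBot] (hB : 0 < B) (hΔ : 0 < Δ) {i : ℝ}
    (hi : Tendsto (fun q : ℕ × ℕ => miCS P Δ q.1 q.2) (thermodynamicLimit B α) (𝓝 i))
    {Γ w : ℕ} (hw : 2 * w + 1 ≤ Γ) :
    Tendsto (fun q : ℕ × ℕ => miPer P Δ Γ w q.1 q.2) (thermodynamicLimit B α) (𝓝 i) := by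
  refine tendsto_of_le_of_le hB hi (hi.comp (tendsto_scale (Γ := Γ) (by omega)))
    (fun ε hε => ?_) (fun ε hε => ?_)
  · obtain ⟨K, hK⟩ := exists_miCS_le P hΔ hw hε
    exact ⟨K, eventually_size_pos.mono fun q hq => hK q.1 q.2 hq⟩
  · obtain ⟨K, hK⟩ := exists_miPer_le P hΔ hw hε
    exact ⟨K, eventually_size_pos.mono fun q hq => hK q.1 q.2 hq⟩

lemma mul_miSeed_eq_blockGain (hΔ : 0 < Δ) {Γ w : ℕ} (hw : 2 * w + 1 ≤ Γ) {ℓ : ℕ} (hℓ : 0 < ℓ)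
    (m : ℕ) : (Γ * ℓ : ℝ) * miSeed P Δ Γ w ℓ m = blockGain (fun k j => P.a k j / √Δ)
      (fun k => (P.p k : ℝ))
      (fun r c => if IsBoundary w c then 0 else (Jper Γ w r c : ℝ) / Γ) ℓ m :=
  (mul_miSeed P hΔ hw hℓ m).trans (gain_map_mask_blockRow _ (fun c => IsBoundary w c) ℓ m)

lemma exists_tendsto_miSeed [(thermodynamicLimit B α).NeBot] (hB : 0 < B) (hα : 0 < α)
    (hΔ : 0 < Δ) {Γ w : ℕ} (hw : 2 * w + 1 ≤ Γ) :
    ∃ i, Tendsto (fun q : ℕ × ℕ => miSeed P Δ Γ w q.1 q.2) (thermodynamicLimit B α) (𝓝 i) := by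
  have hΓ : 0 < Γ := by omega
  have : Nonempty (Fin Γ) := ⟨⟨0, hΓ⟩⟩
  obtain ⟨i, hi⟩ := exists_tendsto_blockGain (α := α) (x := fun k j => P.a k j / √Δ)
    (p := fun k => (P.p k : ℝ))
    (J := fun r c => if IsBoundary w c then 0 else (Jper Γ w r c : ℝ) / Γ) hB hα
    (fun k => (P.p k).2) (sum_weights_eq_one P) (fun _ _ => by split_ifs <;> positivity)
  refine ⟨i / Γ, (hi.div_const _).congr' ?_⟩
  filter_upwards [eventually_size_pos] with q hq
  have h1 : (q.1 : ℝ) ≠ 0 := by exact_mod_cast hq.ne'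
  have h2 : (Γ : ℝ) ≠ 0 := by exact_mod_cast hΓ.ne'
  rw [← mul_miSeed_eq_blockGain P hΔ hw hq]
  field_simp

/-- Deleting the entries of the rows in the boundary sections loses information. -/
lemma exists_miSeed_le (hΔ : 0 < Δ) {Γ w : ℕ} (hw : 2 * w + 1 ≤ Γ) {ε : ℝ} (hε : 0 < ε) :
    ∃ K : ℝ, ∀ ℓ m : ℕ, 0 < ℓ →
      miSeed P Δ Γ w ℓ m ≤ miPer P Δ Γ w ℓ m + ε * ((m : ℝ) / ℓ) + K / ℓ := by
  have hΓ : 0 < Γ := by omega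
  have : Nonempty (Fin Γ) := ⟨⟨0, hΓ⟩⟩
  obtain ⟨K, hK⟩ := exists_blockGain_le (p := fun k => (P.p k : ℝ)) (fun k => (P.p k).2)
    (sum_weights_eq_one P) (fun k j => P.a k j / √Δ)
    (J := fun r c => (Jper Γ w r c : ℝ) / Γ)
    (J' := fun r c => if IsBoundary w c then 0 else (Jper Γ w r c : ℝ) / Γ)
    (Q := fun r i => if r = i then 1 else 0) (fun _ _ => by positivity)
    (fun _ _ => by split_ifs <;> positivity) (fun _ _ => by split_ifs <;> norm_num)
    (fun _ => by simp) (fun _ => by simp)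
    (fun r c => by
      simp only [ite_mul, one_mul, zero_mul, Finset.sum_ite_eq, Finset.mem_univ, if_true]
      split_ifs
      · positivity
      · exact le_rfl) hε
  refine ⟨K / Γ, fun ℓ m hℓ => le_of_mul_size_le hΓ hℓ ?_⟩
  have h := hK ℓ m hℓ
  rw [← mul_miPer P hΔ hΓ w hℓ, ← mul_miSeed_eq_blockGain P hΔ hw hℓ, Fintype.card_fin] at h
  exact h

/-- The boundary sections are a fraction of order `w / Γ` of all the sections, and the entropy of
each of them is bounded. -/
lemma miPer_le_miSeed (hΔ : 0 < Δ) {Γ w : ℕ} (hw : 2 * w + 1 ≤ Γ) {ℓ : ℕ} (hℓ : 0 < ℓ) (m : ℕ) :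
    miPer P Δ Γ w ℓ m ≤ miSeed P Δ Γ w ℓ m + 16 * w * Real.log P.K / Γ := by
  have hΓ : 0 < Γ := by omega
  have h1 : (0 : ℝ) < Γ := by exact_mod_cast hΓ
  have h2 : (0 : ℝ) < ℓ := by exact_mod_cast hℓ
  refine le_of_mul_le_mul_left ?_ (mul_pos h1 h2)
  have h := gain_le_gain_mask (x := fun k j => P.a k j / √Δ) (C := Fin Γ × Fin ℓ)
    (w := prior (Fin Γ × Fin ℓ) fun k => (P.p k : ℝ)) (fun c => IsBoundary w c.1)
    ((Finset.univ : Finset (Fin Γ × Fin m)).toList.map fun μ =>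
      blockRow (fun r c => (Jper Γ w r c : ℝ) / Γ) ℓ μ.1) (prior_nonneg fun k => (P.p k).2)
    (sum_prior (sum_weights_eq_one P))
  rw [List.map_map] at h
  have hc : (Fintype.card {c : Fin Γ × Fin ℓ // IsBoundary w c.1} : ℝ) ≤ 8 * w * ℓ := by
    exact_mod_cast card_boundary_sections_le ℓ
  have hl : 0 ≤ Real.log P.K := Real.log_natCast_nonneg _
  have e : (Γ * ℓ : ℝ) * (miSeed P Δ Γ w ℓ m + 16 * w * Real.log P.K / Γ) =
      (Γ * ℓ : ℝ) * miSeed P Δ Γ w ℓ m + 2 * (8 * w * ℓ * Real.log P.K) := by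
    field_simp
    ring
  rw [e, mul_miPer P hΔ hΓ w hℓ, mul_miSeed P hΔ hw hℓ]
  refine h.trans ?_
  rw [Fintype.card_fin]
  gcongr
  exact le_rfl

lemma seed_limit_bounds [(thermodynamicLimit B α).NeBot] (hB : 0 < B) (hΔ : 0 < Δ) {i j : ℝ}
    (hi : Tendsto (fun q : ℕ × ℕ => miCS P Δ q.1 q.2) (thermodynamicLimit B α) (𝓝 i))
    {Γ w : ℕ} (hw : 2 * w + 1 ≤ Γ)
    (hj : Tendsto (fun q : ℕ × ℕ => miSeed P Δ Γ w q.1 q.2) (thermodynamicLimit B α) (𝓝 j)) :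
    i - 16 * w * Real.log P.K / Γ ≤ j ∧ j ≤ i := by
  have hper := tendsto_miPer P hB hΔ hi hw
  refine ⟨sub_le_iff_le_add.2 (le_of_tendsto_of_tendsto hper (hj.add_const _) ?_),
    le_of_tendsto_of_le hB hper hj fun ε hε => ?_⟩
  · exact eventually_size_pos.mono fun q hq => miPer_le_miSeed P hΔ hw hq q.2
  · obtain ⟨K, hK⟩ := exists_miSeed_le P hΔ hw hε
    exact ⟨K, eventually_size_pos.mono fun q hq => hK q.1 q.2 hq⟩

end Comparison

end LinearEstimation

end

theorem mainTheorem6 (B : ℕ) (hB : 0 < B) (P : LinearEstimation.DiscretePrior B)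
    (Δ α : ℝ) (hΔ : 0 < Δ) (hα : 0 < α) :
    ∃ i : ℝ,
      Tendsto (fun q : ℕ × ℕ => LinearEstimation.miCS P Δ q.1 q.2)
        (LinearEstimation.thermodynamicLimit B α) (𝓝 i) ∧
      (∀ Γ w : ℕ, Odd Γ → w ≤ (Γ - 1) / 2 →
        Tendsto (fun q : ℕ × ℕ => LinearEstimation.miPer P Δ Γ w q.1 q.2)
          (LinearEstimation.thermodynamicLimit B α) (𝓝 i)) ∧
      (∀ w : ℕ, ∃ iSeed : ℕ → ℝ,
        (∀ Γ : ℕ, Odd Γ → w ≤ (Γ - 1) / 2 →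
          Tendsto (fun q : ℕ × ℕ => LinearEstimation.miSeed P Δ Γ w q.1 q.2)
            (LinearEstimation.thermodynamicLimit B α) (𝓝 (iSeed Γ))) ∧
        Tendsto iSeed (atTop ⊓ 𝓟 {Γ : ℕ | Odd Γ}) (𝓝 i)) := by
  have := LinearEstimation.thermodynamicLimit_neBot hB hα
  obtain ⟨i, hi⟩ := LinearEstimation.exists_tendsto_miCS (α := α) P hB hα hΔ
  refine ⟨i, hi, fun Γ w hΓ hw => LinearEstimation.tendsto_miPer P hB hΔ hi
    (LinearEstimation.two_mul_add_one_le hΓ hw), fun w => ?_⟩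
  have hex : ∀ Γ : ℕ, ∃ j : ℝ, 2 * w + 1 ≤ Γ →
      Tendsto (fun q : ℕ × ℕ => LinearEstimation.miSeed P Δ Γ w q.1 q.2)
        (LinearEstimation.thermodynamicLimit B α) (𝓝 j) := by
    intro Γ
    by_cases h : 2 * w + 1 ≤ Γ
    · obtain ⟨j, hj⟩ := LinearEstimation.exists_tendsto_miSeed (α := α) P hB hα hΔ h
      exact ⟨j, fun _ => hj⟩
    · exact ⟨0, fun h' => absurd h' h⟩
  choose iSeed hSeed using hex
  refine ⟨iSeed, fun Γ hΓ hw => hSeed Γ (LinearEstimation.two_mul_add_one_le hΓ hw),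
    Tendsto.mono_left ?_ inf_le_left⟩
  have hb : ∀ᶠ Γ : ℕ in atTop, i - 16 * w * Real.log P.K / Γ ≤ iSeed Γ ∧ iSeed Γ ≤ i := by
    filter_upwards [eventually_ge_atTop (2 * w + 1)] with Γ hΓ
    exact LinearEstimation.seed_limit_bounds P hB hΔ hi hΓ (hSeed Γ hΓ)
  refine tendsto_of_tendsto_of_tendsto_of_le_of_le' ?_ tendsto_const_nhds
    (hb.mono fun _ h => h.1) (hb.mono fun _ h => h.2)
  simpa using (tendsto_const_div_atTop_nhds_zero_nat (16 * w * Real.log P.K)).const_sub i
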